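/- **Definitions.** Let $\alpha,\rho>0$. A probability distribution on $\mathbb R^d$ is *$(\alpha,\rho)$-semi-product* if for a random vector $\eta$ with this law: (1) each coordinate $\eta_j$ is symmetric about $0$; (2) $\mathbb P(|\eta_j|\le\rho)\ge\alpha$ for every $j$; (3) the random vectors $(\operatorname{sign}\eta_j)_{j=1}^d$ and $(|\eta_j|)_{j=1}^d$ are independent, and $\operatorname{sign}\eta_1,\dots,\operatorname{sign}\eta_d$ are mutually independent. A distribution $D$ on $\mathbb R^d$ is $(\alpha,\rho)$-semi-product *with location $\mu^*\in\mathbb R^d$* if $y-\mu^*$ has an $(\alpha,\rho)$-semi-product law when $y\sim D$. Points $Z_1,\dots,Z_n$ are an *$\varepsilon$-corruption* of $X_1,\dots,X_n$ if $Z_i=X_i$ for at least $(1-\varepsilon)n$ indices $i$. Running time is counted in the real-RAM model: unit-cost exact field operations and comparisons on real numbers, with rational constants only. **Theorem.** There are absolute constants $C,K>0$ and a single deterministic algorithm which takes as input $n,d\ge 1$, reals $\rho,\varepsilon$ and points $Z_1,\dots,Z_n\in\mathbb R^d$, runs on every input in time $n^{O(1)}d^{O(1)}$, outputs a point $\hat\mu=\hat\mu(Z)\in\mathbb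 R^d$, and has the following property. Let $d\ge1$, $\alpha,\rho,\varepsilon>0$ and $\delta\in(0,1)$, with $\delta\le 1/2$ in case $d=1$. Let $D$ be an $(\alpha,\rho)$-semi-product distribution with location $\mu^*\in\mathbb R^d$, and suppose that $$\sqrt[3]{\varepsilon}\le\frac{\alpha}{C}\qquad\text{and}\qquad n\ge C\cdot\frac{d\log d+\log(1/\delta)}{\alpha^6\varepsilon^2\log(1/\varepsilon)}.$$ Let $X_1,\dots,X_n$ be i.i.d. samples from $D$. Then with probability at least $1-\delta$, for every $\varepsilon$-corruption $Z$ of $X$ (so also for one chosen by an adversary who sees all the samples), the output of the algorithm on $n,d,\rho,\varepsilon,Z$ satisfies $$\|\hat\mu-\mu^*\|\le K\rho\left[\sqrt{\frac{d\log d+\log(1/\delta)}{\alpha^4 n}}+\frac{\varepsilon\sqrt{\log(1/\varepsilon)}}{\alpha^3}\right].$$ -/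

import Mathlib

open MeasureTheory ProbabilityTheory

/-! ### Distributions and corruptions -/

/-- The law `D` of a random vector `η` in `ℝ^d` is `(α, ρ)`-semi-product. -/
structure IsSemiProduct {d : ℕ} (α ρ : ℝ) (D : Measure (EuclideanSpace ℝ (Fin d))) : Prop where
  /-- every coordinate is symmetric about `0` -/
  symm : ∀ j : Fin d, D.map (fun η => η j) = D.map (fun η => -η j)
  /-- every coordinate has mass at least `α` in `[-ρ, ρ]` -/
  mass : ∀ j : Fin d, α ≤ D.real {η | |η j| ≤ ρ}
  /-- the vector of signs is independent of the vector of absolute values -/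
  indep_sign_abs :
    IndepFun (fun η (j : Fin d) => Real.sign (η j)) (fun η (j : Fin d) => |η j|) D
  /-- the signs of the coordinates are mutually independent -/
  indep_signs : iIndepFun (fun (j : Fin d) η => Real.sign (η j)) D

/-- `D` is `(α, ρ)`-semi-product with location `μ`: if `y ∼ D`, then the law of `y - μ` is
`(α, ρ)`-semi-product. -/
def IsSemiProductWithLocation {d : ℕ} (α ρ : ℝ) (μ : EuclideanSpace ℝ (Fin d))
    (D : Measure (EuclideanSpace ℝ (Fin d))) : Prop :=
  IsSemiProduct α ρ (D.map (fun y => y - μ))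

/-- `Z` agrees with `X` on at least a `(1 - ε)`-fraction of the `n` points; the other points are
arbitrary. -/
def IsCorruption {n d : ℕ} (ε : ℝ) (X Z : Fin n → EuclideanSpace ℝ (Fin d)) : Prop :=
  (1 - ε) * (n : ℝ) ≤ (Set.ncard {i | Z i = X i} : ℝ)

/-! ### Programs over the reals with unit cost

While-programs on a real random access machine: natural-number variables used for counting and
addressing, and two-dimensional arrays of exact real numbers. The only operations on reals are the
four field operations and comparison, and the only real constants are rational. -/

/-- Memory contents: the value of every natural-number variable, and the real number in every cell
`(i, j)` of every array `a`. -/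
structure Store where
  nat : ℕ → ℕ
  real : ℕ → ℕ → ℕ → ℝ

/-- Natural-number expressions. -/
inductive NatExpr : Type
  | const (k : ℕ)
  | var (x : ℕ)
  | add (e₁ e₂ : NatExpr)
  | sub (e₁ e₂ : NatExpr)

/-- Value of a natural-number expression (with truncated subtraction). -/
def NatExpr.eval (s : Store) : NatExpr → ℕ
  | .const k => k
  | .var x => s.nat x
  | .add e₁ e₂ => e₁.eval s + e₂.eval s
  | .sub e₁ e₂ => e₁.eval s - e₂.eval s

/-- Real expressions; `cell a i j` reads the cell `(i, j)` of the array `a`. -/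
inductive RealExpr : Type
  | const (q : ℚ)
  | ofNat (e : NatExpr)
  | cell (a : ℕ) (i j : NatExpr)
  | add (e₁ e₂ : RealExpr)
  | sub (e₁ e₂ : RealExpr)
  | mul (e₁ e₂ : RealExpr)
  | div (e₁ e₂ : RealExpr)

/-- Value of a real expression (division by zero returns zero). -/
noncomputable def RealExpr.eval (s : Store) : RealExpr → ℝ
  | .const q => (q : ℝ)
  | .ofNat e => ((e.eval s : ℕ) : ℝ)
  | .cell a i j => s.real a (i.eval s) (j.eval s)
  | .add e₁ e₂ => e₁.eval s + e₂.eval s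
  | .sub e₁ e₂ => e₁.eval s - e₂.eval s
  | .mul e₁ e₂ => e₁.eval s * e₂.eval s
  | .div e₁ e₂ => e₁.eval s / e₂.eval s

/-- Tests. -/
inductive Test : Type
  | natLe (e₁ e₂ : NatExpr)
  | realLe (e₁ e₂ : RealExpr)
  | not (b : Test)
  | and (b₁ b₂ : Test)

/-- Truth of a test. -/
def Test.holds (s : Store) : Test → Prop
  | .natLe e₁ e₂ => e₁.eval s ≤ e₂.eval s
  | .realLe e₁ e₂ => e₁.eval s ≤ e₂.eval s
  | .not b => ¬ b.holds s
  | .and b₁ b₂ => b₁.holds s ∧ b₂.holds s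

/-- Programs. -/
inductive Prog : Type
  | nop
  | setNat (x : ℕ) (e : NatExpr)
  | setCell (a : ℕ) (i j : NatExpr) (e : RealExpr)
  | seq (p q : Prog)
  | cond (b : Test) (p q : Prog)
  | loop (b : Test) (p : Prog)

/-- The store after assigning `v` to the natural-number variable `x`. -/
def Store.setNat (s : Store) (x v : ℕ) : Store :=
  { s with nat := fun y => if y = x then v else s.nat y }

/-- The store after writing `v` into the cell `(i, j)` of the array `a`. -/
def Store.setCell (s : Store) (a i j : ℕ) (v : ℝ) : Store :=
  { s with real := fun a' i' j' =>
      if a' = a ∧ i' = i ∧ j' = j then v else s.real a' i' j' }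

/-- `Run p s t s'`: started in the store `s`, the program `p` halts in the store `s'` after `t`
steps. Every executed assignment and every evaluated test is one step; the expressions in a fixed
program have bounded size, so that charging each operation in them instead changes the running time
only by a constant factor. -/
inductive Run : Prog → Store → ℕ → Store → Prop
  | nop (s : Store) : Run .nop s 1 s
  | setNat (x : ℕ) (e : NatExpr) (s : Store) : Run (.setNat x e) s 1 (s.setNat x (e.eval s))
  | setCell (a : ℕ) (i j : NatExpr) (e : RealExpr) (s : Store) :
      Run (.setCell a i j e) s 1 (s.setCell a (i.eval s) (j.eval s) (e.eval s))
  | seq {p q : Prog} {s s' s'' : Store} {t t' : ℕ} (hp : Run p s t s') (hq : Run q s' t' s'') :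
      Run (.seq p q) s (t + t') s''
  | condTrue {b : Test} {p q : Prog} {s s' : Store} {t : ℕ} (hb : b.holds s) (hp : Run p s t s') :
      Run (.cond b p q) s (1 + t) s'
  | condFalse {b : Test} {p q : Prog} {s s' : Store} {t : ℕ} (hb : ¬ b.holds s)
      (hq : Run q s t s') : Run (.cond b p q) s (1 + t) s'
  | loopDone {b : Test} {p : Prog} {s : Store} (hb : ¬ b.holds s) : Run (.loop b p) s 1 s
  | loopStep {b : Test} {p : Prog} {s s' s'' : Store} {t t' : ℕ} (hb : b.holds s)
      (hp : Run p s t s') (hl : Run (.loop b p) s' t' s'') : Run (.loop b p) s (1 + t + t') s''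

/-- Execution is deterministic: the final store and the number of steps are determined by the
program and the initial store. -/
theorem Run.deterministic {p : Prog} {s s₁ s₂ : Store} {t₁ t₂ : ℕ}
    (h₁ : Run p s t₁ s₁) (h₂ : Run p s t₂ s₂) : t₁ = t₂ ∧ s₁ = s₂ := by
  induction h₁ generalizing t₂ s₂ with
  | nop s => cases h₂; exact ⟨rfl, rfl⟩
  | setNat x e s => cases h₂; exact ⟨rfl, rfl⟩
  | setCell a i j e s => cases h₂; exact ⟨rfl, rfl⟩
  | seq hp hq ihp ihq =>
    cases h₂ with
    | seq hp' hq' =>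
      obtain ⟨rfl, rfl⟩ := ihp hp'
      obtain ⟨rfl, rfl⟩ := ihq hq'
      exact ⟨rfl, rfl⟩
  | condTrue hb hp ih =>
    cases h₂ with
    | condTrue hb' hp' => obtain ⟨rfl, rfl⟩ := ih hp'; exact ⟨rfl, rfl⟩
    | condFalse hb' hq' => exact absurd hb hb'
  | condFalse hb hq ih =>
    cases h₂ with
    | condTrue hb' hp' => exact absurd hb' hb
    | condFalse hb' hq' => obtain ⟨rfl, rfl⟩ := ih hq'; exact ⟨rfl, rfl⟩
  | loopDone hb =>
    cases h₂ with
    | loopDone hb' => exact ⟨rfl, rfl⟩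
    | loopStep hb' hp' hl' => exact absurd hb' hb
  | loopStep hb hp hl ihp ihl =>
    cases h₂ with
    | loopDone hb' => exact absurd hb hb'
    | loopStep hb' hp' hl' =>
      obtain ⟨rfl, rfl⟩ := ihp hp'
      obtain ⟨rfl, rfl⟩ := ihl hl'
      exact ⟨rfl, rfl⟩

/-- Initial store on the input `(n, d, ρ, ε, Z)`: the variables `0`, `1` hold `n`, `d`, the cell
`(0, 0)` of the arrays `0`, `1` holds `ρ`, `ε`, the array `2` holds the `n` points of the sample as
its rows, and everything else is zero. -/
noncomputable def inputStore (n d : ℕ) (ρ ε : ℝ) (Z : Fin n → EuclideanSpace ℝ (Fin d)) :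
    Store where
  nat
    | 0 => n
    | 1 => d
    | _ => 0
  real
    | 0, 0, 0 => ρ
    | 1, 0, 0 => ε
    | 2, i, j => if h : i < n ∧ j < d then Z ⟨i, h.1⟩ ⟨j, h.2⟩ else 0
    | _, _, _ => 0

/-- The output vector: the first `d` entries of row `0` of the array `3`. -/
noncomputable def outputVector (d : ℕ) (s : Store) : EuclideanSpace ℝ (Fin d) :=
  WithLp.toLp 2 (fun j : Fin d => s.real 3 0 j)

/-- A location estimator for samples of any size `n` in any dimension `d`; its further arguments
are the scale `ρ`, the corruption level `ε` and the sample. -/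
abbrev Estimator : Type :=
  (n d : ℕ) → ℝ → ℝ → (Fin n → EuclideanSpace ℝ (Fin d)) → EuclideanSpace ℝ (Fin d)

/-- The program `p` computes the estimator `A` in time `n^{O(1)} d^{O(1)}`, on all inputs. -/
def ComputesInPolyTime (p : Prog) (A : Estimator) : Prop :=
  ∃ c k : ℕ, ∀ (n d : ℕ), 1 ≤ n → 1 ≤ d →
    ∀ (ρ ε : ℝ) (Z : Fin n → EuclideanSpace ℝ (Fin d)),
      ∃ (t : ℕ) (s : Store), Run p (inputStore n d ρ ε Z) t s ∧
        t ≤ c * n ^ k * d ^ k ∧ outputVector d s = A n d ρ ε Z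

/-! Put b = 3ρ and truncate the residuals X_i - u coordinatewise at level b. Truncation is odd, so
for u = μ the truncated vector is, given the absolute values of the noise, a linear image of
independent centred signs. Hence it is centred, it is sub-Gaussian at scale b in every direction,
and different coordinates are uncorrelated. The variances of the single coordinates are unknown but
at most b². Every second-moment comparison therefore uses only the off-diagonal part of the moment
matrix.

Probability enters once. Chernoff bounds for the directions of a finite grid, extended to all
directions by a polarisation argument (`IsQuad.le_of_net`), show that the clean sample is a
`GoodSample` outside an event of probability δ (`measure_not_goodSample_le`). This means that the
mean of the truncated residuals at μ is O(bε√log(1/ε)), their off-diagonal second moment is O(b²ε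
log(1/ε)), no 3ε-fraction of the points carries more second moment than that, and each coordinate
has few points far out on either side. The rest is deterministic, hence uniform over the choices of
the adversary.

The filter removes weight in proportion to the scores of the highest scoring points. As long as the
off-diagonal excess is large, the corrupted points have the larger share of the removed weight
(`corrupted_mass_gt`). Every step also kills a point, so a small excess occurs before the sample is
exhausted (`exists_small_excess`). A small excess bounds the off-diagonal form in all directions
(`offDiag_le_of_excess`), and by Cauchy–Schwarz the weighted mean of the corrupted sample is then
close to the clean one (`weighted_mean_close`). The scoring directions are the columns of H^K, where
H is the moment matrix with diagonal b² and K = 2^n comes from repeated squaring. Exact unit-cost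
arithmetic makes this an eigenvector computation with negligible error.

The descent starts at a coordinatewise median u₀, which is within ρ of μ in every coordinate. Moving
the centre u by the mean of the truncated residuals contracts u - μ, because clipping acts as the
identity on the α-fraction of points near μ (`descent_step`). Off the centre, regularity is lost
only by a term of order bR with R = ‖u - μ‖ (`Regular.perturb`). It enters the error as √(εbR),
which AM–GM splits into a small multiple of αR and a term bε/α (`descent_recursion`). The error thus
shrinks by the factor 1 - α/4 up to an additive O(ρε√log(1/ε)/α), which gives a final error
O(ρε√log(1/ε)/α²), better than required.

For the running time, the algorithm is written in a small language of terms with bounded sums and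
maxima and of commands with bounded repetition. Once and for all, its compiler is proved correct and
polynomial (`Cmd.correct`). -/

/-! ### A structured language of array assignments, compiled to programs -/

/-- Loop bounds: `1`, the sample size, the dimension. -/
inductive Size : Type
  | one
  | samples
  | dims

def Size.eval (n d : ℕ) : Size → ℕ
  | .one => 1
  | .samples => n
  | .dims => d

def Size.toNatExpr : Size → NatExpr
  | .one => .const 1
  | .samples => .var 0
  | .dims => .var 1

/-- Indices: `0` or a loop variable. -/
inductive Idx : Type
  | zero
  | var (x : ℕ)

def Idx.eval (env : ℕ → ℕ) : Idx → ℕ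
  | .zero => 0
  | .var x => env x

def Idx.toNatExpr (base : ℕ) : Idx → NatExpr
  | .zero => .const 0
  | .var x => .var (base + x)

/-- The contents of the sixteen arrays visible to terms. -/
abbrev Mem : Type := Fin 16 → ℕ → ℕ → ℝ

/-- Terms with bounded sums and maxima. `ite s t e f` is `e` if `s ≤ t` and `f` otherwise. -/
inductive Term : Type
  | rat (q : ℚ)
  | size (z : Size)
  | num (x : Idx)
  | cell (a : Fin 16) (i j : Idx)
  | add (e f : Term)
  | sub (e f : Term)
  | mul (e f : Term)
  | div (e f : Term)
  | ite (s t e f : Term)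
  | sum (z : Size) (e : Term)
  | max (z : Size) (e : Term)

/-- Value of a term; `k` is the number of the next bound variable. -/
noncomputable def Term.eval (n d : ℕ) (m : Mem) : Term → ℕ → (ℕ → ℕ) → ℝ
  | .rat q, _, _ => (q : ℝ)
  | .size z, _, _ => (z.eval n d : ℝ)
  | .num x, _, env => (x.eval env : ℝ)
  | .cell a i j, _, env => m a (i.eval env) (j.eval env)
  | .add e f, k, env => e.eval n d m k env + f.eval n d m k env
  | .sub e f, k, env => e.eval n d m k env - f.eval n d m k env
  | .mul e f, k, env => e.eval n d m k env * f.eval n d m k env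
  | .div e f, k, env => e.eval n d m k env / f.eval n d m k env
  | .ite s t e f, k, env =>
      if s.eval n d m k env ≤ t.eval n d m k env then e.eval n d m k env else f.eval n d m k env
  | .sum z e, k, env =>
      ∑ x ∈ Finset.range (z.eval n d), e.eval n d m (k + 1) (Function.update env k x)
  | .max z e, k, env =>
      (Finset.range (z.eval n d)).fold Max.max 0
        (fun x => e.eval n d m (k + 1) (Function.update env k x))

/-- Commands: simultaneous assignment to the leading block of an array, composition, bounded
repetition. -/
inductive Cmd : Type
  | assign (a : Fin 16) (z₁ z₂ : Size) (e : Term)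
  | seq (c c' : Cmd)
  | rep (z : Size) (c : Cmd)

/-- The environment in which the first two loop variables are `i` and `j`. -/
def pairEnv (i j : ℕ) : ℕ → ℕ
  | 0 => i
  | 1 => j
  | _ => 0

noncomputable def Cmd.exec (n d : ℕ) : Cmd → Mem → Mem
  | .assign a z₁ z₂ e, m =>
      Function.update m a (fun i j =>
        if i < z₁.eval n d ∧ j < z₂.eval n d then e.eval n d m 2 (pairEnv i j) else m a i j)
  | .seq c c', m => c'.exec n d (c.exec n d m)
  | .rep z c, m => (c.exec n d)^[z.eval n d] m

/-- The counter is reset to zero on exit. Since all counters start at zero, code built from such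
loops leaves the natural-number variables unchanged. -/
def forLoop (x : ℕ) (z : Size) (p : Prog) : Prog :=
  .seq (.setNat x (.const 0))
    (.seq (.loop (.not (.natLe z.toNatExpr (.var x)))
        (.seq p (.setNat x (.add (.var x) (.const 1)))))
      (.setNat x (.const 0)))

/-- The scalar temporary number `t`. -/
def tempCell (t : ℕ) : RealExpr := .cell (17 + t) (.const 0) (.const 0)

def setTemp (t : ℕ) (e : RealExpr) : Prog := .setCell (17 + t) (.const 0) (.const 0) e

def binop (op : RealExpr → RealExpr → RealExpr) (t : ℕ) (p q : Prog) : Prog :=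
  .seq p (.seq q (setTemp t (op (tempCell t) (tempCell (t + 1)))))

/-- Code that evaluates a term into the temporary `t`. -/
def Term.compile (base : ℕ) : Term → ℕ → ℕ → Prog
  | .rat q, t, _ => setTemp t (.const q)
  | .size z, t, _ => setTemp t (.ofNat z.toNatExpr)
  | .num x, t, _ => setTemp t (.ofNat (x.toNatExpr base))
  | .cell a i j, t, _ => setTemp t (.cell a (i.toNatExpr base) (j.toNatExpr base))
  | .add e f, t, k => binop .add t (e.compile base t k) (f.compile base (t + 1) k)
  | .sub e f, t, k => binop .sub t (e.compile base t k) (f.compile base (t + 1) k)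
  | .mul e f, t, k => binop .mul t (e.compile base t k) (f.compile base (t + 1) k)
  | .div e f, t, k => binop .div t (e.compile base t k) (f.compile base (t + 1) k)
  | .ite r s e f, t, k =>
      .seq (r.compile base t k) (.seq (s.compile base (t + 1) k)
        (.cond (.realLe (tempCell t) (tempCell (t + 1))) (e.compile base t k) (f.compile base t k)))
  | .sum z e, t, k =>
      .seq (setTemp t (.const 0)) (forLoop (base + k) z
        (.seq (e.compile base (t + 1) (k + 1))
          (setTemp t (.add (tempCell t) (tempCell (t + 1))))))
  | .max z e, t, k =>
      .seq (setTemp t (.const 0)) (forLoop (base + k) z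
        (.seq (e.compile base (t + 1) (k + 1))
          (.cond (.realLe (tempCell t) (tempCell (t + 1))) (setTemp t (tempCell (t + 1))) .nop)))

/-- Code for commands. An assignment is buffered in the array `16`. -/
def Cmd.compile : Cmd → ℕ → Prog
  | .assign a z₁ z₂ e, base =>
      .seq (forLoop base z₁ (forLoop (base + 1) z₂ (.seq (e.compile base 0 2)
          (.setCell 16 (.var base) (.var (base + 1)) (tempCell 0)))))
        (forLoop base z₁ (forLoop (base + 1) z₂
          (.setCell a (.var base) (.var (base + 1)) (.cell 16 (.var base) (.var (base + 1))))))
  | .seq c c', base => .seq (c.compile base) (c'.compile base)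
  | .rep z c, base => forLoop base z (c.compile (base + 1))

/-! ### Correctness and running time of the compiled code -/

/-- All arrays, including the write buffer 16 and the temporaries from 17 on, which `Mem` hides. -/
abbrev RawMem : Type := ℕ → ℕ → ℕ → ℝ

/-- Started with counters `σ` and memory `r`, the program restores the counters, stops within `T`
steps, and leaves a memory with the property `Q`. -/
def Runs (p : Prog) (σ : ℕ → ℕ) (r : RawMem) (T : ℕ) (Q : RawMem → Prop) : Prop :=
  ∃ t r', Run p ⟨σ, r⟩ t ⟨σ, r'⟩ ∧ t ≤ T ∧ Q r'

theorem Runs.seq {p q : Prog} {σ : ℕ → ℕ} {r : RawMem} {T T' : ℕ} {Q Q' : RawMem → Prop}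
    (hp : Runs p σ r T Q) (hq : ∀ r', Q r' → Runs q σ r' T' Q') :
    Runs (.seq p q) σ r (T + T') Q' := by
  obtain ⟨t, r₁, h₁, ht, hQ⟩ := hp
  obtain ⟨t', r₂, h₂, ht', hQ'⟩ := hq r₁ hQ
  exact ⟨t + t', r₂, .seq h₁ h₂, by omega, hQ'⟩

theorem Runs.mono {p : Prog} {σ : ℕ → ℕ} {r : RawMem} {T T' : ℕ} {Q Q' : RawMem → Prop}
    (hp : Runs p σ r T Q) (hT : T ≤ T') (hQ : ∀ r', Q r' → Q' r') : Runs p σ r T' Q' := by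
  obtain ⟨t, r₁, h₁, ht, h⟩ := hp
  exact ⟨t, r₁, h₁, ht.trans hT, hQ _ h⟩

theorem Runs.of_le {p : Prog} {σ : ℕ → ℕ} {r : RawMem} {T T' : ℕ} {Q : RawMem → Prop}
    (hT : T ≤ T') (hp : Runs p σ r T Q) : Runs p σ r T' Q :=
  hp.mono hT fun _ h => h

theorem Runs.setCell {σ : ℕ → ℕ} {r : RawMem} {a : ℕ} {i j : NatExpr} {e : RealExpr}
    {Q : RawMem → Prop}
    (h : Q (fun a' i' j' => if a' = a ∧ i' = i.eval ⟨σ, r⟩ ∧ j' = j.eval ⟨σ, r⟩ then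
      e.eval ⟨σ, r⟩ else r a' i' j')) :
    Runs (.setCell a i j e) σ r 1 Q :=
  ⟨1, _, .setCell a i j e ⟨σ, r⟩, le_rfl, h⟩

theorem Size.eval_toNatExpr (z : Size) {n d : ℕ} {s : Store} (h0 : s.nat 0 = n)
    (h1 : s.nat 1 = d) : z.toNatExpr.eval s = z.eval n d := by
  cases z <;> simp [Size.toNatExpr, NatExpr.eval, Size.eval, h0, h1]

theorem Store.setNat_mk (σ : ℕ → ℕ) (r : RawMem) (x v : ℕ) :
    (Store.mk σ r).setNat x v = ⟨Function.update σ x v, r⟩ := by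
  simp only [Store.setNat, Store.mk.injEq, and_true]
  funext y
  simp [Function.update_apply]

/-- Induction on the number k of iterations left, with the loop invariant I. The condition 2 ≤ x
keeps the counter away from the variables holding n and d, so the bound of the loop does not change.
-/
theorem runs_loop {x : ℕ} {z : Size} {p : Prog} {σ : ℕ → ℕ} {n d T : ℕ}
    (hx : 2 ≤ x) (h0 : σ 0 = n) (h1 : σ 1 = d) (I : ℕ → RawMem → Prop)
    (hp : ∀ i < z.eval n d, ∀ r, I i r → Runs p (Function.update σ x i) r T (I (i + 1))) (k : ℕ) :
    ∀ (i : ℕ) (r : RawMem), i + k = z.eval n d → I i r →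
    ∃ t r', Run (.loop (.not (.natLe z.toNatExpr (.var x)))
        (.seq p (.setNat x (.add (.var x) (.const 1))))) ⟨Function.update σ x i, r⟩ t
        ⟨Function.update σ x (z.eval n d), r'⟩ ∧ t ≤ k * (T + 2) + 1 ∧ I (z.eval n d) r' := by
  have hz : ∀ (i : ℕ) (r : RawMem),
      z.toNatExpr.eval ⟨Function.update σ x i, r⟩ = z.eval n d := fun i r =>
    z.eval_toNatExpr (by simp [Function.update_of_ne (show 0 ≠ x by omega), h0])
      (by simp [Function.update_of_ne (show 1 ≠ x by omega), h1])
  induction k with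
  | zero =>
    intro i r hi hI
    obtain rfl : i = z.eval n d := by omega
    refine ⟨1, r, .loopDone ?_, by omega, hI⟩
    simp [Test.holds, hz, NatExpr.eval]
  | succ k ih =>
    intro i r hi hI
    obtain ⟨t, r₁, h₁, ht, hI₁⟩ := hp i (by omega) r hI
    obtain ⟨t', r₂, h₂, ht', hI₂⟩ := ih (i + 1) r₁ (by omega) hI₁
    refine ⟨1 + (t + 1) + t', r₂, .loopStep ?_ (.seq h₁ (.setNat _ _ _)) ?_, ?_, hI₂⟩
    · simp only [Test.holds, hz, NatExpr.eval, Function.update_self]; omega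
    · simpa [Store.setNat_mk, NatExpr.eval] using h₂
    · have : (k + 1) * (T + 2) = k * (T + 2) + (T + 2) := by ring
      omega

theorem runs_forLoop {x : ℕ} {z : Size} {p : Prog} {σ : ℕ → ℕ} {r : RawMem} {n d T : ℕ}
    (hx : 2 ≤ x) (hσ : σ x = 0) (h0 : σ 0 = n) (h1 : σ 1 = d) (I : ℕ → RawMem → Prop)
    (hp : ∀ i < z.eval n d, ∀ r, I i r → Runs p (Function.update σ x i) r T (I (i + 1)))
    (hI : I 0 r) :
    Runs (forLoop x z p) σ r (z.eval n d * (T + 2) + 3) (I (z.eval n d)) := by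
  obtain ⟨t, r', h, ht, hI'⟩ := runs_loop hx h0 h1 I hp (z.eval n d) 0 r (by omega) hI
  refine ⟨1 + (t + 1), r', ?_, by omega, hI'⟩
  -- The counter was zero before the loop, so the final reset restores σ exactly.
  have hs : ∀ i, Function.update (Function.update σ x i) x 0 = σ := by
    intro i; rw [Function.update_idem, ← hσ, Function.update_eq_self]
  refine .seq (.setNat _ _ _) (.seq (s' := ⟨Function.update σ x (z.eval n d), r'⟩) ?_ ?_)
  · simpa [Store.setNat_mk, NatExpr.eval] using h
  · have := Run.setNat x (.const 0) ⟨Function.update σ x (z.eval n d), r'⟩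
    rwa [Store.setNat_mk, show NatExpr.eval _ (.const 0) = 0 from rfl, hs] at this

/-- The visible part of the memory. -/
def visible (r : RawMem) : Mem := fun a => r a

theorem visible_congr {r r' : RawMem} {t : ℕ} (h : ∀ a < 17 + t, r' a = r a) :
    visible r' = visible r := by
  funext a; exact h _ (by have := a.2; omega)

/-- Time bounds are kept in the one-parameter form c * N ^ c, with N at least n and d. This family
is closed under sums and under loops of length at most N, so only the existence of c has to be
carried along. -/
theorem poly_bound_add {c c' N : ℕ} (hN : 1 ≤ N) :
    c * N ^ c + c' * N ^ c' ≤ (c + c') * N ^ (c + c') := by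
  rw [add_mul]
  exact add_le_add (Nat.mul_le_mul le_rfl (Nat.pow_le_pow_right hN (by omega)))
    (Nat.mul_le_mul le_rfl (Nat.pow_le_pow_right hN (by omega)))

theorem le_poly_bound {c N : ℕ} (hN : 1 ≤ N) : c ≤ c * N ^ c :=
  Nat.le_mul_of_pos_right _ (Nat.pow_pos hN)

theorem poly_bound_loop {c N M : ℕ} (hN : 1 ≤ N) (hM : M ≤ N) :
    M * (c * N ^ c + 2) + 3 ≤ (c + 5) * N ^ (c + 5) := by
  have h1 : N * (c * N ^ c + 2) ≤ (c + 2) * N ^ (c + 5) := by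
    have : N ^ (c + 1) ≤ N ^ (c + 5) := Nat.pow_le_pow_right hN (by omega)
    have h2 : N ≤ N ^ (c + 5) := by
      calc N = N ^ 1 := (pow_one N).symm
        _ ≤ _ := Nat.pow_le_pow_right hN (by omega)
    calc N * (c * N ^ c + 2) = c * N ^ (c + 1) + 2 * N := by ring
      _ ≤ c * N ^ (c + 5) + 2 * N ^ (c + 5) := by gcongr
      _ = _ := by ring
  have h3 : 1 ≤ N ^ (c + 5) := Nat.one_le_pow _ _ hN
  have h4 := Nat.mul_le_mul_right (c * N ^ c + 2) hM
  nlinarith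

theorem Size.eval_le (z : Size) {n d N : ℕ} (hN : 1 ≤ N) (hn : n ≤ N) (hd : d ≤ N) :
    z.eval n d ≤ N := by
  cases z <;> simpa [Size.eval]

/-- The term `e` is evaluated correctly by its code, in polynomial time. -/
def Term.Correct (e : Term) : Prop :=
  ∃ c, ∀ (n d N base t k : ℕ) (σ : ℕ → ℕ) (r : RawMem), 1 ≤ N → n ≤ N → d ≤ N → σ 0 = n → σ 1 = d →
    2 ≤ base → (∀ x, k ≤ x → σ (base + x) = 0) →
    Runs (e.compile base t k) σ r (c * N ^ c) (fun r' =>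
      r' (17 + t) 0 0 = e.eval n d (visible r) k (fun x => σ (base + x)) ∧
      ∀ a < 17 + t, r' a = r a)

theorem Idx.eval_toNatExpr (i : Idx) (base : ℕ) (σ : ℕ → ℕ) (r : RawMem) :
    (i.toNatExpr base).eval ⟨σ, r⟩ = i.eval (fun x => σ (base + x)) := by
  cases i <;> rfl

theorem runs_setTemp {σ : ℕ → ℕ} {r : RawMem} {t : ℕ} {e : RealExpr} {v : ℝ} {N c : ℕ}
    (hN : 1 ≤ N) (hc : 1 ≤ c) (he : e.eval ⟨σ, r⟩ = v) :
    Runs (setTemp t e) σ r (c * N ^ c) (fun r' => r' (17 + t) 0 0 = v ∧ ∀ a < 17 + t, r' a = r a) := by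
  refine Runs.mono (Runs.setCell (Q := fun r' => r' (17 + t) 0 0 = v ∧ ∀ a < 17 + t, r' a = r a)
    ⟨?_, ?_⟩) (hc.trans (le_poly_bound hN)) (fun _ h => h)
  · simp [NatExpr.eval, he]
  · intro a ha
    funext i j
    have : a ≠ 17 + t := by omega
    simp [this]

/-- The value of the first operand survives the evaluation of the second, because code for the
temporary t + 1 leaves all arrays below 17 + (t + 1) alone. -/
theorem correct_binop {e f g : Term} {op : RealExpr → RealExpr → RealExpr} {op' : ℝ → ℝ → ℝ}
    (hop : ∀ s x y, (op x y).eval s = op' (x.eval s) (y.eval s))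
    (hc : ∀ base t k, g.compile base t k = binop op t (e.compile base t k) (f.compile base (t + 1) k))
    (hg : ∀ n d m k env, g.eval n d m k env = op' (e.eval n d m k env) (f.eval n d m k env))
    (he : e.Correct) (hf : f.Correct) : g.Correct := by
  obtain ⟨c, he⟩ := he
  obtain ⟨c', hf⟩ := hf
  refine ⟨c + (c' + 1), fun n d N base t k σ r hN hn hd h0 h1 hb hz => ?_⟩
  rw [hc]
  refine Runs.of_le (T := c * N ^ c + (c' * N ^ c' + 1 * N ^ 1)) ?_
    (Runs.seq (he n d N base t k σ r hN hn hd h0 h1 hb hz) fun r₁ h₁ =>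
      Runs.seq (hf n d N base (t + 1) k σ r₁ hN hn hd h0 h1 hb hz) fun r₂ h₂ =>
        Runs.mono (runs_setTemp (c := 1) hN le_rfl rfl) le_rfl ?_)
  · calc _ ≤ c * N ^ c + (c' + 1) * N ^ (c' + 1) := by gcongr; exact poly_bound_add hN
      _ ≤ _ := poly_bound_add hN
  · rintro r₃ ⟨h₃, h₃'⟩
    refine ⟨?_, fun a ha => by rw [h₃' a ha, h₂.2 a (by omega), h₁.2 a ha]⟩
    rw [h₃, hop, hg]
    have e1 : (tempCell t).eval ⟨σ, r₂⟩ = e.eval n d (visible r) k (fun x => σ (base + x)) := by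
      rw [← h₁.1]; simp [tempCell, RealExpr.eval, NatExpr.eval, h₂.2 (17 + t) (by omega)]
    have e2 : (tempCell (t + 1)).eval ⟨σ, r₂⟩ =
        f.eval n d (visible r) k (fun x => σ (base + x)) := by
      rw [← visible_congr h₁.2, ← h₂.1]; simp [tempCell, RealExpr.eval, NatExpr.eval]
    rw [e1, e2]

theorem update_add_base (σ : ℕ → ℕ) (base k i : ℕ) :
    (fun x => Function.update σ (base + k) i (base + x)) =
      Function.update (fun x => σ (base + x)) k i := by
  funext x
  by_cases h : x = k
  · subst h; simp
  · rw [Function.update_of_ne h, Function.update_of_ne (by omega)]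

/-- Loops that accumulate the values of a term. -/
theorem correct_fold {e g : Term} {z : Size} {comb : ℝ → ℝ → ℝ} {step : ℕ → Prog}
    {F : ℕ → (ℕ → ℝ) → ℝ}
    (hF0 : ∀ f, F 0 f = 0) (hF : ∀ N f, F (N + 1) f = comb (F N f) (f N))
    (hstep : ∀ (t : ℕ) σ (r : RawMem), Runs (step t) σ r 2 (fun r' =>
      r' (17 + t) 0 0 = comb (r (17 + t) 0 0) (r (17 + (t + 1)) 0 0) ∧ ∀ a < 17 + t, r' a = r a))
    (hc : ∀ base t k, g.compile base t k = .seq (setTemp t (.const 0)) (forLoop (base + k) z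
        (.seq (e.compile base (t + 1) (k + 1)) (step t))))
    (hg : ∀ n d m k env, g.eval n d m k env =
      F (z.eval n d) (fun x => e.eval n d m (k + 1) (Function.update env k x)))
    (he : e.Correct) : g.Correct := by
  obtain ⟨c, he⟩ := he
  refine ⟨1 + (c + 2 + 5), fun n d N base t k σ r hN hn hd h0 h1 hb hz => ?_⟩
  rw [hc, hg]
  set f : ℕ → ℝ := fun x =>
    e.eval n d (visible r) (k + 1) (Function.update (fun x => σ (base + x)) k x) with hf
  refine Runs.mono (Runs.seq (runs_setTemp (c := 1) hN le_rfl rfl) fun r₁ h₁ =>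
    runs_forLoop (T := (c + 2) * N ^ (c + 2)) (by omega) (hz k le_rfl) h0 h1
      (fun i r' => r' (17 + t) 0 0 = F i f ∧ ∀ a < 17 + t, r' a = r a) ?_ ?_) ?_ fun _ h => h
  · intro i hi r₂ h₂
    refine Runs.of_le (T := c * N ^ c + 2) ?_
      (Runs.seq (he n d N base (t + 1) (k + 1) (Function.update σ (base + k) i) r₂
      hN hn hd (by rw [Function.update_of_ne (by omega), h0])
      (by rw [Function.update_of_ne (by omega), h1]) hb
      (fun x hx => by rw [Function.update_of_ne (by omega)]; exact hz x (by omega)))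
      fun r₃ h₃ => Runs.mono (hstep t _ r₃) le_rfl ?_)
    · calc c * N ^ c + 2 ≤ c * N ^ c + 2 * N ^ 2 := by gcongr; exact le_poly_bound hN
        _ ≤ _ := poly_bound_add hN
    · rintro r₄ ⟨h₄, h₄'⟩
      refine ⟨?_, fun a ha => by rw [h₄' a ha, h₃.2 a (by omega), h₂.2 a ha]⟩
      rw [h₄, h₃.1, h₃.2 (17 + t) (by omega), h₂.1, hF, update_add_base, visible_congr h₂.2]
  · refine ⟨?_, h₁.2⟩
    rw [h₁.1, hF0]; simp [RealExpr.eval]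
  · exact (add_le_add le_rfl (poly_bound_loop hN (z.eval_le hN hn hd))).trans (poly_bound_add hN)

theorem Term.correct (e : Term) : e.Correct := by
  induction e with
  | rat q =>
    exact ⟨1, fun n d N base t k σ r hN hn hd h0 h1 hb hz =>
      runs_setTemp hN le_rfl (by simp [RealExpr.eval, Term.eval])⟩
  | size z =>
    exact ⟨1, fun n d N base t k σ r hN hn hd h0 h1 hb hz =>
      runs_setTemp hN le_rfl (by
        simp only [RealExpr.eval, Term.eval]; rw [z.eval_toNatExpr (n := n) (d := d) h0 h1])⟩
  | num x =>
    exact ⟨1, fun n d N base t k σ r hN hn hd h0 h1 hb hz =>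
      runs_setTemp hN le_rfl (by simp only [RealExpr.eval, Term.eval, Idx.eval_toNatExpr])⟩
  | cell a i j =>
    exact ⟨1, fun n d N base t k σ r hN hn hd h0 h1 hb hz =>
      runs_setTemp hN le_rfl (by
        simp only [RealExpr.eval, Term.eval, Idx.eval_toNatExpr, visible])⟩
  | add e f he hf =>
    exact correct_binop (op := .add) (op' := (· + ·)) (fun _ _ _ => rfl) (fun _ _ _ => rfl)
      (fun _ _ _ _ _ => rfl) he hf
  | sub e f he hf =>
    exact correct_binop (op := .sub) (op' := (· - ·)) (fun _ _ _ => rfl) (fun _ _ _ => rfl)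
      (fun _ _ _ _ _ => rfl) he hf
  | mul e f he hf =>
    exact correct_binop (op := .mul) (op' := (· * ·)) (fun _ _ _ => rfl) (fun _ _ _ => rfl)
      (fun _ _ _ _ _ => rfl) he hf
  | div e f he hf =>
    exact correct_binop (op := .div) (op' := (· / ·)) (fun _ _ _ => rfl) (fun _ _ _ => rfl)
      (fun _ _ _ _ _ => rfl) he hf
  | ite p q e f hp hq he hf =>
    obtain ⟨c₁, hp⟩ := hp
    obtain ⟨c₂, hq⟩ := hq
    obtain ⟨c₃, he⟩ := he
    obtain ⟨c₄, hf⟩ := hf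
    refine ⟨c₁ + (c₂ + (1 + (c₃ + c₄))), fun n d N base t k σ r hN hn hd h0 h1 hb hz => ?_⟩
    refine Runs.mono (T := c₁ * N ^ c₁ + (c₂ * N ^ c₂ + (1 + (c₃ * N ^ c₃ + c₄ * N ^ c₄))))
      (Runs.seq (hp n d N base t k σ r hN hn hd h0 h1 hb hz) fun r₁ h₁ =>
        Runs.seq (hq n d N base (t + 1) k σ r₁ hN hn hd h0 h1 hb hz) fun r₂ h₂ =>
          (?_ : Runs _ σ r₂ (1 + (c₃ * N ^ c₃ + c₄ * N ^ c₄)) _)) ?_ fun _ h => h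
    · have hr : ∀ a < 17 + t, r₂ a = r a := fun a ha => by rw [h₂.2 a (by omega), h₁.2 a ha]
      have e1 : (tempCell t).eval ⟨σ, r₂⟩ = p.eval n d (visible r) k (fun x => σ (base + x)) := by
        rw [← h₁.1]; simp [tempCell, RealExpr.eval, NatExpr.eval, h₂.2 (17 + t) (by omega)]
      have e2 : (tempCell (t + 1)).eval ⟨σ, r₂⟩ =
          q.eval n d (visible r) k (fun x => σ (base + x)) := by
        rw [← visible_congr h₁.2, ← h₂.1]; simp [tempCell, RealExpr.eval, NatExpr.eval]
      by_cases hle : p.eval n d (visible r) k (fun x => σ (base + x)) ≤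
          q.eval n d (visible r) k (fun x => σ (base + x))
      · obtain ⟨τ, r₃, h₃, hτ, h₃'⟩ := he n d N base t k σ r₂ hN hn hd h0 h1 hb hz
        refine ⟨1 + τ, r₃, .condTrue (by simpa [Test.holds, e1, e2] using hle) h₃, by omega, ?_⟩
        refine ⟨?_, fun a ha => by rw [h₃'.2 a ha, hr a ha]⟩
        rw [h₃'.1, visible_congr hr]
        simp [Term.eval, hle]
      · obtain ⟨τ, r₃, h₃, hτ, h₃'⟩ := hf n d N base t k σ r₂ hN hn hd h0 h1 hb hz
        refine ⟨1 + τ, r₃, .condFalse (by simpa [Test.holds, e1, e2] using hle) h₃, by omega, ?_⟩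
        refine ⟨?_, fun a ha => by rw [h₃'.2 a ha, hr a ha]⟩
        rw [h₃'.1, visible_congr hr]
        simp [Term.eval, hle]
    · calc _ ≤ c₁ * N ^ c₁ + (c₂ * N ^ c₂ + (1 * N ^ 1 + (c₃ + c₄) * N ^ (c₃ + c₄))) := by
            gcongr
            · simpa using hN
            · exact poly_bound_add hN
        _ ≤ c₁ * N ^ c₁ + (c₂ * N ^ c₂ + (1 + (c₃ + c₄)) * N ^ (1 + (c₃ + c₄))) := by
            gcongr; exact poly_bound_add hN
        _ ≤ c₁ * N ^ c₁ + (c₂ + (1 + (c₃ + c₄))) * N ^ (c₂ + (1 + (c₃ + c₄))) := by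
            gcongr; exact poly_bound_add hN
        _ ≤ _ := poly_bound_add hN
  | sum z e he =>
    refine correct_fold (comb := (· + ·)) (F := fun N f => ∑ x ∈ Finset.range N, f x)
      (step := fun t => setTemp t (.add (tempCell t) (tempCell (t + 1)))) (by simp)
      (fun N f => Finset.sum_range_succ f N) ?_ (fun _ _ _ => rfl) (fun _ _ _ _ _ => rfl) he
    intro t σ r
    exact Runs.mono (runs_setTemp (N := 1) (c := 1) le_rfl le_rfl rfl) (by simp) fun _ h => h
  | max z e he =>
    refine correct_fold (comb := Max.max)
      (F := fun N f => (Finset.range N).fold Max.max 0 f)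
      (step := fun t => .cond (.realLe (tempCell t) (tempCell (t + 1)))
        (setTemp t (tempCell (t + 1))) .nop) (by simp)
      (fun N f => ?_) ?_ (fun _ _ _ => rfl) (fun _ _ _ _ _ => rfl) he
    · rw [Finset.range_add_one, Finset.fold_insert (by simp), max_comm]
    · intro t σ r
      by_cases h : r (17 + t) 0 0 ≤ r (17 + (t + 1)) 0 0
      · obtain ⟨τ, r', h₁, h₂, h₃⟩ := runs_setTemp (σ := σ) (r := r) (t := t) (e := tempCell (t + 1))
          (N := 1) (c := 1) le_rfl le_rfl rfl
        refine ⟨1 + τ, r', .condTrue (by simpa [Test.holds, tempCell, RealExpr.eval, NatExpr.eval]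
          using h) h₁, by simp at h₂; omega, ?_, h₃.2⟩
        rw [h₃.1, max_eq_right h]; simp [tempCell, RealExpr.eval, NatExpr.eval]
      · refine ⟨1 + 1, r, .condFalse (by simpa [Test.holds, tempCell, RealExpr.eval, NatExpr.eval]
          using h) (.nop _), by omega, ?_, fun _ _ => rfl⟩
        rw [max_eq_left (le_of_not_ge h)]

/-- Writing a block of an array cell by cell. -/
theorem runs_block {base : ℕ} {z₁ z₂ : Size} {p : Prog} {σ : ℕ → ℕ} {r : RawMem} {n d T a : ℕ}
    {v : ℕ → ℕ → ℝ} {keep : ℕ → Prop}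
    (hb : 2 ≤ base) (h0 : σ 0 = n) (h1 : σ 1 = d) (hz : ∀ x, base ≤ x → σ x = 0)
    (hp : ∀ i j r', i < z₁.eval n d → j < z₂.eval n d → (∀ a', keep a' → r' a' = r a') →
      Runs p (Function.update (Function.update σ base i) (base + 1) j) r' T
        (fun r'' => (∀ a', keep a' → r'' a' = r' a') ∧ ∀ i' j', r'' a i' j' =
          if i' = i ∧ j' = j then v i j else r' a i' j')) :
    Runs (forLoop base z₁ (forLoop (base + 1) z₂ p)) σ r
      (z₁.eval n d * ((z₂.eval n d * (T + 2) + 3) + 2) + 3)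
      (fun r' => (∀ a', keep a' → r' a' = r a') ∧ ∀ i j, r' a i j =
        if i < z₁.eval n d ∧ j < z₂.eval n d then v i j else r a i j) := by
  refine Runs.mono (runs_forLoop hb (hz _ le_rfl) h0 h1
    (fun i r' => (∀ a', keep a' → r' a' = r a') ∧ ∀ i' j', r' a i' j' =
      if i' < i ∧ j' < z₂.eval n d then v i' j' else r a i' j') ?_ ?_) le_rfl fun _ h => h
  · rintro i hi r₁ ⟨hk₁, h₁⟩
    refine Runs.mono (runs_forLoop (by omega) (by
      rw [Function.update_of_ne (by omega)]; exact hz _ (by omega))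
      (by rw [Function.update_of_ne (by omega), h0]) (by rw [Function.update_of_ne (by omega), h1])
      (fun j r' => (∀ a', keep a' → r' a' = r a') ∧ ∀ i' j', r' a i' j' =
        if i' = i ∧ j' < j then v i' j' else r₁ a i' j') ?_ ?_) le_rfl ?_
    · rintro j hj r₂ ⟨hk₂, h₂⟩
      refine Runs.mono (hp i j r₂ hi hj hk₂) le_rfl ?_
      rintro r₃ ⟨hk₃, h₃⟩
      refine ⟨fun a' ha' => by rw [hk₃ a' ha', hk₂ a' ha'], fun i' j' => ?_⟩
      rw [h₃, h₂]
      by_cases hi' : i' = i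
      · subst hi'
        rcases lt_trichotomy j' j with h | h | h
        · simp [h, h.ne, Nat.lt_succ_of_lt h]
        · simp [h]
        · simp [h.ne', h.not_gt, show ¬ j' < j + 1 by omega]
      · simp [hi']
    · exact ⟨hk₁, by simp⟩
    · rintro r₂ ⟨hk₂, h₂⟩
      refine ⟨hk₂, fun i' j' => ?_⟩
      rw [h₂, h₁]
      rcases lt_trichotomy i' i with h | h | h
      · simp [h, h.ne, Nat.lt_succ_of_lt h]
      · simp [h]
      · simp [h.ne', h.not_gt, show ¬ i' < i + 1 by omega]
  · exact ⟨fun _ _ => rfl, by simp⟩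

/-- Only the visible arrays are specified. The buffer and the temporaries may end with arbitrary
contents. -/
def Cmd.Correct (c : Cmd) : Prop :=
  ∃ b, ∀ (n d N base : ℕ) (σ : ℕ → ℕ) (r : RawMem), 1 ≤ N → n ≤ N → d ≤ N → σ 0 = n → σ 1 = d →
    2 ≤ base → (∀ x, base ≤ x → σ x = 0) →
    Runs (c.compile base) σ r (b * N ^ b) (fun r' => visible r' = c.exec n d (visible r))

/-- The first pass writes only to the buffer and to temporaries, so every cell is computed from the
old visible memory. The second pass copies the buffer, which makes the assignment simultaneous. -/
theorem Cmd.correct_assign (a : Fin 16) (z₁ z₂ : Size) (e : Term) : (assign a z₁ z₂ e).Correct := by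
  obtain ⟨c, he⟩ := e.correct
  refine ⟨(c + 1 + 5 + 5) + (1 + 5 + 5), fun n d N base σ r hN hn hd h0 h1 hb hz => ?_⟩
  -- Counters beyond `base + 1` are zero, which matches the default value of `pairEnv`.
  have hnat : ∀ (i j x : ℕ), Function.update (Function.update σ base i) (base + 1) j (base + x) =
      pairEnv i j x := by
    intro i j x
    match x with
    | 0 => simp [pairEnv]
    | 1 => simp [pairEnv]
    | x + 2 =>
      rw [Function.update_of_ne (by omega), Function.update_of_ne (by omega)]
      exact hz _ (by omega)
  have hvar0 : ∀ (i j : ℕ) (r' : RawMem), NatExpr.eval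
      ⟨Function.update (Function.update σ base i) (base + 1) j, r'⟩ (.var base) = i :=
    fun i j _ => hnat i j 0
  have hvar1 : ∀ (i j : ℕ) (r' : RawMem), NatExpr.eval
      ⟨Function.update (Function.update σ base i) (base + 1) j, r'⟩ (.var (base + 1)) = j :=
    fun i j _ => hnat i j 1
  have hT : ∀ (c : ℕ), z₁.eval n d * ((z₂.eval n d * (c * N ^ c + 2) + 3) + 2) + 3 ≤
      (c + 5 + 5) * N ^ (c + 5 + 5) := fun c =>
    le_trans (by gcongr; exact poly_bound_loop hN (z₂.eval_le hN hn hd))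
      (poly_bound_loop hN (z₁.eval_le hN hn hd))
  refine Runs.of_le (add_le_add (hT (c + 1)) (hT 1) |>.trans (poly_bound_add hN)) (Runs.seq
    (runs_block (a := 16) (keep := fun a => a < 16) (T := (c + 1) * N ^ (c + 1))
      (v := fun i j => e.eval n d (visible r) 2 (pairEnv i j)) hb h0 h1 hz ?_)
    fun r₁ h₁ => Runs.mono (runs_block (a := a) (keep := fun a' => a' ≠ a ∧ a' < 17) (T := 1 * N ^ 1)
      (v := fun i j => r₁ 16 i j) hb h0 h1 hz ?_) le_rfl ?_)
  · intro i j r₁ hi hj hr₁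
    refine Runs.mono (Runs.seq (he n d N base 0 2 _ r₁ hN hn hd ?_ ?_ hb ?_)
      fun r₂ h₂ => Runs.setCell ?_) ?_ fun _ h => h
    · rw [Function.update_of_ne (by omega), Function.update_of_ne (by omega), h0]
    · rw [Function.update_of_ne (by omega), Function.update_of_ne (by omega), h1]
    · intro x hx
      rw [hnat]
      match x with
      | 0 => omega
      | 1 => omega
      | x + 2 => rfl
    · refine ⟨?_, ?_⟩
      · intro a' ha'
        funext i' j'
        have : a' ≠ 16 := by omega
        simp only [this, false_and, if_false]
        rw [h₂.2 a' (by omega)]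
      · intro i' j'
        rw [hvar0, hvar1]
        beta_reduce
        rw [h₂.2 16 (by omega)]
        have : (tempCell 0).eval ⟨Function.update (Function.update σ base i) (base + 1) j, r₂⟩ =
            e.eval n d (visible r) 2 (pairEnv i j) := by
          have hv : visible r₁ = visible r := by funext a'; exact hr₁ _ a'.2
          rw [← hv, show pairEnv i j = fun x => Function.update (Function.update σ base i)
            (base + 1) j (base + x) from funext fun x => (hnat i j x).symm, ← h₂.1]
          rfl
        rw [this]; simp
    · calc c * N ^ c + 1 ≤ c * N ^ c + 1 * N ^ 1 := by gcongr; simpa using hN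
        _ ≤ _ := poly_bound_add hN
  · intro i j r₂ hi hj hr₂
    refine Runs.mono (Runs.setCell ?_) (by simpa using hN) fun _ h => h
    refine ⟨?_, ?_⟩
    · rintro a' ⟨ha', -⟩
      funext i' j'
      simp [ha']
    · intro i' j'
      have h16 : (16 : ℕ) ≠ a := by have := a.2; omega
      rw [hvar0, hvar1]
      have : RealExpr.eval ⟨Function.update (Function.update σ base i) (base + 1) j, r₂⟩
          (.cell 16 (.var base) (.var (base + 1))) = r₁ 16 i j := by
        simp only [RealExpr.eval]
        rw [hvar0, hvar1, hr₂ 16 ⟨h16, by omega⟩]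
      rw [this]; simp
  · rintro r₂ ⟨hk, h₂⟩
    funext a' i j
    by_cases haa : a' = a
    · subst haa
      simp only [Cmd.exec, Function.update_self, visible]
      rw [h₂, h₁.1 _ a'.2]
      split_ifs with h
      · rw [h₁.2, if_pos h]
      · rfl
    · have : (a' : ℕ) ≠ a := fun h => haa (Fin.ext h)
      simp only [Cmd.exec, Function.update_of_ne haa, visible]
      rw [hk _ ⟨this, by have := a'.2; omega⟩, h₁.1 _ a'.2]

theorem Cmd.correct (c : Cmd) : c.Correct := by
  induction c with
  | assign a z₁ z₂ e => exact Cmd.correct_assign a z₁ z₂ e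
  | seq c c' hc hc' =>
    obtain ⟨b, hc⟩ := hc
    obtain ⟨b', hc'⟩ := hc'
    refine ⟨b + b', fun n d N base σ r hN hn hd h0 h1 hb hz => ?_⟩
    refine Runs.of_le (poly_bound_add hN) (Runs.seq (hc n d N base σ r hN hn hd h0 h1 hb hz)
      fun r₁ h₁ => Runs.mono (hc' n d N base σ r₁ hN hn hd h0 h1 hb hz) le_rfl fun r₂ h₂ => ?_)
    rw [h₂, h₁]; rfl
  | rep z c hc =>
    obtain ⟨b, hc⟩ := hc
    refine ⟨b + 5, fun n d N base σ r hN hn hd h0 h1 hb hz => ?_⟩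
    refine Runs.mono (runs_forLoop hb (hz _ le_rfl) h0 h1
      (fun i r' => visible r' = (c.exec n d)^[i] (visible r)) ?_ rfl)
      (poly_bound_loop hN (z.eval_le hN hn hd)) fun _ h => h
    intro i hi r₁ h₁
    refine Runs.mono (hc n d N (base + 1) _ r₁ hN hn hd
      (by rw [Function.update_of_ne (by omega), h0]) (by rw [Function.update_of_ne (by omega), h1])
      (by omega) fun x hx => by
        rw [Function.update_of_ne (by omega)]; exact hz x (by omega)) le_rfl fun r₂ h₂ => ?_
    rw [h₂, h₁, Function.iterate_succ_apply']

/-- The estimator defined by a command. -/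
noncomputable def Cmd.estimator (c : Cmd) : Estimator := fun n d ρ ε Z =>
  WithLp.toLp 2 (fun j : Fin d => c.exec n d (visible (inputStore n d ρ ε Z).real) 3 0 j)

/-- Take N = n * d, which bounds n and d because both are at least 1. Counters start at 2, since the
variables 0 and 1 hold n and d. -/
theorem Cmd.computesInPolyTime (c : Cmd) : ComputesInPolyTime (c.compile 2) c.estimator := by
  obtain ⟨b, hb⟩ := c.correct
  refine ⟨b, b, fun n d hn hd ρ ε Z => ?_⟩
  have hnd : 1 ≤ n * d := Nat.mul_pos hn hd
  obtain ⟨t, r', h, ht, hr⟩ := hb n d (n * d) 2 (inputStore n d ρ ε Z).nat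
    (inputStore n d ρ ε Z).real hnd (Nat.le_mul_of_pos_right n hd) (Nat.le_mul_of_pos_left d hn)
    rfl rfl le_rfl (fun x hx => by
      match x with
      | 0 => omega
      | 1 => omega
      | x + 2 => rfl)
  refine ⟨t, _, h, by rw [mul_assoc, ← mul_pow]; exact ht, ?_⟩
  unfold outputVector Cmd.estimator
  rw [← hr]; rfl

/-! ### The power method with exact arithmetic -/

/-- The factor multiplying a - x in a^(m+1) - x^(m+1) is a sum of m + 1 monomials, each at least
x^m. -/
theorem mul_pow_mul_sub_le {a x : ℝ} (hx : 0 ≤ x) (hxa : x ≤ a) (m : ℕ) :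
    m * (x ^ m * (a - x)) ≤ a ^ (m + 1) - x ^ (m + 1) := by
  induction m with
  | zero => simpa using hxa
  | succ m ih =>
    have h1 := mul_le_mul_of_nonneg_left ih hx
    have h2 : 0 ≤ (a ^ (m + 1) - x ^ (m + 1)) * (a - x) :=
      mul_nonneg (sub_nonneg.2 (pow_le_pow_left₀ hx hxa _)) (sub_nonneg.2 hxa)
    push_cast
    have e1 : ((m : ℝ) + 1) * (x ^ (m + 1) * (a - x)) =
      x * (m * (x ^ m * (a - x))) + x ^ (m + 1) * (a - x) := by ring
    have e2 : a ^ (m + 1 + 1) - x ^ (m + 1 + 1) = x * (a ^ (m + 1) - x ^ (m + 1))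
      + x ^ (m + 1) * (a - x) + (a ^ (m + 1) - x ^ (m + 1)) * (a - x) := by ring
    rw [e1, e2]; linarith

/-- A ratio of consecutive power sums is almost the largest term. -/
theorem le_ratio_power_sums {κ : Type*} [Fintype κ] {l : κ → ℝ} (hl : ∀ j, 0 ≤ l j) (i : κ)
    {m : ℕ} (hm : 0 < m) :
    l i * ∑ j, l j ^ m ≤
      ∑ j, l j ^ (m + 1) + Fintype.card κ * (∑ j, l j) / m * ∑ j, l j ^ m := by
  set F := ∑ j, l j ^ m with hF
  set S := ∑ j, l j with hS
  have hm' : (0 : ℝ) < m := by exact_mod_cast hm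
  have hiF : l i ^ m ≤ F :=
    Finset.single_le_sum (f := fun j => l j ^ m) (fun j _ => pow_nonneg (hl j) m) (Finset.mem_univ i)
  have hiS : l i ≤ S := Finset.single_le_sum (fun j _ => hl j) (Finset.mem_univ i)
  -- Terms with l j ≥ l i lose nothing. For smaller ones the loss l j ^ m * (l i - l j) is at most l
  -- i ^ (m + 1) / m, hence at most S * F / m.
  have key : ∀ j, l i * l j ^ m ≤ l j ^ (m + 1) + S / m * F := by
    intro j
    have hSF : 0 ≤ S / m * F := by
      have : 0 ≤ F := (pow_nonneg (hl i) m).trans hiF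
      have : 0 ≤ S := (hl i).trans hiS
      positivity
    rcases le_total (l i) (l j) with h | h
    · have : l i * l j ^ m ≤ l j * l j ^ m := mul_le_mul_of_nonneg_right h (pow_nonneg (hl j) m)
      rw [pow_succ']; linarith
    · have h1 := mul_pow_mul_sub_le (hl j) h m
      have h2 : l i ^ (m + 1) ≤ S * F := by
        rw [pow_succ']
        exact mul_le_mul hiS hiF (pow_nonneg (hl i) m) ((hl i).trans hiS)
      have h3 : l j ^ m * (l i - l j) ≤ S / m * F := by
        rw [div_mul_eq_mul_div, le_div_iff₀ hm']
        have := pow_nonneg (hl j) (m + 1)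
        linarith
      rw [pow_succ]; linarith
  calc l i * F = ∑ j, l i * l j ^ m := by rw [hF, Finset.mul_sum]
    _ ≤ ∑ j, (l j ^ (m + 1) + S / m * F) := Finset.sum_le_sum fun j _ => key j
    _ = _ := by
      rw [Finset.sum_add_distrib, Finset.sum_const, Finset.card_univ, nsmul_eq_mul]; ring

open Matrix in
theorem Matrix.IsHermitian.trace_pow_eq_sum {κ : Type*} [Fintype κ] [DecidableEq κ]
    {H : Matrix κ κ ℝ} (hH : H.IsHermitian) (m : ℕ) :
    (H ^ m).trace = ∑ j, hH.eigenvalues j ^ m := by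
  conv_lhs => rw [hH.spectral_theorem]
  rw [← map_pow, Matrix.diagonal_pow, Unitary.conjStarAlgAut_apply, Matrix.trace_mul_cycle]
  simp [Matrix.trace_diagonal]

open Matrix in
theorem Matrix.IsHermitian.exists_diag_form {κ : Type*} [Fintype κ] [DecidableEq κ]
    {H : Matrix κ κ ℝ} (hH : H.IsHermitian) (v : κ → ℝ) :
    ∃ y : κ → ℝ, v ⬝ᵥ v = ∑ j, y j ^ 2 ∧ v ⬝ᵥ H *ᵥ v = ∑ j, hH.eigenvalues j * y j ^ 2 := by
  set U : Matrix κ κ ℝ := (hH.eigenvectorUnitary : Matrix κ κ ℝ) with hU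
  have hUU : U * Uᵀ = 1 := by
    have := Unitary.coe_mul_star_self hH.eigenvectorUnitary
    simpa [Matrix.star_eq_conjTranspose] using this
  have hsp : H = U * Matrix.diagonal hH.eigenvalues * Uᵀ := by
    have := hH.spectral_theorem
    rw [Unitary.conjStarAlgAut_apply] at this
    simpa [Matrix.star_eq_conjTranspose] using this
  refine ⟨Uᵀ *ᵥ v, ?_, ?_⟩
  · have : v ⬝ᵥ v = (Uᵀ *ᵥ v) ⬝ᵥ (Uᵀ *ᵥ v) := by
      rw [Matrix.dotProduct_mulVec, Matrix.vecMul_transpose, Matrix.mulVec_mulVec, hUU,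
        Matrix.one_mulVec]
    rw [this]
    simp [dotProduct, sq]
  · have : v ⬝ᵥ H *ᵥ v = (Uᵀ *ᵥ v) ⬝ᵥ (Matrix.diagonal hH.eigenvalues *ᵥ (Uᵀ *ᵥ v)) := by
      conv_lhs => rw [hsp]
      rw [← Matrix.mulVec_mulVec, ← Matrix.mulVec_mulVec, Matrix.dotProduct_mulVec,
        ← Matrix.mulVec_transpose]
    rw [this]
    simp only [dotProduct, Matrix.mulVec_diagonal]
    exact Finset.sum_congr rfl fun j _ => by ring

/-- The quadratic form of `H` is bounded by its average over the columns of `H ^ K`. -/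
theorem Matrix.PosSemidef.form_le_power_average {κ : Type*} [Fintype κ] [DecidableEq κ]
    {H : Matrix κ κ ℝ} (hH : H.PosSemidef) {K : ℕ} (hK : 0 < K) (v : κ → ℝ) :
    (∑ i, ∑ j, H i j * v i * v j) * (∑ i, ∑ k, (H ^ K) i k ^ 2) ≤
      (∑ j, v j ^ 2) * ((∑ k, ∑ i, ∑ j, H i j * (H ^ K) i k * (H ^ K) j k) +
        Fintype.card κ * H.trace / (2 * K) * ∑ i, ∑ k, (H ^ K) i k ^ 2) := by
  have hs : ∀ i j, (H ^ K) i j = (H ^ K) j i := fun i j => by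
    have := (hH.1.pow K).apply i j
    simpa using this.symm
  have hF : ∑ i, ∑ k, (H ^ K) i k ^ 2 = (H ^ (2 * K)).trace := by
    rw [two_mul, pow_add]
    simp only [Matrix.trace, Matrix.diag, Matrix.mul_apply]
    exact Finset.sum_congr rfl fun i _ => Finset.sum_congr rfl fun k _ => by rw [hs k i, sq]
  -- The average of the form over the columns of H ^ K is thus tr H^(2K+1) / tr H^(2K), a ratio of
  -- consecutive power sums of the eigenvalues.
  have hG : ∑ k, ∑ i, ∑ j, H i j * (H ^ K) i k * (H ^ K) j k = (H ^ (2 * K + 1)).trace := by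
    have : H ^ (2 * K + 1) = H ^ K * (H * H ^ K) := by
      rw [← pow_succ', ← pow_add]; congr 1; omega
    rw [this]
    simp only [Matrix.trace, Matrix.diag, Matrix.mul_apply, Finset.mul_sum]
    refine Finset.sum_congr rfl fun k _ => Finset.sum_congr rfl fun i _ =>
      Finset.sum_congr rfl fun j _ => ?_
    rw [hs k i]; ring
  have hQ : ∑ i, ∑ j, H i j * v i * v j = v ⬝ᵥ H.mulVec v := by
    simp only [dotProduct, Matrix.mulVec, Finset.mul_sum]
    exact Finset.sum_congr rfl fun i _ => Finset.sum_congr rfl fun j _ => by ring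
  have hv : ∑ j, v j ^ 2 = v ⬝ᵥ v := by simp [dotProduct, sq]
  obtain ⟨y, hy1, hy2⟩ := hH.1.exists_diag_form v
  rw [hF, hG, hQ, hv, hy1, hy2, hH.1.trace_pow_eq_sum, hH.1.trace_pow_eq_sum,
    hH.1.trace_eq_sum_eigenvalues, Finset.sum_mul, Finset.sum_mul]
  refine Finset.sum_le_sum fun i _ => ?_
  have := le_ratio_power_sums (fun j => hH.eigenvalues_nonneg j) i (m := 2 * K) (by omega)
  have h2 := mul_le_mul_of_nonneg_left this (sq_nonneg (y i))
  simp only [RCLike.ofReal_real_eq_id, id]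
  push_cast at h2 ⊢
  linarith

/-- A positive trace forces a positive eigenvalue, so tr H^K > 0 and H^K is not zero. This permits
division by its Frobenius norm. -/
theorem Matrix.PosSemidef.sum_sq_pow_pos {κ : Type*} [Fintype κ] [DecidableEq κ]
    {H : Matrix κ κ ℝ} (hH : H.PosSemidef) (ht : 0 < H.trace) (K : ℕ) :
    0 < ∑ i, ∑ k, (H ^ K) i k ^ 2 := by
  have hne : ∃ i k, (H ^ K) i k ≠ 0 := by
    by_contra! h
    have h0 : H ^ K = 0 := by ext i k; exact h i k
    have h1 := hH.1.trace_pow_eq_sum K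
    rw [h0, Matrix.trace_zero] at h1
    rw [hH.1.trace_eq_sum_eigenvalues] at ht
    obtain ⟨i, -, hi⟩ := Finset.exists_lt_of_sum_lt (s := Finset.univ) (f := fun _ => (0 : ℝ))
      (g := fun i => hH.1.eigenvalues i) (by simpa using ht)
    have := Finset.single_le_sum (f := fun j => hH.1.eigenvalues j ^ K)
      (fun j _ => pow_nonneg (hH.eigenvalues_nonneg j) K) (Finset.mem_univ i)
    have := pow_pos hi K
    beta_reduce at *
    linarith
  obtain ⟨i, k, h⟩ := hne
  refine Finset.sum_pos' (fun i _ => Finset.sum_nonneg fun k _ => sq_nonneg _)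
    ⟨i, Finset.mem_univ i, Finset.sum_pos' (fun k _ => sq_nonneg _) ⟨k, Finset.mem_univ k, ?_⟩⟩
  positivity

/-! ### Regular samples and the filter -/

section Filter

variable {ι κ : Type*} [Fintype ι] [Fintype κ]

def dotp (v x : κ → ℝ) : ℝ := ∑ j, v j * x j

def sqNorm (v : κ → ℝ) : ℝ := ∑ j, v j ^ 2

/-- The off-diagonal part of the square of a linear form. -/
def offDiag (v x : κ → ℝ) : ℝ := dotp v x ^ 2 - ∑ j, v j ^ 2 * x j ^ 2

theorem sqNorm_nonneg (v : κ → ℝ) : 0 ≤ sqNorm v := Finset.sum_nonneg fun _ _ => sq_nonneg _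

theorem dotp_sq_le (v x : κ → ℝ) : dotp v x ^ 2 ≤ sqNorm v * sqNorm x :=
  Finset.sum_mul_sq_le_sq_mul_sq _ _ _

theorem dotp_add (v x y : κ → ℝ) : dotp v (x + y) = dotp v x + dotp v y := by
  simp [dotp, mul_add, Finset.sum_add_distrib]

theorem sum_sq_mul_sq_le {v x : κ → ℝ} {b : ℝ} (hx : ∀ j, |x j| ≤ b) :
    ∑ j, v j ^ 2 * x j ^ 2 ≤ b ^ 2 * sqNorm v := by
  rw [sqNorm, Finset.mul_sum]
  refine Finset.sum_le_sum fun j _ => ?_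
  have := sq_le_sq' (abs_le.1 (hx j)).1 (abs_le.1 (hx j)).2
  nlinarith [sq_nonneg (v j)]

theorem sum_sq_mul_sq_nonneg (v x : κ → ℝ) : 0 ≤ ∑ j, v j ^ 2 * x j ^ 2 :=
  Finset.sum_nonneg fun _ _ => by positivity

/-- The sample `ψ` has a nearly diagonal second moment matrix, and small fractions of it carry
little of its second moment. -/
structure Regular (ψ : ι → κ → ℝ) (ε L : ℝ) : Prop where
  offDiag_le : ∀ v, |∑ i, offDiag v (ψ i)| ≤ Fintype.card ι * L * sqNorm v
  tail_le : ∀ a : ι → ℝ, (∀ i, 0 ≤ a i) → (∀ i, a i ≤ 1) → ∑ i, a i ≤ 3 * ε * Fintype.card ι →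
    ∀ v, ∑ i, a i * dotp v (ψ i) ^ 2 ≤ Fintype.card ι * L * sqNorm v

/-- The cross terms between φ and the displacement are split by AM–GM with weight R / b. The second
moment of φ is only O(b²), so they cost O(bR) rather than a constant multiple of b². -/
theorem Regular.perturb {φ ψ : ι → κ → ℝ} {ε E b R : ℝ} (h : Regular φ ε E) (hb : 0 < b)
    (hR : 0 ≤ R) (hE0 : 0 ≤ E) (hE : E ≤ b ^ 2) (hε : ε ≤ 1) (hφ : ∀ i j, |φ i j| ≤ b)
    (hψ : ∀ i j, |ψ i j| ≤ b) (hd : ∀ i, sqNorm (ψ i - φ i) ≤ R ^ 2) :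
    Regular ψ ε (2 * E + 5 * b * R + 6 * R ^ 2) := by
  set N : ℝ := (Fintype.card ι : ℝ) with hN
  have hN0 : 0 ≤ N := Nat.cast_nonneg _
  have hdec : ∀ i v, dotp v (ψ i) = dotp v (φ i) + dotp v (ψ i - φ i) := fun i v => by
    rw [← dotp_add]; congr 1; abel
  have hD : ∀ i v, dotp v (ψ i - φ i) ^ 2 ≤ R ^ 2 * sqNorm v := fun i v => by
    have := mul_le_mul_of_nonneg_left (hd i) (sqNorm_nonneg v)
    linarith [dotp_sq_le v (ψ i - φ i)]
  have hbR : 0 ≤ b * R := by positivity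
  constructor
  · intro v
    have hv := sqNorm_nonneg v
    -- One b² bounds the diagonal part, the other the off-diagonal part through E ≤ b².
    have hsum : ∑ i, dotp v (φ i) ^ 2 ≤ 2 * N * b ^ 2 * sqNorm v := by
      have h1 := (abs_le.1 (h.offDiag_le v)).2
      simp only [offDiag, Finset.sum_sub_distrib] at h1
      have h2 : ∑ i, ∑ j, v j ^ 2 * φ i j ^ 2 ≤ ∑ _i : ι, b ^ 2 * sqNorm v :=
        Finset.sum_le_sum fun i _ => sum_sq_mul_sq_le (hφ i)
      rw [Finset.sum_const, Finset.card_univ, nsmul_eq_mul] at h2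
      have h3 : N * E * sqNorm v ≤ N * b ^ 2 * sqNorm v := by gcongr
      linarith
    have hpt : ∀ i, |offDiag v (ψ i) - offDiag v (φ i)| ≤
        R / b * dotp v (φ i) ^ 2 + (3 * b * R + R ^ 2) * sqNorm v := by
      intro i
      set x := dotp v (φ i)
      set y := dotp v (ψ i - φ i)
      have hy := hD i v
      -- The case R = 0 is separate because the weight b / R is then meaningless.
      have hxy : |2 * x * y| ≤ R / b * x ^ 2 + b * R * sqNorm v := by
        rcases hR.eq_or_lt with h0 | hRpos
        · have : y = 0 := by
            rw [← h0] at hy; simpa using le_antisymm (by simpa using hy) (sq_nonneg y)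
          simp [this, ← h0]
        · have e : R / b * x ^ 2 + b / R * y ^ 2 - |2 * x * y| =
              (Real.sqrt (R / b) * |x| - Real.sqrt (b / R) * |y|) ^ 2 := by
            have e1 : Real.sqrt (R / b) * Real.sqrt (b / R) = 1 := by
              rw [← Real.sqrt_mul (by positivity), div_mul_div_comm, mul_comm b R, div_self
                (by positivity), Real.sqrt_one]
            have e2 := Real.sq_sqrt (show 0 ≤ R / b by positivity)
            have e3 := Real.sq_sqrt (show 0 ≤ b / R by positivity)
            rw [abs_mul, abs_mul, abs_two, ← sq_abs x, ← sq_abs y, sub_sq, mul_pow, mul_pow, e2, e3]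
            linear_combination (2 * |x| * |y|) * e1
          have h1 : b / R * y ^ 2 ≤ b / R * (R ^ 2 * sqNorm v) := by gcongr
          have h2 : b / R * (R ^ 2 * sqNorm v) = b * R * sqNorm v := by field_simp
          nlinarith [sq_nonneg (Real.sqrt (R / b) * |x| - Real.sqrt (b / R) * |y|)]
      have hq : |∑ j, v j ^ 2 * ψ i j ^ 2 - ∑ j, v j ^ 2 * φ i j ^ 2| ≤ 2 * b * R * sqNorm v := by
        rw [← Finset.sum_sub_distrib, sqNorm, Finset.mul_sum]
        refine (Finset.abs_sum_le_sum_abs _ _).trans (Finset.sum_le_sum fun j _ => ?_)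
        have hdj : |ψ i j - φ i j| ≤ R := by
          refine abs_le_of_sq_le_sq ?_ hR
          refine le_trans ?_ (hd i)
          exact Finset.single_le_sum (f := fun j => (ψ i - φ i) j ^ 2)
            (fun _ _ => sq_nonneg _) (Finset.mem_univ j)
        have hs : |ψ i j + φ i j| ≤ 2 * b := (abs_add_le _ _).trans (by linarith [hφ i j, hψ i j])
        rw [show v j ^ 2 * ψ i j ^ 2 - v j ^ 2 * φ i j ^ 2 =
          v j ^ 2 * ((ψ i j + φ i j) * (ψ i j - φ i j)) by ring, abs_mul, abs_mul,
          abs_of_nonneg (sq_nonneg _)]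
        have := mul_le_mul hs hdj (abs_nonneg _) (by positivity)
        nlinarith [sq_nonneg (v j)]
      have e : offDiag v (ψ i) - offDiag v (φ i) = 2 * x * y + y ^ 2 -
          (∑ j, v j ^ 2 * ψ i j ^ 2 - ∑ j, v j ^ 2 * φ i j ^ 2) := by
        simp only [offDiag, hdec i v]; ring
      rw [e]
      have a1 := abs_le.1 hxy
      have a2 := abs_le.1 hq
      rw [abs_le]
      constructor <;> nlinarith [sq_nonneg y]
    have htot : |∑ i, offDiag v (ψ i) - ∑ i, offDiag v (φ i)| ≤
        N * (5 * b * R + R ^ 2) * sqNorm v := by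
      rw [← Finset.sum_sub_distrib]
      refine (Finset.abs_sum_le_sum_abs _ _).trans ((Finset.sum_le_sum fun i _ => hpt i).trans ?_)
      rw [Finset.sum_add_distrib, ← Finset.mul_sum, Finset.sum_const, Finset.card_univ,
        nsmul_eq_mul]
      have : R / b * ∑ i, dotp v (φ i) ^ 2 ≤ R / b * (2 * N * b ^ 2 * sqNorm v) := by gcongr
      have e : R / b * (2 * N * b ^ 2 * sqNorm v) = 2 * N * b * R * sqNorm v := by field_simp
      nlinarith
    have h1 := h.offDiag_le v
    have h2 : 0 ≤ N * E * sqNorm v := by positivity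
    have h3 : 0 ≤ N * R ^ 2 * sqNorm v := by positivity
    have := abs_sub_abs_le_abs_sub (∑ i, offDiag v (ψ i)) (∑ i, offDiag v (φ i))
    nlinarith
  · intro a ha0 ha1 hsum v
    have hv := sqNorm_nonneg v
    have h1 := h.tail_le a ha0 ha1 hsum v
    have h2 : ∑ i, a i * dotp v (ψ i) ^ 2 ≤
        ∑ i, (2 * (a i * dotp v (φ i) ^ 2) + a i * (2 * (R ^ 2 * sqNorm v))) := by
      refine Finset.sum_le_sum fun i _ => ?_
      rw [hdec i v]
      have := hD i v
      have h3 : (dotp v (φ i) + dotp v (ψ i - φ i)) ^ 2 ≤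
          2 * dotp v (φ i) ^ 2 + 2 * (R ^ 2 * sqNorm v) := by
        nlinarith [sq_nonneg (dotp v (φ i) - dotp v (ψ i - φ i))]
      have := mul_le_mul_of_nonneg_left h3 (ha0 i)
      linarith
    rw [Finset.sum_add_distrib, ← Finset.mul_sum, ← Finset.sum_mul] at h2
    have h3 : (∑ i, a i) * (2 * (R ^ 2 * sqNorm v)) ≤ (3 * N) * (2 * (R ^ 2 * sqNorm v)) := by
      refine mul_le_mul_of_nonneg_right (hsum.trans ?_) (by positivity)
      nlinarith
    have h4 : 0 ≤ N * (b * R) * sqNorm v := by positivity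
    nlinarith

/-! #### Scores averaged over a family of directions -/

variable {τ : Type*} [Fintype τ]

theorem Regular.sum_offDiag_le {ψ : ι → κ → ℝ} {ε L : ℝ} (h : Regular ψ ε L) (c : τ → κ → ℝ) :
    ∑ i, ∑ k, offDiag (c k) (ψ i) ≤ Fintype.card ι * L * ∑ k, sqNorm (c k) := by
  rw [Finset.sum_comm, Finset.mul_sum]
  exact Finset.sum_le_sum fun k _ => (le_abs_self _).trans (h.offDiag_le (c k))

theorem Regular.sum_tail_le {ψ : ι → κ → ℝ} {ε L : ℝ} (h : Regular ψ ε L) (c : τ → κ → ℝ)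
    {a : ι → ℝ} (ha0 : ∀ i, 0 ≤ a i) (ha1 : ∀ i, a i ≤ 1)
    (ha : ∑ i, a i ≤ 3 * ε * Fintype.card ι) :
    ∑ i, a i * ∑ k, dotp (c k) (ψ i) ^ 2 ≤ Fintype.card ι * L * ∑ k, sqNorm (c k) := by
  simp only [Finset.mul_sum]
  rw [Finset.sum_comm]
  refine Finset.sum_le_sum fun k _ => ?_
  have := h.tail_le a ha0 ha1 ha (c k)
  linarith

/-- The points whose weighted score is exceeded by few others. -/
def TopScore (t : ι → ℝ) (k : ℝ) (i : ι) : Prop := (∑ j, if t i ≤ t j then (1 : ℝ) else 0) ≤ k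

open Classical in
-- All top points score at least as much as the lowest of them, so the count in the condition for
-- that one bounds their number.
theorem card_top_le (t : ι → ℝ) {k : ℝ} (hk : 0 ≤ k) :
    ((Finset.univ.filter (TopScore t k)).card : ℝ) ≤ k := by
  set T := Finset.univ.filter (TopScore t k) with hT
  rcases T.eq_empty_or_nonempty with h | h
  · rw [h]; simpa using hk
  · obtain ⟨i, hi, hmin⟩ := T.exists_min_image t h
    have h1 : TopScore t k i := (Finset.mem_filter.1 hi).2
    refine le_trans ?_ h1
    rw [Finset.sum_boole]
    exact_mod_cast Finset.card_le_card fun j hj => by simpa using hmin j hj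

open Classical in
/-- If the weighted second moment exceeds what the clean sample can explain, then among the top
scores the corrupted points have the larger share. -/
theorem corrupted_mass_gt {G : Finset ι} {s q s' q' w : ι → ℝ} {ε L B : ℝ}
    (hL : 0 ≤ L) (hε : 0 ≤ ε) (hB : ε * B ≤ L)
    (hG : (Gᶜ.card : ℝ) ≤ ε * Fintype.card ι)
    (hs0 : ∀ i, 0 ≤ s i) (hq0 : ∀ i, 0 ≤ q i) (hq : ∀ i, q i ≤ B)
    (hq0' : ∀ i, 0 ≤ q' i)
    (hss : ∀ i ∈ G, s' i = s i) (hqq : ∀ i ∈ G, q' i = q i)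
    (hdiag : ∑ i, (s i - q i) ≤ Fintype.card ι * L)
    (htail : ∀ a : ι → ℝ, (∀ i, 0 ≤ a i) → (∀ i, a i ≤ 1) → ∑ i, a i ≤ 3 * ε * Fintype.card ι →
      ∑ i, a i * s i ≤ Fintype.card ι * L)
    (hw0 : ∀ i, 0 ≤ w i) (hw1 : ∀ i, w i ≤ 1)
    (hw : ∑ i, (1 - w i) ≤ 2 * ε * Fintype.card ι)
    (hbig : Fintype.card ι * (6 * L) < ∑ i, w i * (s' i - q' i)) :
    ∑ i ∈ G with TopScore (fun i => w i * s' i) (2 * ε * Fintype.card ι) i, w i * s' i <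
      ∑ i ∈ Gᶜ with TopScore (fun i => w i * s' i) (2 * ε * Fintype.card ι) i, w i * s' i := by
  set N : ℝ := (Fintype.card ι : ℝ) with hN
  have hN0 : 0 ≤ N := Nat.cast_nonneg _
  set t : ι → ℝ := fun i => w i * s' i with ht
  have hεN : 0 ≤ ε * N := by positivity
  have hgoodsum : ∀ S ⊆ G, (S.card : ℝ) ≤ 3 * ε * N → ∑ i ∈ S, t i ≤ N * L := by
    intro S hS hcard
    have h1 := htail (fun i => if i ∈ S then 1 else 0) (fun i => by split_ifs <;> norm_num)
      (fun i => by split_ifs <;> norm_num) (by rw [Finset.sum_boole]; simpa using hcard)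
    simp only [ite_mul, one_mul, zero_mul, Finset.sum_ite_mem, Finset.univ_inter] at h1
    refine le_trans (Finset.sum_le_sum fun i hi => ?_) h1
    simp only [ht, hss i (hS hi)]
    nlinarith [hs0 i, hw1 i]
  -- The total exceeds 6NL, of which the clean points explain at most 4NL.
  have hbad : 2 * N * L < ∑ i ∈ Gᶜ, t i := by
    have hsplit := Finset.sum_add_sum_compl G (fun i => w i * (s' i - q' i))
    have h1 : ∑ i ∈ Gᶜ, w i * (s' i - q' i) ≤ ∑ i ∈ Gᶜ, t i :=
      Finset.sum_le_sum fun i _ => by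
        simp only [ht]; nlinarith [mul_nonneg (hw0 i) (hq0' i)]
    have h2 : ∑ i ∈ G, w i * (s' i - q' i) ≤ 4 * N * L := by
      -- The missing part of the clean sample: the weight removed on G and everything off G. Its
      -- mass is at most 2εN + εN, the budget 3εN of the tail condition.
      set a : ι → ℝ := fun i => if i ∈ G then 1 - w i else 1 with ha
      have ha0 : ∀ i, 0 ≤ a i := fun i => by
        simp only [ha]; split_ifs <;> linarith [hw1 i]
      have hasum : ∑ i, a i ≤ 3 * ε * N := by
        have : ∑ i, a i ≤ ∑ i, ((1 - w i) + if i ∈ Gᶜ then 1 else 0) :=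
          Finset.sum_le_sum fun i _ => by
            simp only [ha, Finset.mem_compl]; split_ifs <;> simp_all
        rw [Finset.sum_add_distrib, Finset.sum_boole] at this
        simp only [Finset.filter_mem_eq_inter, Finset.univ_inter] at this
        linarith
      have e : ∑ i ∈ G, w i * (s' i - q' i) = ∑ i, (s i - q i) - ∑ i, a i * (s i - q i) := by
        rw [← Finset.sum_sub_distrib, ← Finset.sum_add_sum_compl G]
        have z : ∑ i ∈ Gᶜ, (s i - q i - a i * (s i - q i)) = 0 :=
          Finset.sum_eq_zero fun i hi => by
            simp only [ha, if_neg (Finset.mem_compl.1 hi)]; ring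
        rw [z, add_zero]
        refine Finset.sum_congr rfl fun i hi => ?_
        simp only [ha, if_pos hi, hss i hi, hqq i hi]; ring
      -- Deleting clean mass can raise the off-diagonal sum only through the diagonal terms q ≤ B.
      have h3 : -∑ i, a i * (s i - q i) ≤ ∑ i, a i * B := by
        rw [← Finset.sum_neg_distrib]
        refine Finset.sum_le_sum fun i _ => ?_
        nlinarith [mul_nonneg (ha0 i) (hs0 i), mul_le_mul_of_nonneg_left (hq i) (ha0 i)]
      rw [← Finset.sum_mul] at h3
      have hB0 : 0 ≤ B ∨ IsEmpty ι := by
        by_cases hne : Nonempty ι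
        · exact Or.inl ((hq0 hne.some).trans (hq _))
        · exact Or.inr (not_nonempty_iff.1 hne)
      rcases hB0 with hB0 | hemp
      · have h4 : (∑ i, a i) * B ≤ 3 * N * L := by
          calc (∑ i, a i) * B ≤ 3 * ε * N * B := mul_le_mul_of_nonneg_right hasum hB0
            _ = 3 * N * (ε * B) := by ring
            _ ≤ 3 * N * L := by gcongr
        rw [e]; linarith
      · have : ∑ i ∈ G, w i * (s' i - q' i) = 0 :=
          Finset.sum_eq_zero fun i _ => hemp.elim i
        rw [this]; positivity
    linarith
  -- A corrupted point outside the top has more than 2εN points scoring at least as high, and at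
  -- least |Gᶜ| of these are clean. The corrupted points outside the top are thus dominated by |Gᶜ|
  -- clean points, whose mass is at most NL.
  have hnotT : ∑ i ∈ Gᶜ with ¬ TopScore t (2 * ε * N) i, t i ≤ N * L := by
    set S := Gᶜ.filter fun i => ¬ TopScore t (2 * ε * N) i with hS
    rcases S.eq_empty_or_nonempty with h | h
    · rw [h]; simp; positivity
    · obtain ⟨i, hi, hmax⟩ := S.exists_max_image t h
      have hiT : ¬ TopScore t (2 * ε * N) i := (Finset.mem_filter.1 hi).2
      rw [TopScore, not_le, Finset.sum_boole] at hiT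
      set A := Finset.univ.filter fun j => t i ≤ t j with hA
      have hAG : (Gᶜ.card : ℝ) ≤ ((A ∩ G).card : ℝ) := by
        have h1 : A.card ≤ (A ∩ G).card + Gᶜ.card := by
          rw [← Finset.card_inter_add_card_sdiff A G]
          gcongr
          intro j hj
          simp only [Finset.mem_sdiff] at hj
          exact Finset.mem_compl.2 hj.2
        have h2 : (A.card : ℝ) ≤ (A ∩ G).card + Gᶜ.card := by exact_mod_cast h1
        linarith
      obtain ⟨S', hS', hcard⟩ := Finset.exists_subset_card_eq (Nat.cast_le.1 hAG)
      have h3 := hgoodsum S' (hS'.trans Finset.inter_subset_right) (by rw [hcard]; linarith)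
      have h4 : (Gᶜ.card : ℝ) * t i ≤ ∑ j ∈ S', t j := by
        rw [← hcard, ← nsmul_eq_mul]
        refine Finset.card_nsmul_le_sum _ _ _ fun j hj => ?_
        simpa [hA] using (Finset.mem_inter.1 (hS' hj)).1
      have h5 : ∑ j ∈ S, t j ≤ S.card • t i := Finset.sum_le_card_nsmul _ _ _ hmax
      rw [nsmul_eq_mul] at h5
      by_cases hti : 0 ≤ t i
      · have h6 : (S.card : ℝ) * t i ≤ Gᶜ.card * t i := by
          refine mul_le_mul_of_nonneg_right ?_ hti
          exact_mod_cast Finset.card_le_card (Finset.filter_subset _ _)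
        linarith
      · have : (S.card : ℝ) * t i ≤ 0 :=
          mul_nonpos_of_nonneg_of_nonpos (Nat.cast_nonneg _) (le_of_not_ge hti)
        have : 0 ≤ N * L := by positivity
        linarith
  have hgood : ∑ i ∈ G with TopScore t (2 * ε * N) i, t i ≤ N * L := by
    refine hgoodsum _ (Finset.filter_subset _ _) ?_
    have h1 : ((G.filter fun i => TopScore t (2 * ε * N) i).card : ℝ) ≤
        ((Finset.univ.filter (TopScore t (2 * ε * N))).card : ℝ) := by
      exact_mod_cast Finset.card_le_card (Finset.filter_subset_filter _ (Finset.subset_univ _))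
    have h2 := card_top_le t (k := 2 * ε * N) (by positivity)
    linarith
  have := Finset.sum_filter_add_sum_filter_not Gᶜ (fun i => TopScore t (2 * ε * N) i) t
  linarith

/-- The weights after removing mass in proportion to the scores `g`. -/
noncomputable def reweight (w g : ι → ℝ) (M : ℝ) (i : ι) : ℝ := w i - w i * g i / M

open Classical in
/-- One filter step removes more corrupted than clean weight, and kills a point. -/
theorem reweight_spec {G : Finset ι} {T : ι → Prop} {s w g : ι → ℝ} {M : ℝ}
    (hs0 : ∀ i, 0 ≤ s i) (hw0 : ∀ i, 0 ≤ w i)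
    (hg : ∀ i, g i = if w i ≤ 0 then 0 else if T i then s i else 0)
    (hM0 : 0 ≤ M) (hgM : ∀ i, g i ≤ M) (hM : M = 0 ∨ ∃ i, g i = M)
    (hmass : ∑ i ∈ G with T i, w i * s i < ∑ i ∈ Gᶜ with T i, w i * s i) :
    (∀ i, 0 ≤ reweight w g M i) ∧ (∀ i, reweight w g M i ≤ w i) ∧
    (∑ i ∈ G, (w i - reweight w g M i) ≤ ∑ i ∈ Gᶜ, (w i - reweight w g M i)) ∧
    (Finset.univ.filter fun i => 0 < reweight w g M i).card <
      (Finset.univ.filter fun i => 0 < w i).card := by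
  have hwg : ∀ i, w i * g i = if T i then w i * s i else 0 := by
    intro i
    rw [hg]
    rcases (hw0 i).eq_or_lt with h | h
    · simp [← h]
    · rw [if_neg (not_le.2 h)]; split_ifs <;> simp
  have hg0 : ∀ i, 0 ≤ g i := fun i => by
    rw [hg]; split_ifs
    · exact le_rfl
    · exact hs0 i
    · exact le_rfl
  -- With M = 0 all scores vanish and both masses are zero, contrary to the strict inequality.
  have hMpos : 0 < M := by
    refine hM0.lt_of_ne fun h0 => ?_
    have hz : ∀ i, g i = 0 := fun i => le_antisymm (h0 ▸ hgM i) (hg0 i)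
    have hz' : ∀ (S : Finset ι), ∑ i ∈ S with T i, w i * s i = 0 := fun S => by
      rw [Finset.sum_filter]
      exact Finset.sum_eq_zero fun i _ => by rw [← hwg, hz, mul_zero]
    rw [hz', hz'] at hmass
    exact lt_irrefl _ hmass
  have hsub : ∀ i, w i - reweight w g M i = w i * g i / M := fun i => by
    rw [reweight]; ring
  have hle : ∀ i, w i * g i / M ≤ w i := fun i => by
    rw [div_le_iff₀ hMpos]; exact mul_le_mul_of_nonneg_left (hgM i) (hw0 i)
  have hnn : ∀ i, 0 ≤ w i * g i / M := fun i =>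
    div_nonneg (mul_nonneg (hw0 i) (hg0 i)) hM0
  refine ⟨fun i => ?_, fun i => ?_, ?_, ?_⟩
  · rw [reweight]; linarith [hle i]
  · rw [reweight]; linarith [hnn i]
  · simp only [hsub, hwg, ← Finset.sum_div, ← Finset.sum_filter]
    exact div_le_div_of_nonneg_right hmass.le hM0
  · refine Finset.card_lt_card (Finset.ssubset_iff_subset_ne.2 ⟨fun i hi => ?_, fun heq => ?_⟩)
    · simp only [Finset.mem_filter, Finset.mem_univ, true_and] at hi ⊢
      rw [reweight] at hi; linarith [hnn i]
    -- A point where the maximum is attained loses its whole weight. That weight was positive, since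
    -- g vanishes wherever w ≤ 0.
    · rcases hM with h | ⟨i, hi⟩
      · exact hMpos.ne' h
      · have hwi : 0 < w i := by
          by_contra hcon
          rw [hg, if_pos (not_lt.1 hcon)] at hi
          exact hMpos.ne hi
        have : i ∈ Finset.univ.filter fun i => 0 < reweight w g M i := by
          rw [heq]; simpa using hwi
        have h0 : 0 < reweight w g M i := (Finset.mem_filter.1 this).2
        rw [reweight, hi, mul_div_assoc, div_self hMpos.ne'] at h0
        linarith

/-! #### The mean under good weights -/

open Classical in
-- The two sums differ by the weighted corrupted points and by the missing clean mass.
-- Cauchy–Schwarz bounds each by the root of mass times second moment. The masses are at most εN and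
-- 3εN, the second moments at most 10NL‖v‖² and NL‖v‖². The former is read off from the hypothesis
-- on the off-diagonal sum, after subtracting the clean points and adding back the diagonal. Finally
-- √10 + √3 ≤ 5.
theorem weighted_mean_close {G : Finset ι} {ψ ψ' : ι → κ → ℝ} {w : ι → ℝ} {ε L b : ℝ}
    (h : Regular ψ ε L) (hL : 0 ≤ L) (hε : 0 ≤ ε) (hB : ε * b ^ 2 ≤ L)
    (hG : (Gᶜ.card : ℝ) ≤ ε * Fintype.card ι) (hGψ : ∀ i ∈ G, ψ' i = ψ i)
    (hψ' : ∀ i j, |ψ' i j| ≤ b)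
    (hw0 : ∀ i, 0 ≤ w i) (hw1 : ∀ i, w i ≤ 1)
    (hw : ∑ i, (1 - w i) ≤ 2 * ε * Fintype.card ι) (v : κ → ℝ)
    (hv : ∑ i, w i * offDiag v (ψ' i) ≤ Fintype.card ι * (7 * L) * sqNorm v) :
    |∑ i, w i * dotp v (ψ' i) - ∑ i, dotp v (ψ i)| ≤
      5 * Fintype.card ι * Real.sqrt (ε * L) * Real.sqrt (sqNorm v) := by
  set N : ℝ := (Fintype.card ι : ℝ) with hN
  have hN0 : 0 ≤ N := Nat.cast_nonneg _
  have hv0 := sqNorm_nonneg v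
  set a : ι → ℝ := fun i => if i ∈ G then 1 - w i else 1 with ha
  have ha0 : ∀ i, 0 ≤ a i := fun i => by
    simp only [ha]; split_ifs <;> linarith [hw1 i]
  have ha1 : ∀ i, a i ≤ 1 := fun i => by
    simp only [ha]; split_ifs <;> linarith [hw0 i]
  have hasum : ∑ i, a i ≤ 3 * ε * N := by
    have : ∑ i, a i ≤ ∑ i, ((1 - w i) + if i ∈ Gᶜ then 1 else 0) :=
      Finset.sum_le_sum fun i _ => by
        simp only [ha, Finset.mem_compl]; split_ifs <;> simp_all
    rw [Finset.sum_add_distrib, Finset.sum_boole] at this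
    simp only [Finset.filter_mem_eq_inter, Finset.univ_inter] at this
    linarith
  have htail := h.tail_le a ha0 ha1 hasum v
  have hgood : ∀ f : (κ → ℝ) → ℝ, ∑ i ∈ G, w i * f (ψ' i) =
      ∑ i, f (ψ i) - ∑ i, a i * f (ψ i) := by
    intro f
    rw [← Finset.sum_sub_distrib, ← Finset.sum_add_sum_compl G]
    have z : ∑ i ∈ Gᶜ, (f (ψ i) - a i * f (ψ i)) = 0 :=
      Finset.sum_eq_zero fun i hi => by simp only [ha, if_neg (Finset.mem_compl.1 hi)]; ring
    rw [z, add_zero]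
    refine Finset.sum_congr rfl fun i hi => ?_
    simp only [ha, if_pos hi, hGψ i hi]; ring
  have hbad2 : ∑ i ∈ Gᶜ, w i * dotp v (ψ' i) ^ 2 ≤ 10 * N * L * sqNorm v := by
    have h1 := Finset.sum_add_sum_compl G (fun i => w i * offDiag v (ψ' i))
    have h2 : ∑ i ∈ G, w i * offDiag v (ψ' i) ≥ -(2 * N * L * sqNorm v) := by
      rw [hgood (offDiag v)]
      have h3 := (abs_le.1 (h.offDiag_le v)).1
      have h4 : ∑ i, a i * offDiag v (ψ i) ≤ ∑ i, a i * dotp v (ψ i) ^ 2 :=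
        Finset.sum_le_sum fun i _ => mul_le_mul_of_nonneg_left
          (by simp only [offDiag]; linarith [sum_sq_mul_sq_nonneg v (ψ i)]) (ha0 i)
      linarith
    have h5 : ∑ i ∈ Gᶜ, w i * dotp v (ψ' i) ^ 2 - N * L * sqNorm v ≤
        ∑ i ∈ Gᶜ, w i * offDiag v (ψ' i) := by
      have h6 : ∑ i ∈ Gᶜ, w i * ∑ j, v j ^ 2 * ψ' i j ^ 2 ≤ N * L * sqNorm v := by
        have : ∑ i ∈ Gᶜ, w i * ∑ j, v j ^ 2 * ψ' i j ^ 2 ≤ Gᶜ.card • (b ^ 2 * sqNorm v) := by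
          refine Finset.sum_le_card_nsmul _ _ _ fun i _ => ?_
          have h7 := sum_sq_mul_sq_le (v := v) (hψ' i)
          nlinarith [sum_sq_mul_sq_nonneg v (ψ' i), hw0 i, hw1 i]
        rw [nsmul_eq_mul] at this
        calc _ ≤ (Gᶜ.card : ℝ) * (b ^ 2 * sqNorm v) := this
          _ ≤ (ε * N) * (b ^ 2 * sqNorm v) := by gcongr
          _ = N * (ε * b ^ 2) * sqNorm v := by ring
          _ ≤ _ := by gcongr
      simp only [offDiag, mul_sub, Finset.sum_sub_distrib]
      linarith
    linarith
  have hbad1 : |∑ i ∈ Gᶜ, w i * dotp v (ψ' i)| ≤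
      Real.sqrt 10 * N * Real.sqrt (ε * L) * Real.sqrt (sqNorm v) := by
    have hcs := Finset.sum_mul_sq_le_sq_mul_sq Gᶜ (fun i => Real.sqrt (w i))
      (fun i => Real.sqrt (w i) * dotp v (ψ' i))
    have e1 : ∀ i, Real.sqrt (w i) * (Real.sqrt (w i) * dotp v (ψ' i)) = w i * dotp v (ψ' i) :=
      fun i => by rw [← mul_assoc, Real.mul_self_sqrt (hw0 i)]
    simp only [e1, mul_pow, Real.sq_sqrt (hw0 _)] at hcs
    have h1 : ∑ i ∈ Gᶜ, w i ≤ ε * N := by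
      refine le_trans (Finset.sum_le_card_nsmul _ _ 1 fun i _ => hw1 i) ?_
      simpa using hG
    refine abs_le_of_sq_le_sq (hcs.trans ?_) (by positivity)
    calc _ ≤ (ε * N) * (10 * N * L * sqNorm v) :=
          mul_le_mul h1 hbad2 (Finset.sum_nonneg fun i _ => mul_nonneg (hw0 i) (sq_nonneg _))
            (by positivity)
      _ = _ := by
        rw [mul_pow, mul_pow, mul_pow, Real.sq_sqrt (by norm_num), Real.sq_sqrt (by positivity),
          Real.sq_sqrt hv0]; ring
  have hrest : |∑ i, a i * dotp v (ψ i)| ≤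
      Real.sqrt 3 * N * Real.sqrt (ε * L) * Real.sqrt (sqNorm v) := by
    have hcs := Finset.sum_mul_sq_le_sq_mul_sq Finset.univ (fun i => Real.sqrt (a i))
      (fun i => Real.sqrt (a i) * dotp v (ψ i))
    have e1 : ∀ i, Real.sqrt (a i) * (Real.sqrt (a i) * dotp v (ψ i)) = a i * dotp v (ψ i) :=
      fun i => by rw [← mul_assoc, Real.mul_self_sqrt (ha0 i)]
    simp only [e1, mul_pow, Real.sq_sqrt (ha0 _)] at hcs
    refine abs_le_of_sq_le_sq (hcs.trans ?_) (by positivity)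
    calc _ ≤ (3 * ε * N) * (N * L * sqNorm v) :=
          mul_le_mul hasum htail (Finset.sum_nonneg fun i _ => mul_nonneg (ha0 i) (sq_nonneg _))
            (by positivity)
      _ = _ := by
        rw [mul_pow, mul_pow, mul_pow, Real.sq_sqrt (by norm_num), Real.sq_sqrt (by positivity),
          Real.sq_sqrt hv0]; ring
  have hsplit := Finset.sum_add_sum_compl G (fun i => w i * dotp v (ψ' i))
  rw [hgood (dotp v)] at hsplit
  have e : ∑ i, w i * dotp v (ψ' i) - ∑ i, dotp v (ψ i) =
      ∑ i ∈ Gᶜ, w i * dotp v (ψ' i) - ∑ i, a i * dotp v (ψ i) := by linarith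
  have h10 : Real.sqrt 10 ≤ 3.2 := Real.sqrt_le_iff.2 ⟨by norm_num, by norm_num⟩
  have h3 : Real.sqrt 3 ≤ 1.8 := Real.sqrt_le_iff.2 ⟨by norm_num, by norm_num⟩
  have hX : 0 ≤ N * Real.sqrt (ε * L) * Real.sqrt (sqNorm v) := by positivity
  rw [e]
  refine (abs_sub _ _).trans ((add_le_add hbad1 hrest).trans ?_)
  nlinarith

end Filter

/-! ### The filter with scores from powers of the moment matrix -/

section Phase

variable {ι κ : Type*} [Fintype κ]

/-- Squared length of the image of a point, relative to the squared Frobenius norm. -/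
noncomputable def score (C : Matrix κ κ ℝ) (x : κ → ℝ) : ℝ :=
  (∑ k, (∑ j, C j k * x j) ^ 2) / ∑ j, ∑ k, C j k ^ 2

/-- The part of the score without products of different coordinates. Subtracting it cancels the
unknown variances. -/
noncomputable def diagScore (C : Matrix κ κ ℝ) (x : κ → ℝ) : ℝ :=
  (∑ k, ∑ j, C j k ^ 2 * x j ^ 2) / ∑ j, ∑ k, C j k ^ 2

theorem score_nonneg (C : Matrix κ κ ℝ) (x : κ → ℝ) : 0 ≤ score C x :=
  div_nonneg (Finset.sum_nonneg fun _ _ => sq_nonneg _)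
    (Finset.sum_nonneg fun _ _ => Finset.sum_nonneg fun _ _ => sq_nonneg _)

theorem diagScore_nonneg (C : Matrix κ κ ℝ) (x : κ → ℝ) : 0 ≤ diagScore C x :=
  div_nonneg (Finset.sum_nonneg fun k _ => sum_sq_mul_sq_nonneg (fun j => C j k) x)
    (Finset.sum_nonneg fun _ _ => Finset.sum_nonneg fun _ _ => sq_nonneg _)

theorem sum_sqNorm_columns (C : Matrix κ κ ℝ) :
    ∑ k, sqNorm (fun j => C j k) = ∑ j, ∑ k, C j k ^ 2 := Finset.sum_comm

theorem diagScore_le {C : Matrix κ κ ℝ} {x : κ → ℝ} {b : ℝ} (hx : ∀ j, |x j| ≤ b) :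
    diagScore C x ≤ b ^ 2 := by
  have h : ∑ k, ∑ j, C j k ^ 2 * x j ^ 2 ≤ b ^ 2 * ∑ j, ∑ k, C j k ^ 2 := by
    rw [← sum_sqNorm_columns, Finset.mul_sum]
    exact Finset.sum_le_sum fun k _ => sum_sq_mul_sq_le (v := fun j => C j k) hx
  have hF : 0 ≤ ∑ j, ∑ k, C j k ^ 2 :=
    Finset.sum_nonneg fun _ _ => Finset.sum_nonneg fun _ _ => sq_nonneg _
  exact div_le_of_le_mul₀ hF (sq_nonneg b) h

theorem score_sub_diagScore (C : Matrix κ κ ℝ) (x : κ → ℝ) :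
    score C x - diagScore C x =
      (∑ k, offDiag (fun j => C j k) x) / ∑ j, ∑ k, C j k ^ 2 := by
  rw [score, diagScore, ← sub_div, ← Finset.sum_sub_distrib]; rfl

/-- No relation between clean and corrupted mass is needed here. For M = 0 the quotient is zero and
nothing changes. -/
theorem reweight_mem {w g : ι → ℝ} {M : ℝ} (hw0 : ∀ i, 0 ≤ w i) (hg0 : ∀ i, 0 ≤ g i)
    (hgM : ∀ i, g i ≤ M) (i : ι) : 0 ≤ reweight w g M i ∧ reweight w g M i ≤ w i := by
  have hM0 : 0 ≤ M := (hg0 i).trans (hgM i)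
  have h1 : w i * g i / M ≤ w i := by
    refine div_le_of_le_mul₀ hM0 (hw0 i) ?_
    exact mul_le_mul_of_nonneg_left (hgM i) (hw0 i)
  have h2 : 0 ≤ w i * g i / M := div_nonneg (mul_nonneg (hw0 i) (hg0 i)) hM0
  exact ⟨by rw [reweight]; linarith, by rw [reweight]; linarith⟩

variable [Fintype ι] [DecidableEq κ]

/-- The second moment matrix of a weighted sample, with its diagonal replaced by `b ^ 2`. -/
noncomputable def shiftedMoment (w : ι → ℝ) (ψ : ι → κ → ℝ) (b : ℝ) : Matrix κ κ ℝ :=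
  fun j k => if j = k then b ^ 2 else (∑ i, w i * ψ i j * ψ i k) / Fintype.card ι

theorem shiftedMoment_form (w : ι → ℝ) (ψ : ι → κ → ℝ) (b : ℝ) (v : κ → ℝ) :
    ∑ j, ∑ k, shiftedMoment w ψ b j k * v j * v k =
      b ^ 2 * sqNorm v + (∑ i, w i * offDiag v (ψ i)) / Fintype.card ι := by
  have h1 : ∀ j k, shiftedMoment w ψ b j k * v j * v k =
      (∑ i, w i * (v j * ψ i j) * (v k * ψ i k)) / Fintype.card ι +
      if j = k then b ^ 2 * v j ^ 2 - (∑ i, w i * (v j ^ 2 * ψ i j ^ 2)) / Fintype.card ι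
        else 0 := by
    intro j k
    have e : ∑ i, w i * (v j * ψ i j) * (v k * ψ i k) =
        (∑ i, w i * ψ i j * ψ i k) * v j * v k := by
      rw [Finset.sum_mul, Finset.sum_mul]
      exact Finset.sum_congr rfl fun i _ => by ring
    by_cases hjk : j = k
    · subst hjk
      rw [e, shiftedMoment, if_pos rfl, if_pos rfl]
      have e2 : ∑ i, w i * (v j ^ 2 * ψ i j ^ 2) = (∑ i, w i * ψ i j * ψ i j) * v j * v j := by
        rw [Finset.sum_mul, Finset.sum_mul]
        exact Finset.sum_congr rfl fun i _ => by ring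
      rw [e2]; ring
    · rw [e, shiftedMoment, if_neg hjk, if_neg hjk]; ring
  simp only [h1, Finset.sum_add_distrib, Finset.sum_ite_eq, Finset.mem_univ, if_true,
    Finset.sum_sub_distrib, ← Finset.sum_div]
  have e3 : ∑ j, ∑ k, ∑ i, w i * (v j * ψ i j) * (v k * ψ i k) = ∑ i, w i * dotp v (ψ i) ^ 2 := by
    rw [Finset.sum_congr rfl fun j _ => Finset.sum_comm, Finset.sum_comm]
    refine Finset.sum_congr rfl fun i _ => ?_
    rw [sq, dotp, Finset.sum_mul_sum, Finset.mul_sum]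
    refine Finset.sum_congr rfl fun j _ => ?_
    rw [Finset.mul_sum]
    exact Finset.sum_congr rfl fun k _ => by ring
  have e4 : ∑ j, ∑ i, w i * (v j ^ 2 * ψ i j ^ 2) = ∑ i, w i * ∑ j, v j ^ 2 * ψ i j ^ 2 := by
    rw [Finset.sum_comm]
    exact Finset.sum_congr rfl fun i _ => by rw [Finset.mul_sum]
  rw [e3, e4, sqNorm, Finset.mul_sum]
  simp only [offDiag, mul_sub, Finset.sum_sub_distrib, sub_div]
  ring

/-- The true diagonal entries are at most b², so the shift adds a nonnegative diagonal matrix to a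
weighted moment matrix. -/
theorem shiftedMoment_posSemidef {w : ι → ℝ} {ψ : ι → κ → ℝ} {b : ℝ}
    (hw0 : ∀ i, 0 ≤ w i) (hw1 : ∀ i, w i ≤ 1) (hψ : ∀ i j, |ψ i j| ≤ b) :
    (shiftedMoment w ψ b).PosSemidef := by
  refine Matrix.PosSemidef.of_dotProduct_mulVec_nonneg ?_ fun v => ?_
  · ext j k
    simp only [Matrix.conjTranspose_apply, star_trivial, shiftedMoment, eq_comm (a := k)]
    congr 2
    exact Finset.sum_congr rfl fun i _ => by ring
  · have e : star v ⬝ᵥ (shiftedMoment w ψ b).mulVec v =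
        ∑ j, ∑ k, shiftedMoment w ψ b j k * v j * v k := by
      simp only [star_trivial, dotProduct, Matrix.mulVec, Finset.mul_sum]
      exact Finset.sum_congr rfl fun i _ => Finset.sum_congr rfl fun j _ => by ring
    rw [e, shiftedMoment_form]
    have h1 : ∀ i, -(b ^ 2 * sqNorm v) ≤ w i * offDiag v (ψ i) := fun i => by
      have h2 := sum_sq_mul_sq_le (v := v) (hψ i)
      have h3 := sum_sq_mul_sq_nonneg v (ψ i)
      simp only [offDiag]
      nlinarith [hw0 i, hw1 i, mul_nonneg (hw0 i) (sq_nonneg (dotp v (ψ i)))]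
    have h2 : ∑ _i : ι, -(b ^ 2 * sqNorm v) ≤ ∑ i, w i * offDiag v (ψ i) :=
      Finset.sum_le_sum fun i _ => h1 i
    rw [Finset.sum_const, Finset.card_univ, nsmul_eq_mul] at h2
    rcases (Nat.cast_nonneg (α := ℝ) (Fintype.card ι)).eq_or_lt with h0 | hpos
    · rw [← h0, div_zero, add_zero]; exact mul_nonneg (sq_nonneg b) (sqNorm_nonneg v)
    · have : -(b ^ 2 * sqNorm v) ≤ (∑ i, w i * offDiag v (ψ i)) / Fintype.card ι := by
        rw [le_div_iff₀ hpos]; linarith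
      linarith

theorem shiftedMoment_trace (w : ι → ℝ) (ψ : ι → κ → ℝ) (b : ℝ) :
    (shiftedMoment w ψ b).trace = Fintype.card κ * b ^ 2 := by
  simp [Matrix.trace, shiftedMoment]

/-- The matrix whose columns are the directions in which points are scored. -/
noncomputable def directions (w : ι → ℝ) (ψ : ι → κ → ℝ) (b : ℝ) (K : ℕ) : Matrix κ κ ℝ :=
  shiftedMoment w ψ b ^ K

/-- The excess of the weighted second moment in the directions chosen. -/
noncomputable def excess (w : ι → ℝ) (ψ : ι → κ → ℝ) (b : ℝ) (K : ℕ) : ℝ :=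
  (∑ i, w i * (score (directions w ψ b K) (ψ i) - diagScore (directions w ψ b K) (ψ i))) /
    Fintype.card ι

/-- A small excess controls the off-diagonal part of the second moment in all directions. -/
theorem offDiag_le_of_excess {w : ι → ℝ} {ψ : ι → κ → ℝ} {b : ℝ} {K : ℕ} [Nonempty ι] [Nonempty κ]
    (hb : 0 < b) (hK : 0 < K) (hw0 : ∀ i, 0 ≤ w i) (hw1 : ∀ i, w i ≤ 1)
    (hψ : ∀ i j, |ψ i j| ≤ b) (v : κ → ℝ) :
    ∑ i, w i * offDiag v (ψ i) ≤ Fintype.card ι *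
      (excess w ψ b K + Fintype.card κ * (Fintype.card κ * b ^ 2) / (2 * K)) * sqNorm v := by
  set H := shiftedMoment w ψ b with hHdef
  have hH : H.PosSemidef := shiftedMoment_posSemidef hw0 hw1 hψ
  have htr : H.trace = Fintype.card κ * b ^ 2 := shiftedMoment_trace w ψ b
  set N : ℝ := (Fintype.card ι : ℝ) with hN
  have hN0 : 0 < N := by simp only [hN]; exact_mod_cast Fintype.card_pos
  have hF : 0 < ∑ i, ∑ k, (H ^ K) i k ^ 2 := hH.sum_sq_pow_pos (by
    rw [htr]; have : (0 : ℝ) < Fintype.card κ := by exact_mod_cast Fintype.card_pos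
    positivity) K
  have h := hH.form_le_power_average hK v
  set F := ∑ i, ∑ k, (H ^ K) i k ^ 2 with hFdef
  -- The average of the shifted form over the columns is b² plus the excess; the b² cancels against
  -- the same term for v.
  have hG : ∑ k, ∑ i, ∑ j, H i j * (H ^ K) i k * (H ^ K) j k =
      F * (b ^ 2 + excess w ψ b K) := by
    have e1 : ∀ k, ∑ i, ∑ j, H i j * (H ^ K) i k * (H ^ K) j k =
        b ^ 2 * sqNorm (fun j => (H ^ K) j k) +
          (∑ i, w i * offDiag (fun j => (H ^ K) j k) (ψ i)) / N := fun k =>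
      shiftedMoment_form w ψ b (fun j => (H ^ K) j k)
    simp only [e1, Finset.sum_add_distrib, ← Finset.mul_sum, ← Finset.sum_div]
    rw [sum_sqNorm_columns, ← hFdef]
    have e2 : ∑ k, ∑ i, w i * offDiag (fun j => (H ^ K) j k) (ψ i) =
        F * ∑ i, w i * (score (H ^ K) (ψ i) - diagScore (H ^ K) (ψ i)) := by
      rw [Finset.sum_comm, Finset.mul_sum]
      refine Finset.sum_congr rfl fun i _ => ?_
      rw [score_sub_diagScore, ← hFdef, ← Finset.mul_sum]
      field_simp
    rw [e2, excess, directions, ← hHdef, ← hN]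
    ring
  rw [shiftedMoment_form, hG, htr, ← hN] at h
  change _ ≤ sqNorm v * _ at h
  have h2 : b ^ 2 * sqNorm v + (∑ i, w i * offDiag v (ψ i)) / N ≤ sqNorm v *
      (b ^ 2 + excess w ψ b K + Fintype.card κ * (Fintype.card κ * b ^ 2) / (2 * K)) := by
    refine le_of_mul_le_mul_right ?_ hF
    calc _ ≤ _ := h
      _ = _ := by ring
  have h3 : (∑ i, w i * offDiag v (ψ i)) / N ≤
      (excess w ψ b K + Fintype.card κ * (Fintype.card κ * b ^ 2) / (2 * K)) * sqNorm v := by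
    linarith
  rw [div_le_iff₀ hN0] at h3
  linarith

open Classical in
/-- The amounts by which the weights are reduced, up to normalization. -/
noncomputable def filterScore (w : ι → ℝ) (ψ : ι → κ → ℝ) (b : ℝ) (K : ℕ) (k : ℝ) (i : ι) : ℝ :=
  if w i ≤ 0 then 0 else
    if TopScore (fun i => w i * score (directions w ψ b K) (ψ i)) k i then
      score (directions w ψ b K) (ψ i) else 0

theorem filterScore_nonneg (w : ι → ℝ) (ψ : ι → κ → ℝ) (b : ℝ) (K : ℕ) (k : ℝ) (i : ι) :
    0 ≤ filterScore w ψ b K k i := by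
  unfold filterScore
  split_ifs
  · exact le_rfl
  · exact score_nonneg _ _
  · exact le_rfl

open Classical in
/-- The filter, started with unit weights, meets good weights before all points are removed. -/
theorem exists_small_excess {G : Finset ι} {ψ ψ' : ι → κ → ℝ} {ε L b : ℝ} {K : ℕ}
    [Nonempty ι] (h : Regular ψ ε L)
    (hε : 0 ≤ ε) (hε' : 2 * ε < 1) (hL : 0 ≤ L) (hB : ε * b ^ 2 ≤ L)
    (hG : (Gᶜ.card : ℝ) ≤ ε * Fintype.card ι) (hGψ : ∀ i ∈ G, ψ' i = ψ i)
    (hψ : ∀ i j, |ψ i j| ≤ b)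
    {w : ℕ → ι → ℝ} {M : ℕ → ℝ} (hw : w 0 = fun _ => 1)
    (hstep : ∀ t, w (t + 1) =
      reweight (w t) (filterScore (w t) ψ' b K (2 * ε * Fintype.card ι)) (M t))
    (hM0 : ∀ t, 0 ≤ M t)
    (hgM : ∀ t i, filterScore (w t) ψ' b K (2 * ε * Fintype.card ι) i ≤ M t)
    (hM : ∀ t, M t = 0 ∨ ∃ i, filterScore (w t) ψ' b K (2 * ε * Fintype.card ι) i = M t) :
    ∃ t < Fintype.card ι, ∑ i, (1 - w t i) ≤ 2 * ε * Fintype.card ι ∧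
      excess (w t) ψ' b K ≤ 6 * L := by
  set N : ℝ := (Fintype.card ι : ℝ) with hN
  have hN0 : 0 < N := by simp only [hN]; exact_mod_cast Fintype.card_pos
  by_contra! hcon
  -- As long as the excess is large, clean removal stays below corrupted removal, which is at most
  -- εN. This keeps the weights admissible. Moreover at least t points are dead after t steps.
  have hinv : ∀ t ≤ Fintype.card ι, (∀ i, 0 ≤ w t i) ∧ (∀ i, w t i ≤ 1) ∧
      ∑ i ∈ G, (1 - w t i) ≤ ∑ i ∈ Gᶜ, (1 - w t i) ∧
      (Finset.univ.filter fun i => 0 < w t i).card + t ≤ Fintype.card ι := by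
    intro t
    induction t with
    | zero =>
      intro _
      refine ⟨fun i => by simp [hw], fun i => by simp [hw], by simp [hw], ?_⟩
      simpa using Finset.card_le_univ _
    | succ t ih =>
      intro ht
      obtain ⟨h0, h1, h2, h3⟩ := ih (by omega)
      have hsum : ∑ i, (1 - w t i) ≤ 2 * ε * N := by
        have h4 : ∑ i ∈ Gᶜ, (1 - w t i) ≤ ε * N := by
          refine le_trans (Finset.sum_le_card_nsmul _ _ 1 fun i _ => by linarith [h0 i]) ?_
          simpa using hG
        have := Finset.sum_add_sum_compl G (fun i => 1 - w t i)
        linarith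
      have hbig := hcon t (by omega) hsum
      set C := directions (w t) ψ' b K with hC
      have hmass := corrupted_mass_gt (G := G) (s := fun i => score C (ψ i))
        (q := fun i => diagScore C (ψ i)) (s' := fun i => score C (ψ' i))
        (q' := fun i => diagScore C (ψ' i)) (w := w t) (B := b ^ 2) hL hε hB hG
        (fun i => score_nonneg _ _) (fun i => diagScore_nonneg _ _)
        (fun i => diagScore_le (hψ i)) (fun i => diagScore_nonneg _ _)
        (fun i hi => by simp only [hGψ i hi]) (fun i hi => by simp only [hGψ i hi])
        (by
          simp only [score_sub_diagScore, ← Finset.sum_div]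
          refine div_le_of_le_mul₀ (Finset.sum_nonneg fun _ _ => Finset.sum_nonneg fun _ _ =>
            sq_nonneg _) (by positivity) ?_
          rw [← sum_sqNorm_columns]
          exact h.sum_offDiag_le _)
        (fun a ha0 ha1 ha => by
          simp only [score, ← mul_div_assoc, ← Finset.sum_div]
          refine div_le_of_le_mul₀ (Finset.sum_nonneg fun _ _ => Finset.sum_nonneg fun _ _ =>
            sq_nonneg _) (by positivity) ?_
          rw [← sum_sqNorm_columns]
          exact h.sum_tail_le (fun k j => C j k) ha0 ha1 ha)
        h0 h1 hsum (by
          rw [excess, lt_div_iff₀ hN0] at hbig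
          rw [← hN]; linarith)
      obtain ⟨r0, r1, r2, r3⟩ := reweight_spec (G := G) (s := fun i => score C (ψ' i)) (w := w t)
        (g := filterScore (w t) ψ' b K (2 * ε * N)) (M := M t)
        (T := TopScore (fun i => w t i * score C (ψ' i)) (2 * ε * N))
        (fun i => score_nonneg _ _) h0 (fun i => rfl) (hM0 t) (hgM t) (hM t) hmass
      rw [hstep]
      refine ⟨r0, fun i => (r1 i).trans (h1 i), ?_, by omega⟩
      simp only [Finset.sum_sub_distrib] at r2 h2 ⊢
      linarith
  obtain ⟨h0, h1, h2, h3⟩ := hinv _ le_rfl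
  have hz : ∀ i, w (Fintype.card ι) i = 0 := by
    have : (Finset.univ.filter fun i => 0 < w (Fintype.card ι) i) = ∅ := by
      rw [← Finset.card_eq_zero]; omega
    intro i
    refine le_antisymm ?_ (h0 i)
    by_contra hlt
    have hi : i ∈ (Finset.univ.filter fun i => 0 < w (Fintype.card ι) i) := by
      simpa using hlt
    rw [this] at hi
    simp at hi
  have hcard : (G.card : ℝ) + Gᶜ.card = N := by
    rw [hN]; exact_mod_cast Finset.card_add_card_compl G
  -- With everything removed the invariant reads |G| ≤ |Gᶜ| ≤ εN, which is impossible for 2ε < 1.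
  simp only [hz, sub_zero, Finset.sum_const, nsmul_eq_mul, mul_one] at h2
  nlinarith

end Phase

/-! ### Truncation and the contraction step -/

/-- Truncation at level `b`. -/
def clip (b x : ℝ) : ℝ := max (-b) (min x b)

theorem abs_clip_le {b : ℝ} (hb : 0 ≤ b) (x : ℝ) : |clip b x| ≤ b :=
  abs_le.2 ⟨le_max_left _ _, max_le (by linarith) (min_le_right _ _)⟩

theorem clip_of_abs_le {b x : ℝ} (hx : |x| ≤ b) : clip b x = x := by
  rw [clip, min_eq_left (abs_le.1 hx).2, max_eq_right (abs_le.1 hx).1]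

theorem clip_mono (b : ℝ) : Monotone (clip b) := fun _ _ h =>
  max_le_max le_rfl (min_le_min h le_rfl)

theorem abs_clip_sub_le (b x y : ℝ) : |clip b x - clip b y| ≤ |x - y| := by
  refine (abs_max_sub_max_le_max _ _ _ _).trans ?_
  refine max_le (by simp) ((abs_min_sub_min_le_max _ _ _ _).trans (by simp))

theorem clip_neg {b : ℝ} (hb : 0 ≤ b) (x : ℝ) : clip b (-x) = -clip b x := by
  unfold clip
  rcases le_total x b with h | h <;> rcases le_total (-b) x with h' | h'
  · rw [min_eq_left h, max_eq_right h', min_eq_left (by linarith), max_eq_right (by linarith)]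
  · rw [min_eq_left h, max_eq_left h', min_eq_right (by linarith), max_eq_right (by linarith),
      neg_neg]
  · rw [min_eq_right h, min_eq_left (a := -x) (by linarith),
      max_eq_left (a := -b) (b := -x) (by linarith), max_eq_right (by linarith)]
  · rw [min_eq_right h, min_eq_left (a := -x) (by linarith),
      max_eq_left (a := -b) (b := -x) (by linarith), max_eq_right (by linarith)]

/-- The truncation is monotone and 1-Lipschitz, so its difference quotients lie in [0, 1]. They
equal 1 where both arguments are untruncated. -/
theorem exists_clip_slope (b x y : ℝ) :
    ∃ c, 0 ≤ c ∧ c ≤ 1 ∧ clip b (x - y) = clip b x - c * y ∧ (|x| ≤ b → |x - y| ≤ b → c = 1) := by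
  rcases eq_or_ne y 0 with rfl | hy
  · exact ⟨1, by norm_num, le_rfl, by simp, fun _ _ => rfl⟩
  · refine ⟨(clip b x - clip b (x - y)) / y, ?_, ?_, by field_simp; ring, fun h h' => ?_⟩
    · rcases hy.lt_or_gt with h | h
      · exact div_nonneg_of_nonpos (sub_nonpos.2 (clip_mono b (by linarith))) h.le
      · exact div_nonneg (sub_nonneg.2 (clip_mono b (by linarith))) h.le
    · have h1 := abs_clip_sub_le b x (x - y)
      rw [sub_sub_cancel] at h1
      refine (le_abs_self _).trans ?_
      rw [abs_div]
      exact div_le_one_of_le₀ h1 (abs_nonneg _)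
    · rw [clip_of_abs_le h, clip_of_abs_le h', sub_sub_cancel, div_self hy]

section Descent

variable {ι κ : Type*} [Fintype ι] [Fintype κ]

noncomputable def l2 (v : κ → ℝ) : ℝ := Real.sqrt (sqNorm v)

theorem l2_eq_norm (v : κ → ℝ) : l2 v = ‖(WithLp.toLp 2 v : EuclideanSpace ℝ κ)‖ := by
  rw [EuclideanSpace.norm_eq]
  simp [l2, sqNorm]

theorem l2_nonneg (v : κ → ℝ) : 0 ≤ l2 v := Real.sqrt_nonneg _

theorem l2_sq (v : κ → ℝ) : l2 v ^ 2 = sqNorm v := Real.sq_sqrt (sqNorm_nonneg v)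

theorem l2_add_le (v w : κ → ℝ) : l2 (v + w) ≤ l2 v + l2 w := by
  simp only [l2_eq_norm, WithLp.toLp_add]
  exact norm_add_le _ _

theorem l2_le_of_abs_le {v w : κ → ℝ} (h : ∀ j, |v j| ≤ |w j|) : l2 v ≤ l2 w :=
  Real.sqrt_le_sqrt (Finset.sum_le_sum fun j _ => sq_le_sq.2 (h j))

theorem l2_le_of_abs_le_mul {v w : κ → ℝ} {c : ℝ} (hc : 0 ≤ c) (h : ∀ j, |v j| ≤ c * |w j|) :
    l2 v ≤ c * l2 w := by
  rw [l2, l2, ← Real.sqrt_sq hc, ← Real.sqrt_mul (sq_nonneg _)]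
  refine Real.sqrt_le_sqrt ?_
  rw [sqNorm, sqNorm, Finset.mul_sum]
  refine Finset.sum_le_sum fun j _ => ?_
  rw [← sq_abs (v j), ← sq_abs (w j), ← mul_pow]
  exact pow_le_pow_left₀ (abs_nonneg _) (h j) 2

open Classical in
/-- The truncated mean contracts towards the location, coordinate by coordinate. -/
theorem exists_mean_slope [Nonempty ι] {x : ι → ℝ} {y ρ α : ℝ} (hρ : 0 < ρ) (hy : |y| ≤ 2 * ρ)
    (hcount : α / 2 * Fintype.card ι ≤ ((Finset.univ.filter fun i => |x i| ≤ ρ).card : ℝ)) :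
    ∃ c, α / 2 ≤ c ∧ c ≤ 1 ∧ (∑ i, clip (3 * ρ) (x i - y)) / Fintype.card ι =
      (∑ i, clip (3 * ρ) (x i)) / Fintype.card ι - c * y := by
  have hN0 : (0 : ℝ) < Fintype.card ι := by exact_mod_cast Fintype.card_pos
  choose c hc0 hc1 hc hcone using fun i => exists_clip_slope (3 * ρ) (x i) y
  refine ⟨(∑ i, c i) / Fintype.card ι, ?_, ?_, ?_⟩
  · rw [le_div_iff₀ hN0]
    refine hcount.trans ?_
    rw [← Finset.sum_boole]
    refine Finset.sum_le_sum fun i _ => ?_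
    split_ifs with h
    -- The level 3ρ is chosen so that |x i| ≤ ρ and |y| ≤ 2ρ leave x i - y untruncated.
    · rw [hcone i (by linarith)]
      calc |x i - y| ≤ |x i| + |y| := abs_sub _ _
        _ ≤ _ := by linarith
    · exact hc0 i
  · rw [div_le_one hN0]
    calc ∑ i, c i ≤ ∑ _i : ι, (1 : ℝ) := Finset.sum_le_sum fun i _ => hc1 i
      _ = _ := by simp
  · simp only [hc, Finset.sum_sub_distrib, ← Finset.sum_mul]
    ring

/-- One gradient step with good weights. -/
theorem descent_step [Nonempty ι] {X Z : ι → κ → ℝ} {μ u u₀ u' : κ → ℝ} {w : ι → ℝ}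
    {ρ α M η : ℝ} (hρ : 0 < ρ) (hα1 : α ≤ 2) (hη : 0 ≤ η)
    (hu : ∀ j, |u j - μ j| ≤ 2 * ρ) (hu₀ : ∀ j, |u₀ j - μ j| ≤ ρ)
    (hcount : ∀ j, α / 2 * Fintype.card ι ≤
      ((Finset.univ.filter fun i => |X i j - μ j| ≤ ρ).card : ℝ))
    (hmean : l2 (fun j => (∑ i, clip (3 * ρ) (X i j - μ j)) / Fintype.card ι) ≤ M)
    (hclose : ∀ v : κ → ℝ,
      |∑ i, w i * dotp v (fun j => clip (3 * ρ) (Z i j - u j)) -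
        ∑ i, dotp v (fun j => clip (3 * ρ) (X i j - u j))| ≤
      Fintype.card ι * η * Real.sqrt (sqNorm v))
    (hu' : ∀ j, u' j = u₀ j + clip ρ
      (u j + (∑ i, w i * clip (3 * ρ) (Z i j - u j)) / Fintype.card ι - u₀ j)) :
    (∀ j, |u' j - μ j| ≤ 2 * ρ) ∧
      l2 (fun j => u' j - μ j) ≤ (1 - α / 2) * l2 (fun j => u j - μ j) + M + η := by
  have hN0 : (0 : ℝ) < Fintype.card ι := by exact_mod_cast Fintype.card_pos
  constructor
  · intro j
    rw [hu', show u₀ j + clip ρ (u j + (∑ i, w i * clip (3 * ρ) (Z i j - u j)) / Fintype.card ι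
      - u₀ j) - μ j = (u₀ j - μ j) + clip ρ (u j + (∑ i, w i * clip (3 * ρ) (Z i j - u j)) /
        Fintype.card ι - u₀ j) by ring]
    refine (abs_add_le _ _).trans ?_
    linarith [hu₀ j, abs_clip_le hρ.le (u j + (∑ i, w i * clip (3 * ρ) (Z i j - u j)) /
      Fintype.card ι - u₀ j)]
  · choose c hc0 hc1 hc using fun j =>
      exists_mean_slope (x := fun i => X i j - μ j) hρ (hu j) (hcount j)
    set e : κ → ℝ := fun j => (∑ i, w i * clip (3 * ρ) (Z i j - u j)) / Fintype.card ι -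
      (∑ i, clip (3 * ρ) (X i j - u j)) / Fintype.card ι with he
    -- The closeness hypothesis is tested on v = e itself, which gives ‖e‖² ≤ η‖e‖.
    have hel : l2 e ≤ η := by
      have h1 := hclose e
      have h2 : ∑ i, w i * dotp e (fun j => clip (3 * ρ) (Z i j - u j)) -
          ∑ i, dotp e (fun j => clip (3 * ρ) (X i j - u j)) = Fintype.card ι * sqNorm e := by
        simp only [dotp, Finset.mul_sum]
        rw [Finset.sum_comm, Finset.sum_comm (f := fun i j => e j * clip (3 * ρ) (X i j - u j)),
          ← Finset.sum_sub_distrib, sqNorm, Finset.mul_sum]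
        refine Finset.sum_congr rfl fun j _ => ?_
        have h3 : (Fintype.card ι : ℝ) * e j = ∑ i, w i * clip (3 * ρ) (Z i j - u j) -
            ∑ i, clip (3 * ρ) (X i j - u j) := by
          simp only [he]; field_simp
        rw [sq, ← mul_assoc, h3, sub_mul, Finset.sum_mul, Finset.sum_mul]
        congr 1 <;> exact Finset.sum_congr rfl fun i _ => by ring
      rw [h2, abs_of_nonneg (mul_nonneg hN0.le (sqNorm_nonneg e)), mul_assoc] at h1
      have h4 := le_of_mul_le_mul_left h1 hN0
      change sqNorm e ≤ η * l2 e at h4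
      rw [← l2_sq, sq] at h4
      by_contra hcon
      push Not at hcon
      have h5 : 0 < l2 e := hη.trans_lt hcon
      have h6 : l2 e ≤ η := le_of_mul_le_mul_right h4 h5
      linarith
    have h1 : l2 (fun j => u' j - μ j) ≤ l2 ((fun j => (1 - c j) * (u j - μ j)) +
        ((fun j => (∑ i, clip (3 * ρ) (X i j - μ j)) / Fintype.card ι) + e)) := by
      refine l2_le_of_abs_le fun j => ?_
      -- The location lies in the box of radius ρ about u₀, so clipping the update to that box
      -- brings no coordinate farther from it.
      have h2 : μ j = u₀ j + clip ρ (μ j - u₀ j) := by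
        rw [clip_of_abs_le (by rw [abs_sub_comm]; exact hu₀ j)]; ring
      have h3 : u' j - μ j = clip ρ
          (u j + (∑ i, w i * clip (3 * ρ) (Z i j - u j)) / Fintype.card ι - u₀ j) -
          clip ρ (μ j - u₀ j) := by
        rw [hu']; linarith
      rw [h3]
      refine (abs_clip_sub_le _ _ _).trans (le_of_eq ?_)
      congr 1
      have h4 := hc j
      simp only [sub_sub_sub_cancel_right] at h4
      simp only [Pi.add_apply, he, h4]
      ring
    have h2 : l2 (fun j => (1 - c j) * (u j - μ j)) ≤ (1 - α / 2) * l2 (fun j => u j - μ j) := by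
      refine l2_le_of_abs_le_mul (by linarith) fun j => ?_
      rw [abs_mul, abs_of_nonneg (by linarith [hc1 j])]
      exact mul_le_mul_of_nonneg_right (by linarith [hc0 j]) (abs_nonneg _)
    have h3 := l2_add_le (fun j => (1 - c j) * (u j - μ j))
      ((fun j => (∑ i, clip (3 * ρ) (X i j - μ j)) / Fintype.card ι) + e)
    have h4 := l2_add_le (fun j => (∑ i, clip (3 * ρ) (X i j - μ j)) / Fintype.card ι) e
    linarith

/-- A weighted average of the middle points of a sample. -/
noncomputable def midAverage (z : ι → ℝ) : ℝ :=
  (∑ i, if (∑ j, if z i ≤ z j then (0 : ℝ) else 1) ≤ Fintype.card ι / 2 then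
      (if (∑ j, if z j ≤ z i then (0 : ℝ) else 1) ≤ Fintype.card ι / 2 then z i else 0) else 0) /
  (∑ i, if (∑ j, if z i ≤ z j then (0 : ℝ) else 1) ≤ Fintype.card ι / 2 then
      (if (∑ j, if z j ≤ z i then (0 : ℝ) else 1) ≤ Fintype.card ι / 2 then (1 : ℝ) else 0) else 0)

/-- A point below lo would have more than half of the sample strictly above it, so it is not
averaged; likewise above hi. This substitute for the median needs comparisons and sums but no
sorting. -/
theorem midAverage_mem [Nonempty ι] {z : ι → ℝ} {lo hi : ℝ}
    (hlo : 2 * ((Finset.univ.filter fun i => z i < lo).card : ℝ) < Fintype.card ι)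
    (hhi : 2 * ((Finset.univ.filter fun i => hi < z i).card : ℝ) < Fintype.card ι) :
    lo ≤ midAverage z ∧ midAverage z ≤ hi := by
  set N : ℝ := (Fintype.card ι : ℝ) with hN
  have hflip : ∀ (P : ι → Prop) [DecidablePred P], (∑ j, if P j then (0 : ℝ) else 1) =
      ((Finset.univ.filter fun j => ¬ P j).card : ℝ) := by
    intro P _
    rw [← Finset.sum_boole]
    exact Finset.sum_congr rfl fun j _ => by split_ifs <;> simp_all
  have hcompl : ∀ (P : ι → Prop) [DecidablePred P], ((Finset.univ.filter P).card : ℝ) +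
      ((Finset.univ.filter fun j => ¬ P j).card : ℝ) = N := by
    intro P _
    rw [hN, ← Finset.card_univ]
    exact_mod_cast Finset.card_filter_add_card_filter_not P
  have hmono : ∀ {P Q : ι → Prop} [DecidablePred P] [DecidablePred Q], (∀ j, P j → Q j) →
      ((Finset.univ.filter P).card : ℝ) ≤ ((Finset.univ.filter Q).card : ℝ) := by
    intro P Q _ _ h
    exact_mod_cast Finset.card_le_card fun j hj => by
      simp only [Finset.mem_filter, Finset.mem_univ, true_and] at hj ⊢; exact h j hj
  set I : ι → ℝ := fun i => if (∑ j, if z i ≤ z j then (0 : ℝ) else 1) ≤ N / 2 then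
      (if (∑ j, if z j ≤ z i then (0 : ℝ) else 1) ≤ N / 2 then (1 : ℝ) else 0) else 0 with hI
  have hI0 : ∀ i, 0 ≤ I i := fun i => by simp only [hI]; split_ifs <;> norm_num
  have havg : midAverage z = (∑ i, I i * z i) / ∑ i, I i := by
    rw [midAverage]
    congr 1
    exact Finset.sum_congr rfl fun i _ => by simp only [hI, ← hN]; split_ifs <;> simp
  have hmid : ∀ i, I i ≠ 0 → lo ≤ z i ∧ z i ≤ hi := by
    intro i hi'
    simp only [hI, hflip, ne_eq, ite_eq_right_iff, Classical.not_imp, one_ne_zero,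
      not_false_eq_true, and_true, not_le] at hi'
    constructor
    · by_contra hcon
      push Not at hcon
      have h1 := hcompl fun j => z j < lo
      have h2 := hmono (P := fun j => ¬ z j < lo) (Q := fun j => z i < z j)
        fun j hj => hcon.trans_le (not_lt.1 hj)
      linarith [hi'.2]
    · by_contra hcon
      push Not at hcon
      have h1 := hcompl fun j => hi < z j
      have h2 := hmono (P := fun j => ¬ hi < z j) (Q := fun j => z j < z i)
        fun j hj => (not_lt.1 hj).trans_lt hcon
      linarith [hi'.1]
  -- The denominator is positive: the largest point with at most half of the sample strictly below
  -- it also has at most half strictly above it.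
  have hex : ∃ i, I i = 1 := by
    set S := Finset.univ.filter fun i =>
      ((Finset.univ.filter fun j => z j < z i).card : ℝ) ≤ N / 2 with hS
    have hSne : S.Nonempty := by
      obtain ⟨i, -, hi⟩ := Finset.univ.exists_min_image z Finset.univ_nonempty
      refine ⟨i, ?_⟩
      simp only [hS, Finset.mem_filter, Finset.mem_univ, true_and]
      have : (Finset.univ.filter fun j => z j < z i) = ∅ :=
        Finset.filter_eq_empty_iff.2 fun j hj => not_lt.2 (hi j hj)
      rw [this]
      simp [hN]; positivity
    obtain ⟨i, hiS, hmax⟩ := S.exists_max_image z hSne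
    refine ⟨i, ?_⟩
    have h1 : ((Finset.univ.filter fun j => z j < z i).card : ℝ) ≤ N / 2 := by
      simpa [hS] using hiS
    have h2 : ((Finset.univ.filter fun j => z i < z j).card : ℝ) ≤ N / 2 := by
      set A := Finset.univ.filter fun j => z i < z j with hA
      rcases A.eq_empty_or_nonempty with h | h
      · rw [h]; simp [hN]; positivity
      · obtain ⟨k, hk, hkmin⟩ := A.exists_min_image z h
        have hik : z i < z k := by simpa [hA] using hk
        have hkS : k ∉ S := fun hkS => absurd (hmax k hkS) (not_le.2 hik)
        simp only [hS, Finset.mem_filter, Finset.mem_univ, true_and, not_le] at hkS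
        have h3 := hmono (P := fun j => z j < z k) (Q := fun j => ¬ z i < z j) fun j hj hij =>
          absurd (hkmin j (by simpa [hA] using hij)) (not_le.2 hj)
        have h4 := hcompl fun j => z i < z j
        linarith
    simp only [hI, hflip, not_le]
    rw [if_pos h1, if_pos h2]
  have hpos : 0 < ∑ i, I i := by
    obtain ⟨i, hi⟩ := hex
    exact Finset.sum_pos' (fun i _ => hI0 i) ⟨i, Finset.mem_univ i, by rw [hi]; norm_num⟩
  rw [havg]
  constructor
  · rw [le_div_iff₀ hpos, Finset.mul_sum]
    refine Finset.sum_le_sum fun i _ => ?_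
    by_cases h : I i = 0
    · simp [h]
    · nlinarith [hI0 i, (hmid i h).1]
  · rw [div_le_iff₀ hpos, Finset.mul_sum]
    refine Finset.sum_le_sum fun i _ => ?_
    by_cases h : I i = 0
    · simp [h]
    · nlinarith [hI0 i, (hmid i h).2]

end Descent

/-! ### Truncated semi-product vectors -/

section SemiProduct

variable {d : ℕ}

theorem Real.measurable_sign' : Measurable Real.sign := by
  unfold Real.sign
  exact Measurable.ite measurableSet_Iio measurable_const
    (Measurable.ite measurableSet_Ioi measurable_const measurable_const)

theorem Real.abs_sign_le (x : ℝ) : |Real.sign x| ≤ 1 := by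
  rcases Real.sign_apply_eq x with h | h | h <;> simp [h]

/-- Truncation is odd. Once the absolute values are frozen, a truncated vector is linear in the
independent signs. -/
theorem clip_eq_sign_mul {b : ℝ} (hb : 0 ≤ b) (x : ℝ) : clip b x = Real.sign x * clip b |x| := by
  rcases lt_trichotomy x 0 with h | rfl | h
  · rw [Real.sign_of_neg h, abs_of_neg h, clip_neg hb]; ring
  · simp [clip, hb]
  · rw [Real.sign_of_pos h, abs_of_pos h, one_mul]

theorem measurable_clip (b : ℝ) : Measurable (clip b) := by
  unfold clip; fun_prop

/-- The truncation of a vector. -/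
def clipVec (b : ℝ) (x : EuclideanSpace ℝ (Fin d)) : Fin d → ℝ := fun j => clip b (x j)

theorem measurable_dotp_clipVec (b : ℝ) (v : Fin d → ℝ) :
    Measurable fun x : EuclideanSpace ℝ (Fin d) => dotp v (clipVec b x) := by
  unfold dotp clipVec
  refine Finset.measurable_sum _ fun j _ => ?_
  have := measurable_clip b
  fun_prop

theorem measurable_offDiag_clipVec (b : ℝ) (v : Fin d → ℝ) :
    Measurable fun x : EuclideanSpace ℝ (Fin d) => offDiag v (clipVec b x) := by
  unfold offDiag
  refine ((measurable_dotp_clipVec b v).pow_const 2).sub (Finset.measurable_sum _ fun j _ => ?_)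
  unfold clipVec
  have := measurable_clip b
  fun_prop

theorem abs_dotp_le {v x : Fin d → ℝ} {b : ℝ} (hx : ∀ j, |x j| ≤ b) :
    |dotp v x| ≤ ∑ j, |v j| * b := by
  refine (Finset.abs_sum_le_sum_abs _ _).trans (Finset.sum_le_sum fun j _ => ?_)
  rw [abs_mul]; exact mul_le_mul_of_nonneg_left (hx j) (abs_nonneg _)

theorem abs_dotp_clipVec_le {b : ℝ} (hb : 0 ≤ b) (v : Fin d → ℝ) (x : EuclideanSpace ℝ (Fin d)) :
    |dotp v (clipVec b x)| ≤ ∑ j, |v j| * b := abs_dotp_le fun _ => abs_clip_le hb _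

variable {α ρ : ℝ} {P : Measure (EuclideanSpace ℝ (Fin d))}

theorem IsSemiProduct.integral_sign (hP : IsSemiProduct α ρ P) (j : Fin d) :
    ∫ η, Real.sign (η j) ∂P = 0 := by
  have e1 : ∫ η, Real.sign (η j) ∂P = ∫ x, Real.sign x ∂(P.map fun η => η j) := by
    rw [integral_map (by fun_prop) Real.measurable_sign'.aestronglyMeasurable]
  have e2 : ∫ η, Real.sign (-η j) ∂P = ∫ x, Real.sign x ∂(P.map fun η => -η j) := by
    rw [integral_map (by fun_prop) Real.measurable_sign'.aestronglyMeasurable]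
  rw [hP.symm j, ← e2] at e1
  have e3 : ∀ x, Real.sign (-x) = -Real.sign x := fun x => by
    rcases lt_trichotomy x 0 with h | rfl | h
    · rw [Real.sign_of_neg h, Real.sign_of_pos (by linarith)]; ring
    · simp
    · rw [Real.sign_of_pos h, Real.sign_of_neg (by linarith)]
  simp only [e3, integral_neg] at e1
  linarith

variable [IsProbabilityMeasure P]

/-- Averages over a semi-product law may be computed with the absolute values frozen. -/
theorem IsSemiProduct.integral_le_of_frozen (hP : IsSemiProduct α ρ P)
    {F : (Fin d → ℝ) × (Fin d → ℝ) → ℝ} (hF : Measurable F) {B c : ℝ}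
    (hB : ∀ (η : EuclideanSpace ℝ (Fin d)) a, |F (fun j => Real.sign (η j), a)| ≤ B)
    (h : ∀ a, ∫ η, F (fun j => Real.sign (η j), a) ∂P ≤ c) :
    ∫ η, F (fun j => Real.sign (η j), fun j => |η j|) ∂P ≤ c := by
  have hS : Measurable fun (η : EuclideanSpace ℝ (Fin d)) (j : Fin d) => Real.sign (η j) :=
    measurable_pi_lambda _ fun j => Real.measurable_sign'.comp (by fun_prop)
  have hA : Measurable fun (η : EuclideanSpace ℝ (Fin d)) (j : Fin d) => |η j| :=
    measurable_pi_lambda _ fun j => by fun_prop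
  -- The joint law of signs and absolute values is a product, so Fubini integrates over the signs
  -- first.
  have hmap := (indepFun_iff_map_prod_eq_prod_map_map hS.aemeasurable hA.aemeasurable).1
    hP.indep_sign_abs
  have : IsProbabilityMeasure (P.map fun η (j : Fin d) => Real.sign (η j)) :=
    Measure.isProbabilityMeasure_map hS.aemeasurable
  have : IsProbabilityMeasure (P.map fun η (j : Fin d) => |η j|) :=
    Measure.isProbabilityMeasure_map hA.aemeasurable
  have hInt : Integrable F ((P.map fun η (j : Fin d) => Real.sign (η j)).prod
      (P.map fun η (j : Fin d) => |η j|)) := by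
    rw [← hmap, integrable_map_measure hF.aestronglyMeasurable (hS.prodMk hA).aemeasurable]
    exact Integrable.of_bound (hF.comp (hS.prodMk hA)).aestronglyMeasurable B
      (Filter.Eventually.of_forall fun η => by
        rw [Real.norm_eq_abs]; exact hB η fun j => |η j|)
  have e1 : ∫ η, F (fun j => Real.sign (η j), fun j => |η j|) ∂P =
      ∫ p, F p ∂((P.map fun η (j : Fin d) => Real.sign (η j)).prod
        (P.map fun η (j : Fin d) => |η j|)) := by
    rw [← hmap, integral_map (hS.prodMk hA).aemeasurable hF.aestronglyMeasurable]
  rw [e1, integral_prod_symm F hInt]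
  have e2 : ∀ a, ∫ s, F (s, a) ∂(P.map fun η (j : Fin d) => Real.sign (η j)) ≤ c := fun a => by
    have hFa : Measurable fun s => F (s, a) := hF.comp (measurable_id.prodMk measurable_const)
    rw [integral_map hS.aemeasurable hFa.aestronglyMeasurable]
    exact h a
  calc _ ≤ ∫ _a, c ∂(P.map fun η (j : Fin d) => |η j|) :=
        integral_mono hInt.integral_prod_right (integrable_const c) e2
    _ = c := by simp

/-- Hoeffding's lemma applies to each centred sign in [-1, 1], and the exponents add by mutual
independence. -/
theorem IsSemiProduct.mgf_frozen_le (hP : IsSemiProduct α ρ P) {c : Fin d → ℝ} (t : ℝ) :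
    ∫ η, Real.exp (t * ∑ j, c j * Real.sign (η j)) ∂P ≤ Real.exp (t ^ 2 * sqNorm c / 2) := by
  have hsub : ∀ j, HasSubgaussianMGF (fun η : EuclideanSpace ℝ (Fin d) => c j * Real.sign (η j))
      (‖c j‖₊ ^ 2) P := by
    intro j
    have h := hasSubgaussianMGF_of_mem_Icc_of_integral_eq_zero (μ := P) (a := -1) (b := 1)
      (X := fun η => Real.sign (η j))
      (Real.measurable_sign'.comp (by fun_prop)).aemeasurable
      (Filter.Eventually.of_forall fun η => abs_le.1 (Real.abs_sign_le _)) (hP.integral_sign j)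
    have h2 := h.const_mul (c j)
    convert h2 using 1
    refine NNReal.eq ?_
    have e : ‖(1 : ℝ) - -1‖ = 2 := by norm_num
    change ‖c j‖ ^ 2 = c j ^ 2 * (‖(1 : ℝ) - -1‖ / 2) ^ 2
    rw [e, Real.norm_eq_abs, sq_abs]; ring
  have hind : iIndepFun (fun (j : Fin d) (η : EuclideanSpace ℝ (Fin d)) =>
      c j * Real.sign (η j)) P :=
    hP.indep_signs.comp (fun j x => c j * x) fun j => by fun_prop
  have h := (HasSubgaussianMGF.sum_of_iIndepFun hind (s := Finset.univ)
    fun j _ => hsub j).mgf_le t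
  simp only [mgf] at h
  refine h.trans (le_of_eq ?_)
  congr 2
  simp [sqNorm, mul_comm]

theorem dotp_clipVec_eq {b : ℝ} (hb : 0 ≤ b) (v : Fin d → ℝ) (η : EuclideanSpace ℝ (Fin d)) :
    dotp v (clipVec b η) = ∑ j, v j * clip b |η j| * Real.sign (η j) := by
  simp only [dotp, clipVec]
  exact Finset.sum_congr rfl fun j _ => by rw [clip_eq_sign_mul hb]; ring

/-- The frozen coefficients have squared norm at most b²‖v‖² ≤ 2b². The bound 2 on ‖v‖² is the one
that grid points satisfy. -/
theorem IsSemiProduct.mgf_dotp_le (hP : IsSemiProduct α ρ P) {b : ℝ} (hb : 0 ≤ b) {v : Fin d → ℝ}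
    (hv : sqNorm v ≤ 2) (t : ℝ) :
    ∫ η, Real.exp (t * dotp v (clipVec b η)) ∂P ≤ Real.exp (t ^ 2 * b ^ 2) := by
  simp only [dotp_clipVec_eq hb]
  have hm := measurable_clip b
  refine hP.integral_le_of_frozen
    (F := fun p => Real.exp (t * ∑ j, v j * clip b (p.2 j) * p.1 j))
    (B := Real.exp (|t| * ∑ j, |v j| * b)) ?_ ?_ ?_
  · refine Real.measurable_exp.comp (measurable_const.mul (Finset.measurable_sum _ fun j _ => ?_))
    fun_prop
  · intro η a
    rw [Real.abs_exp, Real.exp_le_exp]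
    refine (le_abs_self _).trans ?_
    rw [abs_mul]
    refine mul_le_mul_of_nonneg_left ?_ (abs_nonneg t)
    refine (Finset.abs_sum_le_sum_abs _ _).trans (Finset.sum_le_sum fun j _ => ?_)
    rw [abs_mul, abs_mul]
    have h1 := Real.abs_sign_le (η j)
    have h2 := abs_clip_le hb (a j)
    calc |v j| * |clip b (a j)| * |Real.sign (η j)| ≤ |v j| * b * 1 := by gcongr
      _ = _ := mul_one _
  · intro a
    refine (hP.mgf_frozen_le (c := fun j => v j * clip b (a j)) t).trans (Real.exp_le_exp.2 ?_)
    have h1 : sqNorm (fun j => v j * clip b (a j)) ≤ b ^ 2 * sqNorm v := by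
      simp only [sqNorm, mul_pow]
      exact sum_sq_mul_sq_le fun j => abs_clip_le hb _
    have h2 : b ^ 2 * sqNorm v ≤ b ^ 2 * 2 := by gcongr
    nlinarith [sq_nonneg t]

theorem offDiag_eq_sum (v x : Fin d → ℝ) :
    offDiag v x = ∑ j, ∑ k, if j = k then 0 else (v j * x j) * (v k * x k) := by
  have : ∀ j k, (if j = k then 0 else (v j * x j) * (v k * x k)) =
      (v j * x j) * (v k * x k) - if j = k then (v j * x j) * (v k * x k) else 0 := fun j k => by
    split_ifs <;> ring
  simp only [this, Finset.sum_sub_distrib, Finset.sum_ite_eq, Finset.mem_univ, if_true]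
  rw [offDiag, sq, dotp, Finset.sum_mul_sum]
  congr 1
  exact Finset.sum_congr rfl fun j _ => by ring

/-- Only products of two different signs occur, and those are independent and centred. -/
theorem IsSemiProduct.integral_offDiag_frozen (hP : IsSemiProduct α ρ P) (c : Fin d → ℝ) :
    ∫ η, offDiag c (fun j => Real.sign (η j)) ∂P = 0 := by
  have hms : ∀ j, Measurable fun η : EuclideanSpace ℝ (Fin d) => Real.sign (η j) := fun j =>
    Real.measurable_sign'.comp (by fun_prop)
  have hpair : ∀ j k, j ≠ k → ∫ η, (c j * Real.sign (η j)) * (c k * Real.sign (η k)) ∂P = 0 := by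
    intro j k hjk
    have h := (hP.indep_signs.indepFun hjk).integral_fun_mul_eq_mul_integral
      (hms j).aestronglyMeasurable (hms k).aestronglyMeasurable
    have e : ∀ η : EuclideanSpace ℝ (Fin d), (c j * Real.sign (η j)) * (c k * Real.sign (η k)) =
        (c j * c k) * (Real.sign (η j) * Real.sign (η k)) := fun η => by ring
    simp only [e, integral_const_mul, h, hP.integral_sign, mul_zero]
  have hInt : ∀ j k, Integrable (fun η : EuclideanSpace ℝ (Fin d) => if j = k then (0 : ℝ) else
      (c j * Real.sign (η j)) * (c k * Real.sign (η k))) P := by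
    intro j k
    split_ifs
    · exact integrable_const _
    · refine Integrable.of_bound (((hms j).const_mul _).mul
        ((hms k).const_mul _)).aestronglyMeasurable (|c j| * 1 * (|c k| * 1))
        (Filter.Eventually.of_forall fun η => ?_)
      rw [Real.norm_eq_abs, abs_mul, abs_mul, abs_mul]
      have := Real.abs_sign_le (η j)
      have := Real.abs_sign_le (η k)
      gcongr
  simp only [offDiag_eq_sum]
  rw [integral_finsetSum _ fun j _ => integrable_finsetSum _ fun k _ => hInt j k]
  refine Finset.sum_eq_zero fun j _ => ?_
  rw [integral_finsetSum _ fun k _ => hInt j k]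
  refine Finset.sum_eq_zero fun k _ => ?_
  split_ifs with h
  · simp
  · exact hpair j k h

theorem abs_offDiag_le {v x : Fin d → ℝ} {b : ℝ} (hx : ∀ j, |x j| ≤ b) :
    |offDiag v x| ≤ dotp v x ^ 2 + b ^ 2 * sqNorm v := by
  have h1 := sum_sq_mul_sq_le (v := v) hx
  have h2 := sum_sq_mul_sq_nonneg v x
  rw [offDiag, abs_le]
  constructor <;> nlinarith [sq_nonneg (dotp v x)]

/-- The mean vanishes with the absolute values frozen. The arbitrary real factor s lets one
inequality serve both signs of the exponent. -/
theorem IsSemiProduct.integral_offDiag_le (hP : IsSemiProduct α ρ P) {b : ℝ} (hb : 0 ≤ b)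
    (v : Fin d → ℝ) (s : ℝ) : ∫ η, s * offDiag v (clipVec b η) ∂P ≤ 0 := by
  have hm := measurable_clip b
  have e : ∀ η : EuclideanSpace ℝ (Fin d), offDiag v (clipVec b η) =
      offDiag (fun j => v j * clip b |η j|) (fun j => Real.sign (η j)) := by
    intro η
    simp only [offDiag_eq_sum, clipVec]
    refine Finset.sum_congr rfl fun j _ => Finset.sum_congr rfl fun k _ => ?_
    split_ifs
    · rfl
    · rw [clip_eq_sign_mul hb (η j), clip_eq_sign_mul hb (η k)]; ring
  simp only [e]
  refine hP.integral_le_of_frozen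
    (F := fun p => s * offDiag (fun j => v j * clip b (p.2 j)) p.1)
    (B := |s| * ((∑ j, |v j| * b) ^ 2 + b ^ 2 * sqNorm v)) ?_ ?_ ?_
  · simp only [offDiag_eq_sum]
    refine measurable_const.mul (Finset.measurable_sum _ fun j _ =>
      Finset.measurable_sum _ fun k _ => ?_)
    split_ifs <;> fun_prop
  · intro η a
    rw [abs_mul]
    refine mul_le_mul_of_nonneg_left ?_ (abs_nonneg _)
    have hc : ∀ j, |clip b (a j) * Real.sign (η j)| ≤ b := fun j => by
      rw [abs_mul]
      calc _ ≤ b * 1 := mul_le_mul (abs_clip_le hb _) (Real.abs_sign_le _) (abs_nonneg _) hb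
        _ = b := mul_one b
    have e2 : offDiag (fun j => v j * clip b (a j)) (fun j => Real.sign (η j)) =
        offDiag v (fun j => clip b (a j) * Real.sign (η j)) := by
      simp only [offDiag_eq_sum, mul_assoc]
    rw [e2]
    refine (abs_offDiag_le hc).trans ?_
    have h1 := abs_dotp_le (v := v) hc
    rw [← sq_abs]
    gcongr
  · intro a
    rw [integral_const_mul]
    exact (congrArg (s * ·) (hP.integral_offDiag_frozen fun j => v j * clip b (a j))).le.trans
      (mul_zero s).le

end SemiProduct

/-! ### Exponential moments -/

theorem lintegral_exp_sq_gaussian :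
    ∫⁻ g, ENNReal.ofReal (Real.exp (g ^ 2 / 4)) ∂(gaussianReal 0 1) = ENNReal.ofReal (Real.sqrt 2) := by
  rw [gaussianReal_of_var_ne_zero _ one_ne_zero,
    lintegral_withDensity_eq_lintegral_mul _ (measurable_gaussianPDF _ _) (by fun_prop)]
  have e : ∀ g : ℝ, (gaussianPDF 0 1 * fun g => ENNReal.ofReal (Real.exp (g ^ 2 / 4))) g =
      ENNReal.ofReal ((Real.sqrt (2 * Real.pi))⁻¹ * Real.exp (-(1 / 4) * g ^ 2)) := by
    intro g
    simp only [Pi.mul_apply, gaussianPDF, gaussianPDFReal]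
    rw [← ENNReal.ofReal_mul (by positivity), mul_assoc, ← Real.exp_add]
    congr 2
    · simp
    · congr 1; simp; ring
  simp only [e]
  rw [← ofReal_integral_eq_lintegral_ofReal
    ((integrable_exp_neg_mul_sq (by norm_num)).const_mul _)
    (Filter.Eventually.of_forall fun g => by positivity), integral_const_mul, integral_gaussian]
  congr 1
  rw [← Real.sqrt_inv, ← Real.sqrt_mul (by positivity)]
  congr 1
  field_simp
  norm_num

/-- Square-exponential moments of a sub-Gaussian variable. -/
theorem integral_exp_sq_le {Ω : Type*} [MeasurableSpace Ω] {P : Measure Ω} [IsProbabilityMeasure P]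
    {x : Ω → ℝ} (hx : Measurable x) {b B : ℝ} (hb : 0 < b) (hB : ∀ ω, |x ω| ≤ B)
    (h : ∀ t, ∫ ω, Real.exp (t * x ω) ∂P ≤ Real.exp (t ^ 2 * b ^ 2)) :
    ∫ ω, Real.exp (x ω ^ 2 / (8 * b ^ 2)) ∂P ≤ 2 := by
  -- Linearisation of the square by an auxiliary standard Gaussian: exp(y²/(8b²)) is the mean of
  -- exp(gy/(2b)).
  have hgauss : ∀ y : ℝ, ENNReal.ofReal (Real.exp (y ^ 2 / (8 * b ^ 2))) =
      ∫⁻ g, ENNReal.ofReal (Real.exp (y / (2 * b) * g)) ∂(gaussianReal 0 1) := by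
    intro y
    rw [← ofReal_integral_eq_lintegral_ofReal (integrable_exp_mul_gaussianReal _)
      (Filter.Eventually.of_forall fun g => (Real.exp_pos _).le)]
    have := mgf_gaussianReal (p := gaussianReal 0 1) (X := id) (μ := 0) (v := 1)
      (by simp) (y / (2 * b))
    simp only [mgf, id] at this
    rw [this]
    congr 2
    simp; field_simp; norm_num
  have hbd : ∀ t : ℝ, Integrable (fun ω => Real.exp (t * x ω)) P := fun t => by
    refine Integrable.of_bound (by fun_prop) (Real.exp (|t| * B))
      (Filter.Eventually.of_forall fun ω => ?_)
    rw [Real.norm_eq_abs, Real.abs_exp, Real.exp_le_exp]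
    refine (le_abs_self _).trans ?_
    rw [abs_mul]
    exact mul_le_mul_of_nonneg_left (hB ω) (abs_nonneg t)
  -- After swapping the integrals, the hypothesis at t = g/(2b) leaves the mean of exp(g²/4), which
  -- is √2.
  have hl : ∫⁻ ω, ENNReal.ofReal (Real.exp (x ω ^ 2 / (8 * b ^ 2))) ∂P ≤
      ENNReal.ofReal (Real.sqrt 2) := by
    simp only [hgauss]
    rw [lintegral_lintegral_swap (by
      refine Measurable.aemeasurable ?_
      have : Measurable fun p : Ω × ℝ => ENNReal.ofReal (Real.exp (x p.1 / (2 * b) * p.2)) := by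
        fun_prop
      exact this), ← lintegral_exp_sq_gaussian]
    refine lintegral_mono fun g => ?_
    have e : ∀ ω, x ω / (2 * b) * g = g / (2 * b) * x ω := fun ω => by ring
    simp only [e]
    rw [← ofReal_integral_eq_lintegral_ofReal (hbd _)
      (Filter.Eventually.of_forall fun g => (Real.exp_pos _).le)]
    refine ENNReal.ofReal_le_ofReal ((h _).trans (le_of_eq ?_))
    congr 1
    field_simp
    norm_num
  have h2 : Real.sqrt 2 ≤ 2 := Real.sqrt_le_iff.2 ⟨by norm_num, by norm_num⟩
  rw [integral_eq_lintegral_of_nonneg_ae (Filter.Eventually.of_forall fun g => (Real.exp_pos _).le)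
    (by fun_prop)]
  refine ENNReal.toReal_le_of_le_ofReal (by norm_num) (hl.trans (ENNReal.ofReal_le_ofReal h2))

theorem Real.exp_le_one_add_add_sq_mul (x : ℝ) :
    Real.exp x ≤ 1 + x + x ^ 2 * Real.exp |x| := by
  have h := Complex.norm_exp_sub_sum_le_norm_mul_exp (x : ℂ) 2
  have e : Complex.exp x - ∑ m ∈ Finset.range 2, (x : ℂ) ^ m / (m.factorial : ℂ) =
      ((Real.exp x - 1 - x : ℝ) : ℂ) := by
    simp [Finset.sum_range_succ]; ring
  rw [e, Complex.norm_real, Complex.norm_real, Real.norm_eq_abs, Real.norm_eq_abs, sq_abs] at h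
  linarith [le_abs_self (Real.exp x - 1 - x)]

/-- Chernoff's bound for i.i.d. samples. -/
theorem measure_pi_sum_ge_le {Ω : Type*} [MeasurableSpace Ω] {D : Measure Ω}
    [IsProbabilityMeasure D] {f : Ω → ℝ} (hf : Measurable f) {B c : ℝ} (hB : ∀ ω, f ω ≤ B)
    (h : ∫ ω, Real.exp (f ω) ∂D ≤ Real.exp c) (n : ℕ) (a : ℝ) :
    Measure.pi (fun _ : Fin n => D) {X | a ≤ ∑ i, f (X i)} ≤ ENNReal.ofReal (Real.exp (n * c - a)) := by
  set Q := Measure.pi (fun _ : Fin n => D)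
  have hprod : ∫ X, Real.exp (∑ i, f (X i)) ∂Q ≤ Real.exp (n * c) := by
    simp only [Real.exp_sum]
    rw [integral_fintype_prod_eq_prod (fun (_ : Fin n) ω => Real.exp (f ω)), Finset.prod_const,
      Finset.card_univ, Fintype.card_fin, Real.exp_nat_mul]
    exact pow_le_pow_left₀ (integral_nonneg fun ω => (Real.exp_pos _).le) h n
  have hmeas : Measurable fun X : Fin n → Ω => Real.exp (∑ i, f (X i)) :=
    Real.measurable_exp.comp (Finset.measurable_sum _ fun i _ => hf.comp (measurable_pi_apply i))
  have hInt : Integrable (fun X : Fin n → Ω => Real.exp (∑ i, f (X i))) Q := by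
    refine Integrable.of_bound hmeas.aestronglyMeasurable (Real.exp (n * B))
      (Filter.Eventually.of_forall fun X => ?_)
    rw [Real.norm_eq_abs, Real.abs_exp, Real.exp_le_exp]
    calc ∑ i, f (X i) ≤ ∑ _i : Fin n, B := Finset.sum_le_sum fun i _ => hB _
      _ = n * B := by simp
  have hmarkov := mul_meas_ge_le_integral_of_nonneg (μ := Q)
    (Filter.Eventually.of_forall fun X => (Real.exp_pos _).le) hInt (Real.exp a)
  have hset : {X : Fin n → Ω | Real.exp a ≤ Real.exp (∑ i, f (X i))} =
      {X | a ≤ ∑ i, f (X i)} := by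
    ext X; simp
  rw [hset] at hmarkov
  rw [← ofReal_measureReal]
  refine ENNReal.ofReal_le_ofReal ?_
  rw [Real.exp_sub, le_div_iff₀ (Real.exp_pos a), mul_comm]
  exact hmarkov.trans hprod

/-! ### A finite net for quadratic forms -/

section Net

variable {κ : Type*} [Fintype κ]

theorem dotp_add_left (v w x : κ → ℝ) : dotp (v + w) x = dotp v x + dotp w x := by
  simp [dotp, add_mul, Finset.sum_add_distrib]

theorem dotp_smul_left (t : ℝ) (v x : κ → ℝ) : dotp (t • v) x = t * dotp v x := by
  simp [dotp, Finset.mul_sum, mul_assoc]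

theorem dotp_sub_left (v w x : κ → ℝ) : dotp (v - w) x = dotp v x - dotp w x := by
  simp [dotp, sub_mul, Finset.sum_sub_distrib]

theorem sqNorm_smul (t : ℝ) (v : κ → ℝ) : sqNorm (t • v) = t ^ 2 * sqNorm v := by
  simp [sqNorm, Finset.mul_sum, mul_pow]

theorem sqNorm_add_add_sqNorm_sub (v w : κ → ℝ) :
    sqNorm (v + w) + sqNorm (v - w) = 2 * sqNorm v + 2 * sqNorm w := by
  simp only [sqNorm, Finset.mul_sum, ← Finset.sum_add_distrib, Pi.add_apply, Pi.sub_apply]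
  exact Finset.sum_congr rfl fun j _ => by ring

theorem dotp_le_l2_mul (v x : κ → ℝ) : dotp v x ≤ l2 v * l2 x := by
  refine (le_abs_self _).trans (abs_le_of_sq_le_sq ?_ (mul_nonneg (l2_nonneg _) (l2_nonneg _)))
  rw [mul_pow, l2_sq, l2_sq]
  exact dotp_sq_le v x

/-- Bounded functions that satisfy the identities of a quadratic form. -/
structure IsQuad (Q : (κ → ℝ) → ℝ) : Prop where
  smul : ∀ (t : ℝ) v, Q (t • v) = t ^ 2 * Q v
  polar : ∀ (t : ℝ) v w, 2 * t * (Q (v + w) - Q v - Q w) = Q (v + t • w) - Q (v - t • w)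
  bdd : ∃ c, 0 ≤ c ∧ ∀ v, |Q v| ≤ c * sqNorm v

theorem isQuad_dotp_sq (x : κ → ℝ) : IsQuad fun v => dotp v x ^ 2 where
  smul t v := by rw [dotp_smul_left]; ring
  polar t v w := by
    rw [dotp_add_left, dotp_add_left, dotp_sub_left, dotp_smul_left]; ring
  bdd := ⟨sqNorm x, sqNorm_nonneg x, fun v => by
    rw [abs_of_nonneg (sq_nonneg _), mul_comm]; exact dotp_sq_le v x⟩

theorem isQuad_coord_sq (j : κ) : IsQuad fun v : κ → ℝ => v j ^ 2 where
  smul t v := by simp [mul_pow]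
  polar t v w := by simp; ring
  bdd := ⟨1, zero_le_one, fun v => by
    rw [abs_of_nonneg (sq_nonneg _), one_mul]
    exact Finset.single_le_sum (f := fun j => v j ^ 2) (fun _ _ => sq_nonneg _)
      (Finset.mem_univ j)⟩

theorem IsQuad.const_mul {Q : (κ → ℝ) → ℝ} (h : IsQuad Q) (a : ℝ) : IsQuad fun v => a * Q v where
  smul t v := by rw [h.smul]; ring
  polar t v w := by have := h.polar t v w; linear_combination a * this
  bdd := by
    obtain ⟨c, hc, hb⟩ := h.bdd
    refine ⟨|a| * c, by positivity, fun v => ?_⟩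
    rw [abs_mul, mul_assoc]
    exact mul_le_mul_of_nonneg_left (hb v) (abs_nonneg a)

theorem IsQuad.sub {Q Q' : (κ → ℝ) → ℝ} (h : IsQuad Q) (h' : IsQuad Q') :
    IsQuad fun v => Q v - Q' v where
  smul t v := by rw [h.smul, h'.smul]; ring
  polar t v w := by linear_combination h.polar t v w - h'.polar t v w
  bdd := by
    obtain ⟨c, hc, hb⟩ := h.bdd
    obtain ⟨c', hc', hb'⟩ := h'.bdd
    refine ⟨c + c', by positivity, fun v => (abs_sub _ _).trans ?_⟩
    linarith [hb v, hb' v]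

theorem IsQuad.sum {ι : Type*} {s : Finset ι} {Q : ι → (κ → ℝ) → ℝ} (h : ∀ i, IsQuad (Q i)) :
    IsQuad fun v => ∑ i ∈ s, Q i v where
  smul t v := by simp only [(h _).smul, Finset.mul_sum]
  polar t v w := by
    simp only [← Finset.sum_sub_distrib, Finset.mul_sum, (h _).polar]
  bdd := by
    choose c hc hb using fun i => (h i).bdd
    refine ⟨∑ i ∈ s, c i, Finset.sum_nonneg fun i _ => hc i, fun v => ?_⟩
    rw [Finset.sum_mul]
    exact (Finset.abs_sum_le_sum_abs _ _).trans (Finset.sum_le_sum fun i _ => hb i v)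

theorem isQuad_offDiag (x : κ → ℝ) : IsQuad fun v => offDiag v x := by
  have h := (isQuad_dotp_sq x).sub (IsQuad.sum (s := Finset.univ)
    fun j : κ => (isQuad_coord_sq j).const_mul (x j ^ 2))
  convert h using 2
  rw [offDiag]
  congr 1
  exact Finset.sum_congr rfl fun j _ => by ring

/-- A quadratic form is determined up to a factor by its values on a net. -/
theorem IsQuad.le_of_net {Q : (κ → ℝ) → ℝ} (h : IsQuad Q) {T : Set (κ → ℝ)} {E : ℝ} (hE : 0 ≤ E)
    (hT : ∀ v, sqNorm v ≤ 1 → ∃ y ∈ T, sqNorm (v - y) ≤ 1 / 64)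
    (hQ : ∀ y ∈ T, |Q y| ≤ E) (v : κ → ℝ) : |Q v| ≤ 2 * E * sqNorm v := by
  -- Any bound c improves to E + c/2. Starting from some finite bound, iteration converges to 2E.
  have himp : ∀ c, 0 ≤ c → (∀ v, |Q v| ≤ c * sqNorm v) → ∀ v, |Q v| ≤ (E + c / 2) * sqNorm v := by
    intro c hc hb
    have hunit : ∀ v, sqNorm v = 1 → |Q v| ≤ E + c / 2 := by
      intro v hv
      obtain ⟨y, hy, hvy⟩ := hT v hv.le
      set x := v - y with hx
      have hy2 : sqNorm y ≤ 81 / 64 := by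
        have h1 : l2 v = 1 := by rw [l2, hv, Real.sqrt_one]
        have h2 : l2 x ≤ 1 / 8 := by
          rw [l2]; refine Real.sqrt_le_iff.2 ⟨by norm_num, by linarith⟩
        have h3 : l2 y ≤ l2 v + l2 ((-1 : ℝ) • x) := by
          have := l2_add_le v ((-1 : ℝ) • x)
          rwa [show v + (-1 : ℝ) • x = y by rw [hx]; simp] at this
        have h4 : l2 ((-1 : ℝ) • x) = l2 x := by rw [l2, sqNorm_smul]; simp [l2]
        rw [← l2_sq]
        have := l2_nonneg y
        nlinarith
      have hvx : v = y + x := by rw [hx]; abel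
      -- The factor 8 balances ‖y‖ ≤ 9/8 against ‖x‖ ≤ 1/8 in the cross term. The total loss stays
      -- below c/2.
      have hp := h.polar 8 y x
      have hs := sqNorm_add_add_sqNorm_sub y ((8 : ℝ) • x)
      rw [sqNorm_smul] at hs
      have b1 := abs_le.1 (hb (y + (8 : ℝ) • x))
      have b2 := abs_le.1 (hb (y - (8 : ℝ) • x))
      have b3 := abs_le.1 (hb x)
      have b4 := abs_le.1 (hQ y hy)
      have hx0 := sqNorm_nonneg x
      have hcx : c * sqNorm x ≤ c * (1 / 64) := mul_le_mul_of_nonneg_left hvy hc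
      have hcy : c * sqNorm y ≤ c * (81 / 64) := mul_le_mul_of_nonneg_left hy2 hc
      have hcs : c * sqNorm (y + (8 : ℝ) • x) + c * sqNorm (y - (8 : ℝ) • x) =
          2 * (c * sqNorm y) + 128 * (c * sqNorm x) := by rw [← mul_add, hs]; ring
      rw [hvx, abs_le]
      constructor <;> linarith [b1.1, b1.2, b2.1, b2.2, b3.1, b3.2, b4.1, b4.2]
    intro v
    rcases (sqNorm_nonneg v).eq_or_lt with h0 | hpos
    · have := hb v
      rw [← h0] at this ⊢
      simpa using this
    · have hl : 0 < l2 v := Real.sqrt_pos.2 hpos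
      have h1 := hunit ((l2 v)⁻¹ • v) (by
        rw [sqNorm_smul, ← l2_sq]; field_simp)
      rw [h.smul, abs_mul, abs_of_nonneg (sq_nonneg _), inv_pow, l2_sq, inv_mul_le_iff₀ hpos] at h1
      linarith
  obtain ⟨c, hc, hb⟩ := h.bdd
  have hiter : ∀ m : ℕ, ∀ v, |Q v| ≤ (2 * E + c * (1 / 2) ^ m) * sqNorm v := by
    intro m
    induction m with
    | zero =>
      intro v
      have := mul_nonneg hE (sqNorm_nonneg v)
      have := hb v
      simp only [pow_zero, mul_one]
      nlinarith
    | succ m ih =>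
      intro v
      refine (himp _ (by positivity) ih v).trans (le_of_eq ?_)
      rw [pow_succ]; ring
  have hlim : Filter.Tendsto (fun m : ℕ => (2 * E + c * (1 / 2 : ℝ) ^ m) * sqNorm v) Filter.atTop
      (nhds ((2 * E + c * 0) * sqNorm v)) :=
    (tendsto_const_nhds.add (tendsto_const_nhds.mul
      (tendsto_pow_atTop_nhds_zero_of_lt_one (by norm_num) (by norm_num)))).mul_const _
  have := ge_of_tendsto' hlim fun m => hiter m v
  simpa using this

/-- A net point within 1/8 of the unit vector along m sees all but an eighth of ‖m‖. -/
theorem l2_le_of_net {m : κ → ℝ} {T : Set (κ → ℝ)} {M : ℝ} (hM : 0 ≤ M)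
    (hT : ∀ v, sqNorm v ≤ 1 → ∃ y ∈ T, sqNorm (v - y) ≤ 1 / 64)
    (hm : ∀ y ∈ T, dotp y m ≤ M) : l2 m ≤ 8 / 7 * M := by
  rcases (l2_nonneg m).eq_or_lt with h0 | hpos
  · rw [← h0]; positivity
  · have hsq : sqNorm m ≠ 0 := by rw [← l2_sq]; positivity
    have h1 : sqNorm ((l2 m)⁻¹ • m) = 1 := by
      rw [sqNorm_smul, inv_pow, l2_sq, inv_mul_cancel₀ hsq]
    obtain ⟨y, hy, hvy⟩ := hT _ h1.le
    have h2 := dotp_le_l2_mul ((l2 m)⁻¹ • m - y) m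
    have h3 : l2 ((l2 m)⁻¹ • m - y) ≤ 1 / 8 := by
      rw [l2]; exact Real.sqrt_le_iff.2 ⟨by norm_num, by linarith⟩
    have h4 : dotp m m = l2 m ^ 2 := by rw [l2_sq]; simp [dotp, sqNorm, sq]
    rw [dotp_sub_left, dotp_smul_left, h4, sq, inv_mul_cancel_left₀ hpos.ne'] at h2
    have := mul_le_mul_of_nonneg_right h3 hpos.le
    linarith [hm y hy]

end Net

/-- The point of the grid of width `1 / (8 d)` with the given integer coordinates. -/
noncomputable def gridPoint {d : ℕ} (k : Fin d → ℤ) : Fin d → ℝ := fun j => k j / (8 * d)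

/-- The grid points in a neighbourhood of the unit ball. -/
noncomputable def gridNet (d : ℕ) : Finset (Fin d → ℤ) :=
  (Fintype.piFinset fun _ => Finset.Icc (-(8 * d : ℤ)) (8 * d)).filter
    fun k => sqNorm (gridPoint k) ≤ 2

/-- Rounding down costs at most 1/(8d) per coordinate, so the squared distance is at most d/(64d²).
The rounded point stays in the ball of squared radius 2. -/
theorem exists_gridPoint {d : ℕ} (hd : 1 ≤ d) (v : Fin d → ℝ) (hv : sqNorm v ≤ 1) :
    ∃ k ∈ gridNet d, sqNorm (v - gridPoint k) ≤ 1 / 64 := by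
  have hd' : (1 : ℝ) ≤ d := by exact_mod_cast hd
  have h8 : (0 : ℝ) < 8 * d := by positivity
  set k : Fin d → ℤ := fun j => ⌊v j * (8 * d)⌋ with hk
  have hdiff : ∀ j, 0 ≤ v j - gridPoint k j ∧ v j - gridPoint k j ≤ 1 / (8 * d) := by
    intro j
    simp only [gridPoint, hk]
    have h1 := Int.floor_le (v j * (8 * d))
    have h2 := Int.lt_floor_add_one (v j * (8 * d))
    constructor
    · rw [sub_nonneg, div_le_iff₀ h8]; exact h1
    · rw [sub_le_iff_le_add, ← add_div, le_div_iff₀ h8]; linarith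
  have hclose : sqNorm (v - gridPoint k) ≤ 1 / 64 := by
    have h1 : sqNorm (v - gridPoint k) ≤ ∑ _j : Fin d, (1 / (8 * (d : ℝ))) ^ 2 :=
      Finset.sum_le_sum fun j _ => pow_le_pow_left₀ (hdiff j).1 (hdiff j).2 2
    refine h1.trans ?_
    rw [Finset.sum_const, Finset.card_univ, Fintype.card_fin, nsmul_eq_mul, div_pow, one_pow,
      mul_one_div, div_le_div_iff₀ (by positivity) (by norm_num)]
    nlinarith
  refine ⟨k, ?_, hclose⟩
  have hvj : ∀ j, |v j| ≤ 1 := fun j => by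
    refine abs_le_of_sq_le_sq (le_trans ?_ (hv.trans_eq (one_pow 2).symm)) zero_le_one
    exact Finset.single_le_sum (f := fun j => v j ^ 2) (fun _ _ => sq_nonneg _)
      (Finset.mem_univ j)
  rw [gridNet, Finset.mem_filter, Fintype.mem_piFinset]
  refine ⟨fun j => ?_, ?_⟩
  · rw [Finset.mem_Icc]
    have h1 := abs_le.1 (hvj j)
    constructor
    · refine Int.le_floor.2 ?_
      push_cast
      nlinarith
    · refine Int.floor_le_iff.2 ?_
      push_cast
      nlinarith
  · have h1 := sqNorm_add_add_sqNorm_sub (gridPoint k) v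
    have h2 : sqNorm (gridPoint k) ≤ 2 * sqNorm v * (1 / 2 + 17 / 64) + 1 / 4 := by
      have h3 : l2 (gridPoint k) ≤ l2 v + l2 ((-1 : ℝ) • (v - gridPoint k)) := by
        have := l2_add_le v ((-1 : ℝ) • (v - gridPoint k))
        rwa [show v + (-1 : ℝ) • (v - gridPoint k) = gridPoint k by simp] at this
      have h4 : l2 ((-1 : ℝ) • (v - gridPoint k)) ≤ 1 / 8 := by
        rw [l2, sqNorm_smul]
        exact Real.sqrt_le_iff.2 ⟨by norm_num, by linarith⟩
      rw [← l2_sq, ← l2_sq]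
      have h5 := l2_nonneg (gridPoint k)
      have h6 := l2_nonneg v
      nlinarith [sq_nonneg (l2 v - 1 / 4)]
    linarith

/-- Each coordinate has 16d + 1 ≤ 17d values. The logarithm of this cardinality is the source of the
term d log d in the sample size. -/
theorem card_gridNet_le {d : ℕ} (hd : 1 ≤ d) : (gridNet d).card ≤ (17 * d) ^ d := by
  refine (Finset.card_filter_le _ _).trans ?_
  rw [Fintype.card_piFinset]
  simp only [Int.card_Icc, Finset.prod_const, Finset.card_univ, Fintype.card_fin]
  refine Nat.pow_le_pow_left ?_ d
  omega

/-! ### Exponential moments of truncated semi-product vectors -/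

section Moments

variable {d : ℕ} {α ρ : ℝ} {P : Measure (EuclideanSpace ℝ (Fin d))} [IsProbabilityMeasure P]

theorem IsSemiProduct.integral_exp_dotp_sq_le (hP : IsSemiProduct α ρ P) {b : ℝ} (hb : 0 < b)
    {v : Fin d → ℝ} (hv : sqNorm v ≤ 2) :
    ∫ η, Real.exp (dotp v (clipVec b η) ^ 2 / (8 * b ^ 2)) ∂P ≤ 2 :=
  integral_exp_sq_le (measurable_dotp_clipVec b v) hb (abs_dotp_clipVec_le hb.le v)
    (hP.mgf_dotp_le hb.le hv)

theorem integrable_exp_dotp_sq {b : ℝ} (hb : 0 < b) (v : Fin d → ℝ) :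
    Integrable (fun η => Real.exp (dotp v (clipVec b η) ^ 2 / (8 * b ^ 2))) P := by
  refine Integrable.of_bound (Real.measurable_exp.comp
    (((measurable_dotp_clipVec b v).pow_const 2).div_const _)).aestronglyMeasurable
    (Real.exp ((∑ j, |v j| * b) ^ 2 / (8 * b ^ 2))) (Filter.Eventually.of_forall fun η => ?_)
  rw [Real.norm_eq_abs, Real.abs_exp, Real.exp_le_exp, ← sq_abs]
  have := abs_dotp_clipVec_le hb.le v η
  gcongr

/-- The threshold 8b² log(1/ε) turns the excess exponential, where it is not 1, into ε times the
full one, whose mean is at most 2. -/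
theorem IsSemiProduct.integral_exp_excess_le (hP : IsSemiProduct α ρ P) {b ε : ℝ} (hb : 0 < b)
    (hε : 0 < ε) {v : Fin d → ℝ} (hv : sqNorm v ≤ 2) :
    ∫ η, Real.exp (max 0 (dotp v (clipVec b η) ^ 2 - 8 * b ^ 2 * Real.log (1 / ε)) / (8 * b ^ 2)) ∂P
      ≤ Real.exp (2 * ε) := by
  have hb2 : 0 < 8 * b ^ 2 := by positivity
  have hpt : ∀ x : ℝ, Real.exp (max 0 (x - 8 * b ^ 2 * Real.log (1 / ε)) / (8 * b ^ 2)) ≤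
      1 + ε * Real.exp (x / (8 * b ^ 2)) := by
    intro x
    rcases max_choice 0 (x - 8 * b ^ 2 * Real.log (1 / ε)) with h | h
    · rw [h, zero_div, Real.exp_zero]; linarith [mul_pos hε (Real.exp_pos (x / (8 * b ^ 2)))]
    · rw [h, sub_div, mul_div_cancel_left₀ _ hb2.ne', Real.exp_sub,
        Real.exp_log (by positivity)]
      rw [div_div_eq_mul_div, div_one]
      linarith
  have hInt := integrable_exp_dotp_sq (P := P) hb v
  calc _ ≤ ∫ η, (1 + ε * Real.exp (dotp v (clipVec b η) ^ 2 / (8 * b ^ 2))) ∂P :=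
        integral_mono_of_nonneg (Filter.Eventually.of_forall fun η => (Real.exp_pos _).le)
          ((integrable_const _).add (hInt.const_mul ε))
          (Filter.Eventually.of_forall fun η => hpt _)
    _ = 1 + ε * ∫ η, Real.exp (dotp v (clipVec b η) ^ 2 / (8 * b ^ 2)) ∂P := by
        rw [integral_add (integrable_const _) (hInt.const_mul ε), integral_const_mul]; simp
    _ ≤ 1 + ε * 2 := by
        have := hP.integral_exp_dotp_sq_le hb hv
        gcongr
    _ ≤ _ := by linarith [Real.add_one_le_exp (2 * ε)]

/-- Expand the exponential to second order. The linear term has mean zero, and the remainder is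
O(ε²) times a square-exponential moment. -/
theorem IsSemiProduct.integral_exp_offDiag_le (hP : IsSemiProduct α ρ P) {b ε s : ℝ} (hb : 0 < b)
    (hε : 0 < ε) (hε' : 16 * ε ≤ 1) (hs : s ^ 2 = 1) {v : Fin d → ℝ} (hv : sqNorm v ≤ 2) :
    ∫ η, Real.exp (s * ε / b ^ 2 * offDiag v (clipVec b η)) ∂P ≤ Real.exp (1400 * ε ^ 2) := by
  have hb2 : 0 < b ^ 2 := by positivity
  have hsa : |s| = 1 := by
    have : |s| ^ 2 = 1 := by rw [sq_abs, hs]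
    exact (pow_eq_one_iff_of_nonneg (abs_nonneg s) two_ne_zero).1 this
  have hq : Real.exp (1 / 4) ≤ 1.3 := by
    have h1 : Real.exp (1 / 4) ^ 4 = Real.exp 1 := by
      rw [← Real.exp_nat_mul]; norm_num
    have h2 := Real.exp_one_lt_d9
    by_contra hcon
    push Not at hcon
    have h3 : (1.3 : ℝ) ^ 4 < Real.exp (1 / 4) ^ 4 := pow_lt_pow_left₀ hcon (by norm_num) (by norm_num)
    rw [h1] at h3
    norm_num at h3 h2
    linarith
  have hpt : ∀ η : EuclideanSpace ℝ (Fin d),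
      Real.exp (s * ε / b ^ 2 * offDiag v (clipVec b η)) ≤
      1 + s * ε / b ^ 2 * offDiag v (clipVec b η) +
        666 * ε ^ 2 * Real.exp (dotp v (clipVec b η) ^ 2 / (8 * b ^ 2)) := by
    intro η
    set W := offDiag v (clipVec b η)
    -- The exponent has absolute value 16εz ≤ z. One factor exp z absorbs z² and another the
    -- remainder's exponential. Together they cost exp(2z), and 2z is at most 1/4 more than the
    -- exponent with known moment. The constants are 256 · 2 · 1.3 < 666 and 666 · 2 < 1400.
    set z := |W| / (16 * b ^ 2) with hz
    have hz0 : 0 ≤ z := by positivity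
    have hW : |W| ≤ dotp v (clipVec b η) ^ 2 + b ^ 2 * 2 :=
      (abs_offDiag_le (x := clipVec b η) fun j => abs_clip_le hb.le _).trans (by gcongr)
    have hx : |s * ε / b ^ 2 * W| = 16 * ε * z := by
      rw [abs_mul, abs_div, abs_mul, hsa, abs_of_pos hε, abs_of_pos hb2, hz]
      field_simp
    have h1 := Real.exp_le_one_add_add_sq_mul (s * ε / b ^ 2 * W)
    have h2 : (s * ε / b ^ 2 * W) ^ 2 * Real.exp |s * ε / b ^ 2 * W| ≤
        666 * ε ^ 2 * Real.exp (dotp v (clipVec b η) ^ 2 / (8 * b ^ 2)) := by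
      rw [← sq_abs, hx]
      have e1 : Real.exp (16 * ε * z) ≤ Real.exp z :=
        Real.exp_le_exp.2 (by nlinarith)
      have e2 : z ^ 2 ≤ 2 * Real.exp z := by
        have := Real.quadratic_le_exp_of_nonneg hz0
        linarith
      have e3 : Real.exp z * Real.exp z ≤
          1.3 * Real.exp (dotp v (clipVec b η) ^ 2 / (8 * b ^ 2)) := by
        rw [← Real.exp_add]
        have : z + z ≤ 1 / 4 + dotp v (clipVec b η) ^ 2 / (8 * b ^ 2) := by
          rw [hz, ← add_div, div_add_div _ _ (by norm_num) (by positivity),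
            div_le_div_iff₀ (by positivity) (by positivity)]
          nlinarith
        calc _ ≤ Real.exp (1 / 4 + dotp v (clipVec b η) ^ 2 / (8 * b ^ 2)) := Real.exp_le_exp.2 this
          _ = Real.exp (1 / 4) * Real.exp (dotp v (clipVec b η) ^ 2 / (8 * b ^ 2)) := Real.exp_add _ _
          _ ≤ _ := by gcongr
      calc (16 * ε * z) ^ 2 * Real.exp (16 * ε * z) = 256 * ε ^ 2 * (z ^ 2 * Real.exp (16 * ε * z)) := by
            ring
        _ ≤ 256 * ε ^ 2 * (2 * Real.exp z * Real.exp z) := by gcongr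
        _ = 512 * ε ^ 2 * (Real.exp z * Real.exp z) := by ring
        _ ≤ 512 * ε ^ 2 * (1.3 * Real.exp (dotp v (clipVec b η) ^ 2 / (8 * b ^ 2))) := by gcongr
        _ ≤ _ := by
          have : 0 ≤ ε ^ 2 * Real.exp (dotp v (clipVec b η) ^ 2 / (8 * b ^ 2)) := by positivity
          nlinarith
    linarith
  have hInt := integrable_exp_dotp_sq (P := P) hb v
  have hIntW : Integrable (fun η => s * ε / b ^ 2 * offDiag v (clipVec b η)) P := by
    refine Integrable.const_mul (Integrable.of_bound
      (measurable_offDiag_clipVec b v).aestronglyMeasurable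
      ((∑ j, |v j| * b) ^ 2 + b ^ 2 * sqNorm v) (Filter.Eventually.of_forall fun η => ?_)) _
    rw [Real.norm_eq_abs]
    refine (abs_offDiag_le (x := clipVec b η) fun j => abs_clip_le hb.le _).trans ?_
    rw [← sq_abs]
    have := abs_dotp_clipVec_le hb.le v η
    gcongr
  calc _ ≤ ∫ η, (1 + s * ε / b ^ 2 * offDiag v (clipVec b η) +
          666 * ε ^ 2 * Real.exp (dotp v (clipVec b η) ^ 2 / (8 * b ^ 2))) ∂P :=
        integral_mono_of_nonneg (Filter.Eventually.of_forall fun η => (Real.exp_pos _).le)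
          (((integrable_const _).add hIntW).add (hInt.const_mul _))
          (Filter.Eventually.of_forall fun η => hpt η)
    _ = 1 + ∫ η, s * ε / b ^ 2 * offDiag v (clipVec b η) ∂P +
          666 * ε ^ 2 * ∫ η, Real.exp (dotp v (clipVec b η) ^ 2 / (8 * b ^ 2)) ∂P := by
        have hInt1 : Integrable (fun η => 1 + s * ε / b ^ 2 * offDiag v (clipVec b η)) P :=
          (integrable_const _).add hIntW
        rw [integral_add hInt1 (hInt.const_mul _),
          integral_add (integrable_const _) hIntW, integral_const_mul (666 * ε ^ 2)]; simp
    _ ≤ 1 + 0 + 666 * ε ^ 2 * 2 := by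
        have := hP.integral_exp_dotp_sq_le hb hv
        have := hP.integral_offDiag_le hb.le v (s * ε / b ^ 2)
        gcongr
    _ ≤ _ := by nlinarith [Real.add_one_le_exp (1400 * ε ^ 2), sq_nonneg ε]

/-- By symmetry the two tails have equal mass, and together at most 1 - α. -/
theorem IsSemiProduct.measureReal_gt_le (hP : IsSemiProduct α ρ P) (hρ : 0 < ρ) (j : Fin d) :
    P.real {η | ρ < η j} ≤ 1 / 2 - α / 2 ∧ P.real {η | η j < -ρ} ≤ 1 / 2 - α / 2 := by
  have hsym : P.real {η | ρ < η j} = P.real {η | η j < -ρ} := by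
    have h1 : (P.map fun η => η j) (Set.Ioi ρ) = P {η | ρ < η j} :=
      Measure.map_apply (by fun_prop) measurableSet_Ioi
    have h2 : (P.map fun η => -η j) (Set.Ioi ρ) = P {η | η j < -ρ} := by
      rw [Measure.map_apply (by fun_prop) measurableSet_Ioi]
      congr 1; ext η; simp [lt_neg]
    rw [measureReal_def, measureReal_def, ← h1, ← h2, hP.symm j]
  have hm1 : MeasurableSet {η : EuclideanSpace ℝ (Fin d) | ρ < η j} :=
    measurableSet_lt measurable_const (by fun_prop)
  have hm2 : MeasurableSet {η : EuclideanSpace ℝ (Fin d) | η j < -ρ} :=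
    measurableSet_lt (by fun_prop) measurable_const
  have hm3 : MeasurableSet {η : EuclideanSpace ℝ (Fin d) | |η j| ≤ ρ} :=
    measurableSet_le (by fun_prop) measurable_const
  have hu1 : P.real ({η | ρ < η j} ∪ {η | η j < -ρ}) =
      P.real {η | ρ < η j} + P.real {η | η j < -ρ} :=
    measureReal_union (Set.disjoint_left.2 fun η h1 h2 => by
      simp only [Set.mem_ofPred_eq] at h1 h2; linarith) hm2
  have hc : ({η : EuclideanSpace ℝ (Fin d) | ρ < η j} ∪ {η | η j < -ρ}) = {η | |η j| ≤ ρ}ᶜ := by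
    ext η
    simp only [Set.mem_union, Set.mem_ofPred_eq, Set.mem_compl_iff, abs_le, not_and_or, not_le]
    exact or_comm
  rw [hc, probReal_compl_eq_one_sub hm3] at hu1
  have := hP.mass j
  constructor <;> linarith

theorem integral_exp_indicator_le {Ω : Type*} [MeasurableSpace Ω] {P : Measure Ω}
    [IsProbabilityMeasure P] {S : Set Ω} (hS : MeasurableSet S) {p t : ℝ} (hp : P.real S ≤ p)
    (hp1 : p ≤ 1) (ht0 : 0 ≤ t) (ht1 : t ≤ 1) :
    ∫ ω, Real.exp (t * S.indicator 1 ω) ∂P ≤ Real.exp (t * p + t ^ 2) := by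
  have hpt : ∀ ω, Real.exp (t * S.indicator 1 ω) ≤ 1 + (t + t ^ 2) * S.indicator 1 ω := by
    intro ω
    by_cases h : ω ∈ S
    · simp only [Set.indicator_of_mem h, Pi.one_apply, mul_one]
      have := Real.abs_exp_sub_one_sub_id_le (x := t) (by rwa [abs_of_nonneg ht0])
      linarith [(abs_le.1 this).2]
    · simp [Set.indicator_of_notMem h]
  have hInt : Integrable (fun ω => S.indicator (1 : Ω → ℝ) ω) P :=
    (integrable_const (1 : ℝ)).indicator hS
  calc _ ≤ ∫ ω, (1 + (t + t ^ 2) * S.indicator 1 ω) ∂P :=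
        integral_mono_of_nonneg (Filter.Eventually.of_forall fun η => (Real.exp_pos _).le)
          ((integrable_const _).add (hInt.const_mul _)) (Filter.Eventually.of_forall hpt)
    _ = 1 + (t + t ^ 2) * P.real S := by
        rw [integral_add (integrable_const _) (hInt.const_mul _), integral_const_mul,
          integral_indicator_one hS]; simp
    _ ≤ t * p + t ^ 2 + 1 := by
        have h0 : 0 ≤ P.real S := measureReal_nonneg
        nlinarith [sq_nonneg t, mul_le_mul_of_nonneg_left (hp.trans hp1) (sq_nonneg t),
          mul_le_mul_of_nonneg_left hp ht0]
    _ ≤ _ := Real.add_one_le_exp _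

end Moments

/-! ### Good samples -/

/-- The deterministic properties of the clean sample on which the analysis rests. -/
structure GoodSample {n d : ℕ} (X : Fin n → Fin d → ℝ) (μ : Fin d → ℝ) (α ρ ε : ℝ) : Prop where
  regular : Regular (fun i j => clip (3 * ρ) (X i j - μ j)) ε
    (3000 * (3 * ρ) ^ 2 * (ε * Real.log (1 / ε)))
  mean : l2 (fun j => (∑ i, clip (3 * ρ) (X i j - μ j)) / n) ≤
    3 * (3 * ρ) * (ε * Real.sqrt (Real.log (1 / ε)))
  upper : ∀ j, ((Finset.univ.filter fun i => ρ < X i j - μ j).card : ℝ) ≤ (1 / 2 - α / 4) * n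
  lower : ∀ j, ((Finset.univ.filter fun i => X i j - μ j < -ρ).card : ℝ) ≤ (1 / 2 - α / 4) * n

theorem measure_pi_sum_shift_ge_le {n d : ℕ} {D : Measure (EuclideanSpace ℝ (Fin d))}
    [IsProbabilityMeasure D] {μ : EuclideanSpace ℝ (Fin d)} {g : EuclideanSpace ℝ (Fin d) → ℝ}
    (hg : Measurable g) {B c : ℝ} (hB : ∀ η, g η ≤ B)
    (h : ∫ η, Real.exp (g η) ∂(D.map fun y => y - μ) ≤ Real.exp c) {a q : ℝ}
    (hq : n * c - a ≤ q) :
    Measure.pi (fun _ : Fin n => D) {X | a ≤ ∑ i, g (X i - μ)} ≤ ENNReal.ofReal (Real.exp q) := by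
  have hm : Measurable fun y : EuclideanSpace ℝ (Fin d) => y - μ := by fun_prop
  have hge : Measurable fun η => Real.exp (g η) := Real.measurable_exp.comp hg
  rw [integral_map hm.aemeasurable hge.aestronglyMeasurable] at h
  exact (measure_pi_sum_ge_le (hg.comp hm) (fun y => hB _) h n a).trans
    (ENNReal.ofReal_le_ofReal (Real.exp_le_exp.2 hq))

/-- The sum of the tails controls every small fraction of the sample. -/
theorem sum_mul_le_of_sum_max {ι : Type*} [Fintype ι] {a x : ι → ℝ} {T : ℝ}
    (ha0 : ∀ i, 0 ≤ a i) (ha1 : ∀ i, a i ≤ 1) :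
    ∑ i, a i * x i ≤ (∑ i, a i) * T + ∑ i, max 0 (x i - T) := by
  rw [Finset.sum_mul, ← Finset.sum_add_distrib]
  refine Finset.sum_le_sum fun i _ => ?_
  have h1 := le_max_left 0 (x i - T)
  have h2 := le_max_right 0 (x i - T)
  nlinarith [ha0 i, ha1 i]

section Good

variable {n d : ℕ} {α ρ ε Λ δ : ℝ} {μ : EuclideanSpace ℝ (Fin d)}

/-- The values on the net and the counts that certify a good sample. -/
theorem goodSample_of_net (hd : 1 ≤ d) (hn : 0 < n) (hρ : 0 < ρ) (hε : 0 < ε)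
    (hl : 1 ≤ Real.log (1 / ε)) {X : Fin n → EuclideanSpace ℝ (Fin d)}
    (hmean : ∀ k ∈ gridNet d, ∑ i, ε * Real.sqrt (Real.log (1 / ε)) / (3 * ρ) *
      dotp (gridPoint k) (clipVec (3 * ρ) (X i - μ)) < 2 * n * (ε ^ 2 * Real.log (1 / ε)))
    (hoff : ∀ s : ℝ, s ^ 2 = 1 → ∀ k ∈ gridNet d, ∑ i, s * ε / (3 * ρ) ^ 2 *
      offDiag (gridPoint k) (clipVec (3 * ρ) (X i - μ)) < 1500 * n * (ε ^ 2 * Real.log (1 / ε)))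
    (htail : ∀ k ∈ gridNet d, ∑ i, max 0 (dotp (gridPoint k) (clipVec (3 * ρ) (X i - μ)) ^ 2 -
      8 * (3 * ρ) ^ 2 * Real.log (1 / ε)) / (8 * (3 * ρ) ^ 2) < 3 * n * ε)
    (hupper : ∀ j, ((Finset.univ.filter fun i => ρ < X i j - μ j).card : ℝ) ≤ (1 / 2 - α / 4) * n)
    (hlower : ∀ j, ((Finset.univ.filter fun i => X i j - μ j < -ρ).card : ℝ) ≤
      (1 / 2 - α / 4) * n) :
    GoodSample (fun i j => X i j) μ α ρ ε := by
  set b := 3 * ρ with hb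
  set l := Real.log (1 / ε) with hldef
  have hb0 : 0 < b := by positivity
  have hn' : (0 : ℝ) < n := by exact_mod_cast hn
  have hl0 : 0 < l := by linarith
  set φ : Fin n → Fin d → ℝ := fun i => clipVec b (X i - μ) with hφ
  have hφ' : (fun i j => clip b (X i j - μ j)) = φ := rfl
  have hnet : ∀ v : Fin d → ℝ, sqNorm v ≤ 1 →
      ∃ y ∈ gridPoint '' (gridNet d : Set (Fin d → ℤ)), sqNorm (v - y) ≤ 1 / 64 := fun v hv => by
    obtain ⟨k, hk, h⟩ := exists_gridPoint hd v hv
    exact ⟨gridPoint k, ⟨k, hk, rfl⟩, h⟩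
  have hcard : (Fintype.card (Fin n) : ℝ) = n := by simp
  refine ⟨⟨fun v => ?_, fun a ha0 ha1 hasum v => ?_⟩, ?_, hupper, hlower⟩
  -- Passing from the net to all directions doubles 1500 to the constant 3000 of `GoodSample`.
  · have h := IsQuad.le_of_net (E := 1500 * n * b ^ 2 * (ε * l))
      (IsQuad.sum (s := Finset.univ) fun i => isQuad_offDiag (φ i)) (by positivity) hnet ?_ v
    · rw [hcard]
      refine h.trans (le_of_eq ?_)
      ring
    · rintro _ ⟨k, hk, rfl⟩
      have h1 := hoff 1 (by norm_num) k hk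
      have h2 := hoff (-1) (by norm_num) k hk
      rw [← Finset.mul_sum] at h1 h2
      have e : 1500 * n * (ε ^ 2 * l) = ε / b ^ 2 * (1500 * n * b ^ 2 * (ε * l)) := by
        field_simp
      have hpos : 0 < ε / b ^ 2 := by positivity
      rw [e, one_mul] at h1
      rw [e, neg_one_mul, neg_div, neg_mul, ← mul_neg] at h2
      have h1' := lt_of_mul_lt_mul_left h1 hpos.le
      have h2' := lt_of_mul_lt_mul_left h2 hpos.le
      exact abs_le.2 ⟨by linarith, h1'.le⟩
  · rw [hcard] at hasum ⊢
    have h := IsQuad.le_of_net (E := 1500 * n * b ^ 2 * (ε * l))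
      (IsQuad.sum (s := Finset.univ) fun i => (isQuad_dotp_sq (φ i)).const_mul (a i))
      (by positivity) hnet ?_ v
    · refine (le_abs_self _).trans (h.trans (le_of_eq ?_))
      ring
    · rintro _ ⟨k, hk, rfl⟩
      have h1 : ∑ i, max 0 (dotp (gridPoint k) (φ i) ^ 2 - 8 * b ^ 2 * l) / (8 * b ^ 2) <
          3 * n * ε := htail k hk
      rw [← Finset.sum_div, div_lt_iff₀ (by positivity)] at h1
      have h2 := sum_mul_le_of_sum_max (x := fun i => dotp (gridPoint k) (φ i) ^ 2)
        (T := 8 * b ^ 2 * l) ha0 ha1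
      have h3 : (∑ i, a i) * (8 * b ^ 2 * l) ≤ 3 * ε * n * (8 * b ^ 2 * l) := by gcongr
      have h4 : n * b ^ 2 * ε ≤ n * b ^ 2 * ε * l := le_mul_of_one_le_right (by positivity) hl
      have h5 : 0 ≤ n * b ^ 2 * ε * l := by positivity
      rw [abs_of_nonneg (Finset.sum_nonneg fun i _ => mul_nonneg (ha0 i) (sq_nonneg _))]
      linarith
  · have hs : 0 < Real.sqrt l := Real.sqrt_pos.2 hl0
    have hsq : Real.sqrt l ^ 2 = l := Real.sq_sqrt hl0.le
    have h := l2_le_of_net (m := fun j => (∑ i, φ i j) / n) (M := 2 * b * (ε * Real.sqrt l))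
      (by positivity) hnet ?_
    · refine h.trans ?_
      have : 0 ≤ b * (ε * Real.sqrt l) := by positivity
      linarith
    · rintro _ ⟨k, hk, rfl⟩
      have h1 := hmean k hk
      rw [← Finset.mul_sum] at h1
      have e : 2 * n * (ε ^ 2 * l) = ε * Real.sqrt l / b * (n * (2 * b * (ε * Real.sqrt l))) := by
        field_simp
        rw [hsq]
      rw [e] at h1
      have h2 := lt_of_mul_lt_mul_left h1 (by positivity)
      have e2 : dotp (gridPoint k) (fun j => (∑ i, φ i j) / n) =
          (∑ i, dotp (gridPoint k) (φ i)) / n := by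
        simp only [dotp]
        rw [Finset.sum_comm, Finset.sum_div]
        exact Finset.sum_congr rfl fun j _ => by rw [← Finset.mul_sum]; ring
      rw [e2, div_le_iff₀ hn']
      linarith

/-- There are four events per grid direction (the mean, both signs of the off-diagonal sum, the
tail) and two per coordinate. The net size is at most e^(6Λ) and the factor 6 at most e^(3Λ), so
e^(-10Λ) leaves e^(-Λ) ≤ δ. -/
theorem union_count_le (hd : 1 ≤ d) (hδ : 0 < δ) (h1 : Real.log 2 ≤ Λ)
    (h2 : d * Real.log d ≤ Λ) (h3 : Real.log (1 / δ) ≤ Λ) :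
    (4 * ((17 * d) ^ d : ℕ) + 2 * d : ℝ) * Real.exp (-(10 * Λ)) ≤ δ := by
  have hd' : (1 : ℝ) ≤ d := by exact_mod_cast hd
  have hlog2 : 0 < Real.log 2 := Real.log_pos (by norm_num)
  have hdl : d * Real.log 2 ≤ Λ := by
    rcases hd.eq_or_lt with h | h
    · rw [← h]; simpa using h1
    · refine le_trans ?_ h2
      have : Real.log 2 ≤ Real.log d := Real.log_le_log (by norm_num) (by exact_mod_cast h)
      gcongr
  have hnet : (((17 * d) ^ d : ℕ) : ℝ) ≤ Real.exp (6 * Λ) := by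
    push_cast
    have h32 : (17 : ℝ) * d ≤ Real.exp (5 * Real.log 2 + Real.log d) := by
      rw [Real.exp_add, Real.exp_log (by positivity),
        show 5 * Real.log 2 = Real.log (2 ^ 5) by rw [Real.log_pow]; norm_num,
        Real.exp_log (by norm_num)]
      nlinarith
    calc ((17 : ℝ) * d) ^ d ≤ Real.exp (5 * Real.log 2 + Real.log d) ^ d := by gcongr
      _ = Real.exp (d * (5 * Real.log 2 + Real.log d)) := by rw [← Real.exp_nat_mul]
      _ ≤ _ := Real.exp_le_exp.2 (by nlinarith)
  have hdn : (d : ℝ) ≤ ((17 * d) ^ d : ℕ) := by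
    have : d ≤ (17 * d) ^ d := by
      calc d ≤ 17 * d := by omega
        _ = (17 * d) ^ 1 := (pow_one _).symm
        _ ≤ _ := Nat.pow_le_pow_right (by omega) hd
    exact_mod_cast this
  have h6 : (6 : ℝ) ≤ Real.exp (3 * Λ) := by
    have : (8 : ℝ) = Real.exp (3 * Real.log 2) := by
      rw [show 3 * Real.log 2 = Real.log (2 ^ 3) by rw [Real.log_pow]; norm_num,
        Real.exp_log (by norm_num)]; norm_num
    have h := Real.exp_le_exp.2 (show 3 * Real.log 2 ≤ 3 * Λ by linarith)
    linarith
  calc (4 * ((17 * d) ^ d : ℕ) + 2 * d : ℝ) * Real.exp (-(10 * Λ))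
      ≤ (6 * ((17 * d) ^ d : ℕ)) * Real.exp (-(10 * Λ)) := by gcongr; linarith
    _ ≤ (Real.exp (3 * Λ) * Real.exp (6 * Λ)) * Real.exp (-(10 * Λ)) := by gcongr
    _ = Real.exp (-Λ) := by rw [← Real.exp_add, ← Real.exp_add]; congr 1; ring
    _ ≤ Real.exp (-Real.log (1 / δ)) := Real.exp_le_exp.2 (by linarith)
    _ = δ := by rw [one_div, Real.log_inv, neg_neg, Real.exp_log hδ]

theorem sum_indicator_eq_card {Ω : Type*} {S : Set Ω} {n : ℕ} (X : Fin n → Ω)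
    [DecidablePred fun i => X i ∈ S] :
    ∑ i, S.indicator (1 : Ω → ℝ) (X i) = ((Finset.univ.filter fun i => X i ∈ S).card : ℝ) := by
  rw [← Finset.sum_boole]
  exact Finset.sum_congr rfl fun i _ => by
    by_cases h : X i ∈ S <;> simp [h]

/-- Chernoff's bound with parameter α/8: the gap α/4 between mean and threshold gives the exponent
-nα²/64, and 640 = 64 · 10. -/
theorem measure_count_gt_le {D : Measure (EuclideanSpace ℝ (Fin d))} [IsProbabilityMeasure D]
    {S : Set (EuclideanSpace ℝ (Fin d))} [DecidablePred fun η => η ∈ S] (hS : MeasurableSet S)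
    (hα : 0 < α) (hα1 : α ≤ 1)
    (hp : (D.map fun y => y - μ).real S ≤ 1 / 2 - α / 2) (hcount : 640 * Λ ≤ n * α ^ 2) :
    Measure.pi (fun _ : Fin n => D) {X | ¬ ((Finset.univ.filter fun i => X i - μ ∈ S).card : ℝ) ≤
      (1 / 2 - α / 4) * n} ≤ ENNReal.ofReal (Real.exp (-(10 * Λ))) := by
  have hm : Measurable fun y : EuclideanSpace ℝ (Fin d) => y - μ := by fun_prop
  have : IsProbabilityMeasure (D.map fun y => y - μ) := Measure.isProbabilityMeasure_map hm.aemeasurable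
  have h := measure_pi_sum_shift_ge_le (n := n) (D := D) (μ := μ)
    (g := fun η => α / 8 * S.indicator 1 η) (B := α / 8 * 1)
    (measurable_const.mul (measurable_one.indicator hS))
    (fun η => by
      refine mul_le_mul_of_nonneg_left ?_ (by positivity)
      exact Set.indicator_le_self' (fun _ _ => zero_le_one) η)
    (integral_exp_indicator_le hS hp (by linarith) (by positivity) (by linarith))
    (a := α / 8 * ((1 / 2 - α / 4) * n)) (q := -(10 * Λ)) (by nlinarith)
  refine (measure_mono fun X hX => ?_).trans h
  rw [Set.mem_ofPred_eq, not_le] at hX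
  rw [Set.mem_ofPred_eq, ← Finset.mul_sum, sum_indicator_eq_card (fun i => X i - μ)]
  exact mul_le_mul_of_nonneg_left hX.le (by positivity)

/-- Samples from a semi-product distribution are good with high probability. -/
theorem measure_not_goodSample_le {D : Measure (EuclideanSpace ℝ (Fin d))} [IsProbabilityMeasure D]
    (hD : IsSemiProductWithLocation α ρ μ D) (hd : 1 ≤ d) (hn : 0 < n) (hα : 0 < α) (hα1 : α ≤ 1)
    (hρ : 0 < ρ) (hε : 0 < ε) (hε' : 16 * ε ≤ 1) (hδ : 0 < δ) (hl : 1 ≤ Real.log (1 / ε))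
    (hεl : ε * Real.log (1 / ε) ≤ 1)
    (h1 : Real.log 2 ≤ Λ) (h2 : d * Real.log d ≤ Λ) (h3 : Real.log (1 / δ) ≤ Λ)
    (hsize : 10 * Λ ≤ n * (ε ^ 2 * Real.log (1 / ε))) (hcount : 640 * Λ ≤ n * α ^ 2) :
    Measure.pi (fun _ : Fin n => D) {X | ¬ GoodSample (fun i j => X i j) μ α ρ ε} ≤
      ENNReal.ofReal δ := by
  set Q := Measure.pi (fun _ : Fin n => D) with hQ
  set b := 3 * ρ with hb
  set l := Real.log (1 / ε) with hldef
  have hb0 : 0 < b := by positivity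
  have hl0 : 0 < l := by linarith
  have hn' : (0 : ℝ) < n := by exact_mod_cast hn
  have hm : Measurable fun y : EuclideanSpace ℝ (Fin d) => y - μ := by fun_prop
  have : IsProbabilityMeasure (D.map fun y => y - μ) := Measure.isProbabilityMeasure_map hm.aemeasurable
  set p := ENNReal.ofReal (Real.exp (-(10 * Λ))) with hp
  have hS : ∀ k ∈ gridNet d, sqNorm (gridPoint k) ≤ 2 := fun k hk => (Finset.mem_filter.1 hk).2
  set A₁ : (Fin d → ℤ) → Set (Fin n → EuclideanSpace ℝ (Fin d)) := fun k =>
    {X | 2 * n * (ε ^ 2 * l) ≤ ∑ i, ε * Real.sqrt l / b * dotp (gridPoint k) (clipVec b (X i - μ))}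
    with hA₁
  set A₂ : ℝ → (Fin d → ℤ) → Set (Fin n → EuclideanSpace ℝ (Fin d)) := fun s k =>
    {X | 1500 * n * (ε ^ 2 * l) ≤
      ∑ i, s * ε / b ^ 2 * offDiag (gridPoint k) (clipVec b (X i - μ))} with hA₂
  set A₃ : (Fin d → ℤ) → Set (Fin n → EuclideanSpace ℝ (Fin d)) := fun k =>
    {X | 3 * n * ε ≤ ∑ i, max 0 (dotp (gridPoint k) (clipVec b (X i - μ)) ^ 2 -
      8 * b ^ 2 * l) / (8 * b ^ 2)} with hA₃
  set B₁ : Fin d → Set (Fin n → EuclideanSpace ℝ (Fin d)) := fun j =>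
    {X | ¬ ((Finset.univ.filter fun i => ρ < X i j - μ j).card : ℝ) ≤ (1 / 2 - α / 4) * n} with hB₁
  set B₂ : Fin d → Set (Fin n → EuclideanSpace ℝ (Fin d)) := fun j =>
    {X | ¬ ((Finset.univ.filter fun i => X i j - μ j < -ρ).card : ℝ) ≤ (1 / 2 - α / 4) * n} with hB₂
  -- For the grid events the thresholds leave an exponent of at most -nε² log(1/ε), hence at most
  -- -10Λ. Here the two terms are one and two times nε² log(1/ε).
  have m₁ : ∀ k ∈ gridNet d, Q (A₁ k) ≤ p := fun k hk => by
    have hsq : Real.sqrt l ^ 2 = l := Real.sq_sqrt hl0.le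
    refine measure_pi_sum_shift_ge_le (B := |ε * Real.sqrt l / b| * ∑ j, |gridPoint k j| * b)
      ((measurable_dotp_clipVec b _).const_mul _) (fun η => ?_)
      (hD.mgf_dotp_le hb0.le (hS k hk) (ε * Real.sqrt l / b)) ?_
    · refine (le_abs_self _).trans ?_
      rw [abs_mul]
      exact mul_le_mul_of_nonneg_left (abs_dotp_clipVec_le hb0.le _ _) (abs_nonneg _)
    · have e : (ε * Real.sqrt l / b) ^ 2 * b ^ 2 = ε ^ 2 * l := by
        rw [div_pow, mul_pow, hsq]; field_simp
      rw [e]; linarith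
  have m₂ : ∀ s : ℝ, s ^ 2 = 1 → ∀ k ∈ gridNet d, Q (A₂ s k) ≤ p := fun s hs k hk => by
    refine measure_pi_sum_shift_ge_le
      (B := |s * ε / b ^ 2| * ((∑ j, |gridPoint k j| * b) ^ 2 + b ^ 2 * sqNorm (gridPoint k)))
      ((measurable_offDiag_clipVec b _).const_mul _) (fun η => ?_)
      (hD.integral_exp_offDiag_le hb0 hε hε' hs (hS k hk)) ?_
    · refine (le_abs_self _).trans ?_
      rw [abs_mul]
      refine mul_le_mul_of_nonneg_left
        ((abs_offDiag_le (x := clipVec b η) fun j => abs_clip_le hb0.le _).trans ?_) (abs_nonneg _)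
      rw [← sq_abs]
      have := abs_dotp_clipVec_le hb0.le (gridPoint k) η
      gcongr
    · have h4 : n * ε ^ 2 * 1 ≤ n * ε ^ 2 * l := by gcongr
      have h5 : 0 ≤ n * (ε ^ 2 * l) := by positivity
      nlinarith
  -- The exponent is 2nε - 3nε = -nε, which is small enough because ε log(1/ε) ≤ 1.
  have m₃ : ∀ k ∈ gridNet d, Q (A₃ k) ≤ p := fun k hk => by
    refine measure_pi_sum_shift_ge_le
      (g := fun η => max 0 (dotp (gridPoint k) (clipVec b η) ^ 2 - 8 * b ^ 2 * l) / (8 * b ^ 2))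
      (B := max 0 ((∑ j, |gridPoint k j| * b) ^ 2 - 8 * b ^ 2 * l) / (8 * b ^ 2))
      ((measurable_const.max (((measurable_dotp_clipVec b _).pow_const 2).sub_const _)).div_const _)
      (fun η => ?_) (hD.integral_exp_excess_le hb0 hε (hS k hk)) ?_
    · rw [← sq_abs (dotp _ _)]
      have := abs_dotp_clipVec_le hb0.le (gridPoint k) η
      gcongr
    · have h4 : n * ε * (ε * l) ≤ n * ε * 1 := by gcongr
      nlinarith
  have n₁ : ∀ j, Q (B₁ j) ≤ p := fun j => by
    classical
    exact measure_count_gt_le (S := {η | ρ < η j})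
      (measurableSet_lt measurable_const (by fun_prop)) hα hα1
      (hD.measureReal_gt_le hρ j).1 hcount
  have n₂ : ∀ j, Q (B₂ j) ≤ p := fun j => by
    classical
    exact measure_count_gt_le (S := {η | η j < -ρ})
      (measurableSet_lt (by fun_prop) measurable_const) hα hα1
      (hD.measureReal_gt_le hρ j).2 hcount
  have hsub : {X | ¬ GoodSample (fun i j => X i j) μ α ρ ε} ⊆
      (⋃ k ∈ gridNet d, (A₁ k ∪ A₂ 1 k ∪ A₂ (-1) k ∪ A₃ k)) ∪ ⋃ j ∈ Finset.univ, (B₁ j ∪ B₂ j) := by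
    intro X hX
    by_contra hcon
    simp only [Set.mem_union, Set.mem_iUnion, not_or, not_exists] at hcon
    obtain ⟨hk, hj⟩ := hcon
    refine hX (goodSample_of_net hd hn hρ hε hl ?_ ?_ ?_ ?_ ?_)
    · intro k hk'
      exact not_le.1 (hk k hk').1.1.1
    · intro s hs k hk'
      rcases mul_self_eq_one_iff.1 ((sq s).symm.trans hs) with h | h
      · rw [h]; exact not_le.1 (hk k hk').1.1.2
      · rw [h]; exact not_le.1 (hk k hk').1.2
    · intro k hk'
      exact not_le.1 (hk k hk').2
    · intro j
      exact not_not.1 (hj j (Finset.mem_univ j)).1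
    · intro j
      exact not_not.1 (hj j (Finset.mem_univ j)).2
  have hA : ∀ k ∈ gridNet d, Q (A₁ k ∪ A₂ 1 k ∪ A₂ (-1) k ∪ A₃ k) ≤ 4 * p := fun k hk => by
    calc _ ≤ Q (A₁ k) + Q (A₂ 1 k) + Q (A₂ (-1) k) + Q (A₃ k) :=
          (measure_union_le _ _).trans (add_le_add ((measure_union_le _ _).trans
            (add_le_add (measure_union_le _ _) le_rfl)) le_rfl)
      _ ≤ p + p + p + p := by
          gcongr
          · exact m₁ k hk
          · exact m₂ 1 (by norm_num) k hk
          · exact m₂ (-1) (by norm_num) k hk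
          · exact m₃ k hk
      _ = 4 * p := by ring
  have hB : ∀ j ∈ (Finset.univ : Finset (Fin d)), Q (B₁ j ∪ B₂ j) ≤ 2 * p := fun j _ => by
    calc _ ≤ Q (B₁ j) + Q (B₂ j) := measure_union_le _ _
      _ ≤ p + p := add_le_add (n₁ j) (n₂ j)
      _ = 2 * p := by ring
  calc Q {X | ¬ GoodSample (fun i j => X i j) μ α ρ ε}
      ≤ _ := measure_mono hsub
    _ ≤ (∑ k ∈ gridNet d, Q (A₁ k ∪ A₂ 1 k ∪ A₂ (-1) k ∪ A₃ k)) +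
          ∑ j ∈ Finset.univ, Q (B₁ j ∪ B₂ j) :=
        (measure_union_le _ _).trans (add_le_add (measure_biUnion_finset_le _ _)
          (measure_biUnion_finset_le _ _))
    _ ≤ (∑ _k ∈ gridNet d, 4 * p) + ∑ _j : Fin d, 2 * p :=
        add_le_add (Finset.sum_le_sum hA) (Finset.sum_le_sum hB)
    _ = (gridNet d).card * (4 * p) + d * (2 * p) := by simp
    _ ≤ ((17 * d) ^ d : ℕ) * (4 * p) + d * (2 * p) := by
        gcongr; exact card_gridNet_le hd
    _ = ENNReal.ofReal ((4 * ((17 * d) ^ d : ℕ) + 2 * d : ℝ) * Real.exp (-(10 * Λ))) := by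
        rw [ENNReal.ofReal_mul (by positivity), ENNReal.ofReal_add (by positivity) (by positivity),
          ENNReal.ofReal_mul (by norm_num), ENNReal.ofReal_mul (by norm_num),
          ENNReal.ofReal_natCast, ENNReal.ofReal_natCast, ← hp]
        rw [ENNReal.ofReal_ofNat, ENNReal.ofReal_ofNat]
        ring
    _ ≤ _ := ENNReal.ofReal_le_ofReal (union_count_le hd hδ h1 h2 h3)

end Good

/-! ### The algorithm -/

/-- Layout of the arrays: 0 scale, 1 corruption level, 2 sample, 3 current centre, 4 initial centre,
5 truncated residuals, 6 current weights, 7 best weights, 8 their excess, 9 flag, 10 matrix power,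
11 scores, 12 current excess, 13 removal scores, 14 shifted moments. In an assignment the variables
0 and 1 are the indices of the cell; bound variables start at 2. -/
instance : Add Term := ⟨Term.add⟩
instance : Sub Term := ⟨Term.sub⟩
instance : Mul Term := ⟨Term.mul⟩
instance : Div Term := ⟨Term.div⟩

namespace Term

variable {n d k : ℕ} {m : Mem} {env : ℕ → ℕ}

theorem eval_add (e f : Term) : (e + f).eval n d m k env = e.eval n d m k env + f.eval n d m k env :=
  rfl

theorem eval_sub (e f : Term) : (e - f).eval n d m k env = e.eval n d m k env - f.eval n d m k env :=
  rfl

theorem eval_div (e f : Term) : (e / f).eval n d m k env = e.eval n d m k env / f.eval n d m k env :=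
  rfl

/-- The scale, held in array `0`. -/
def scale : Term := cell 0 .zero .zero

/-- The admissible amount of removed weight; array `1` holds the corruption level. -/
def budget : Term := rat 2 * cell 1 .zero .zero * size .samples

/-- Truncation of `e` at level `b`. -/
def trunc (b e : Term) : Term := ite e (rat 0 - b) (rat 0 - b) (ite e b e b)

theorem eval_trunc {b e : Term} (hb : 0 ≤ b.eval n d m k env) :
    (trunc b e).eval n d m k env = clip (b.eval n d m k env) (e.eval n d m k env) := by
  simp only [trunc, eval, eval_sub, Rat.cast_zero, zero_sub, clip]
  split_ifs with h1 h2
  · rw [min_eq_left (by linarith), max_eq_left h1]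
  · rw [min_eq_left h2, max_eq_right (by linarith)]
  · rw [min_eq_right (by linarith), max_eq_right (by linarith)]

/-- `e` if the point `x` of the `j`-th column has at most half of the points on either side. -/
def ifMiddle (e : Term) : Term :=
  ite (sum .samples (ite (cell 2 (.var 2) (.var 1)) (cell 2 (.var 3) (.var 1)) (rat 0) (rat 1)))
    (size .samples / rat 2)
    (ite (sum .samples (ite (cell 2 (.var 3) (.var 1)) (cell 2 (.var 2) (.var 1)) (rat 0) (rat 1)))
      (size .samples / rat 2) e (rat 0)) (rat 0)

def middle : Term :=
  sum .samples (ifMiddle (cell 2 (.var 2) (.var 1))) / sum .samples (ifMiddle (rat 1))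

/-- Entry of the shifted second moment matrix of the points in array `5` with the weights in
array `6`. -/
def moment : Term :=
  let off := sum .samples (cell 6 (.var 2) .zero * cell 5 (.var 2) (.var 0) *
    cell 5 (.var 2) (.var 1)) / size .samples
  -- Equality of the indices is tested by two comparisons.
  ite (num (.var 0)) (num (.var 1)) (ite (num (.var 1)) (num (.var 0))
    (rat 3 * scale * (rat 3 * scale)) off) off

/-- Entry of the square of the matrix in array `10`. -/
def squared : Term := sum .dims (cell 10 (.var 0) (.var 2) * cell 10 (.var 2) (.var 1))

/-- Squared Frobenius norm of the matrix in array `10`, with bound variables `x` and `y`. -/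
def frobenius (x y : ℕ) : Term :=
  sum .dims (sum .dims (cell 10 (.var x) (.var y) * cell 10 (.var x) (.var y)))

def pointScore : Term :=
  let form := sum .dims (cell 10 (.var 3) (.var 2) * cell 5 (.var 0) (.var 3))
  sum .dims (form * form) / frobenius 2 3

def totalExcess : Term :=
  sum .samples (cell 6 (.var 2) .zero * (cell 11 (.var 2) .zero -
    sum .dims (sum .dims (cell 10 (.var 4) (.var 3) * cell 10 (.var 4) (.var 3) *
      (cell 5 (.var 2) (.var 4) * cell 5 (.var 2) (.var 4)))) / frobenius 3 4)) / size .samples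

/-- Whether the current weights are admissible and at least as good as the best so far. -/
def improves : Term :=
  ite (sum .samples (rat 1 - cell 6 (.var 2) .zero)) budget
    (ite (cell 12 .zero .zero) (cell 8 .zero .zero) (rat 1) (rat 0)) (rat 0)

def removal : Term :=
  ite (cell 6 (.var 0) .zero) (rat 0) (rat 0)
    (ite (sum .samples (ite (cell 6 (.var 0) .zero * cell 11 (.var 0) .zero)
      (cell 6 (.var 2) .zero * cell 11 (.var 2) .zero) (rat 1) (rat 0))) budget
      (cell 11 (.var 0) .zero) (rat 0))

def reduced : Term :=
  cell 6 (.var 0) .zero - cell 6 (.var 0) .zero * cell 13 (.var 0) .zero /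
    max .samples (cell 13 (.var 2) .zero)

def centred : Term :=
  trunc (rat 3 * scale) (cell 2 (.var 0) (.var 1) - cell 3 .zero (.var 1))

def moved : Term :=
  cell 4 .zero (.var 1) + trunc scale (cell 3 .zero (.var 1) +
    sum .samples (cell 7 (.var 2) .zero * cell 5 (.var 2) (.var 1)) / size .samples -
      cell 4 .zero (.var 1))

end Term

namespace Cmd

/-- Scores the points: high powers of the shifted second moment matrix by repeated squaring. -/
def scoring : Cmd :=
  .seq (.assign 14 .dims .dims .moment)
  (.seq (.assign 10 .dims .dims (.cell 14 (.var 0) (.var 1)))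
  (.seq (.rep .samples (.assign 10 .dims .dims .squared))
  (.seq (.assign 11 .samples .one .pointScore)
    (.assign 12 .one .one .totalExcess))))

/-- One filter step. -/
def filtering : Cmd :=
  .seq scoring
  (.seq (.assign 9 .one .one .improves)
  (.seq (.assign 7 .samples .one
    (.ite (.rat 1) (.cell 9 .zero .zero) (.cell 6 (.var 0) .zero) (.cell 7 (.var 0) .zero)))
  (.seq (.assign 8 .one .one
    (.ite (.rat 1) (.cell 9 .zero .zero) (.cell 12 .zero .zero) (.cell 8 .zero .zero)))
  (.seq (.assign 13 .samples .one .removal)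
    (.assign 6 .samples .one .reduced)))))

/-- One step of the descent: filter around the current centre, then move the centre. -/
def descent : Cmd :=
  .seq (.assign 5 .samples .dims .centred)
  (.seq (.assign 6 .samples .one (.rat 1))
  (.seq (.assign 7 .samples .one (.rat 1))
  -- Unit weights are the first candidate, so array 8 must start with their excess.
  (.seq scoring
  (.seq (.assign 8 .one .one (.cell 12 .zero .zero))
  (.seq (.rep .samples filtering)
    (.assign 3 .one .dims .moved))))))

/-- The number of descent steps is n * d because α, which governs the contraction, is not an input.
-/
def main : Cmd :=
  .seq (.assign 4 .one .dims .middle)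
  (.seq (.assign 3 .one .dims (.cell 4 .zero (.var 1)))
    (.rep .samples (.rep .dims descent)))

end Cmd

/-! ### Analysis of the algorithm -/

section Exec

variable {n d : ℕ} {m : Mem}

theorem exec_assign_of_ne {a a' : Fin 16} (h : a' ≠ a) (z₁ z₂ : Size) (e : Term) :
    (Cmd.assign a z₁ z₂ e).exec n d m a' = m a' :=
  Function.update_of_ne h _ _

theorem exec_assign_self {a : Fin 16} {z₁ z₂ : Size} {e : Term} {i j : ℕ} (hi : i < z₁.eval n d)
    (hj : j < z₂.eval n d) :
    (Cmd.assign a z₁ z₂ e).exec n d m a i j = e.eval n d m 2 (pairEnv i j) := by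
  simp only [Cmd.exec, Function.update_self]
  exact if_pos ⟨hi, hj⟩

/-- The leading `n × d` block of an array, the first `n` entries of its column `0`, and the first
`d` entries of its row `0`. -/
def block (n d : ℕ) (m : Mem) (a : Fin 16) : Fin n → Fin d → ℝ := fun i j => m a i j

def column (n : ℕ) (m : Mem) (a : Fin 16) : Fin n → ℝ := fun i => m a i 0

def row (d : ℕ) (m : Mem) (a : Fin 16) : Fin d → ℝ := fun j => m a 0 j

theorem eval_moment (i j : Fin d) :
    Term.moment.eval n d m 2 (pairEnv i j) =
      shiftedMoment (column n m 6) (block n d m 5) (3 * m 0 0 0) i j := by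
  simp only [Term.moment, Term.eval, Term.eval_div, Term.scale, Idx.eval, Size.eval,
    Finset.sum_range, shiftedMoment, pairEnv, Nat.cast_le, Function.update_self,
    Function.update_of_ne (show (0 : ℕ) ≠ 2 by decide),
    Function.update_of_ne (show (1 : ℕ) ≠ 2 by decide), column, block, Fintype.card_fin]
  rcases lt_trichotomy i j with h | h | h
  · rw [if_pos (Fin.val_fin_le.2 h.le), if_neg (by simpa using h), if_neg h.ne]
  · subst h
    rw [if_pos le_rfl, if_pos le_rfl, if_pos rfl, sq]; norm_num
  · rw [if_neg (by simpa using h), if_neg h.ne']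

theorem exec_squared (H : Matrix (Fin d) (Fin d) ℝ) (h : ∀ i j : Fin d, m 10 i j = H i j) (t : ℕ) :
    (∀ a, a ≠ 10 → ((Cmd.assign 10 .dims .dims .squared).exec n d)^[t] m a = m a) ∧
      ∀ i j : Fin d, ((Cmd.assign 10 .dims .dims .squared).exec n d)^[t] m 10 i j =
        (H ^ 2 ^ t) i j := by
  induction t with
  | zero => exact ⟨fun _ _ => rfl, fun i j => by simpa using h i j⟩
  | succ t ih =>
    rw [Function.iterate_succ_apply']
    refine ⟨fun a ha => by rw [exec_assign_of_ne ha]; exact ih.1 a ha, fun i j => ?_⟩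
    rw [exec_assign_self i.2 j.2]
    obtain ⟨-, ih⟩ := ih
    set m' := ((Cmd.assign 10 .dims .dims .squared).exec n d)^[t] m
    simp only [Term.squared, Term.eval, Idx.eval, Size.eval, Finset.sum_range,
      Function.update_self, Function.update_of_ne (show (0 : ℕ) ≠ 2 by decide),
      Function.update_of_ne (show (1 : ℕ) ≠ 2 by decide), pairEnv, ih]
    rw [pow_succ, pow_mul, sq, Matrix.mul_apply]

theorem eval_frobenius {C : Matrix (Fin d) (Fin d) ℝ} (h : ∀ i j : Fin d, m 10 i j = C i j) (k : ℕ)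
    (env : ℕ → ℕ) :
    (Term.frobenius k (k + 1)).eval n d m k env = ∑ j, ∑ k, C j k ^ 2 := by
  simp only [Term.frobenius, Term.eval, Idx.eval, Size.eval, Finset.sum_range,
    Function.update_self, Function.update_of_ne (show k ≠ k + 1 by omega), h, sq]

theorem eval_pointScore {C : Matrix (Fin d) (Fin d) ℝ} (h : ∀ i j : Fin d, m 10 i j = C i j)
    (i : Fin n) :
    Term.pointScore.eval n d m 2 (pairEnv i 0) = score C (block n d m 5 i) := by
  rw [Term.pointScore, Term.eval_div, eval_frobenius h 2]
  simp only [Term.eval, Idx.eval, Size.eval, Finset.sum_range,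
    Function.update_self, Function.update_of_ne (show (2 : ℕ) ≠ 3 by decide),
    Function.update_of_ne (show (0 : ℕ) ≠ 3 by decide),
    Function.update_of_ne (show (0 : ℕ) ≠ 2 by decide), h, ← sq, score, block, pairEnv]

theorem eval_totalExcess {C : Matrix (Fin d) (Fin d) ℝ} (h : ∀ i j : Fin d, m 10 i j = C i j)
    (env : ℕ → ℕ) :
    Term.totalExcess.eval n d m 2 env =
      (∑ i, column n m 6 i * (column n m 11 i - diagScore C (block n d m 5 i))) / n := by
  rw [Term.totalExcess, Term.eval_div]
  simp only [Term.eval, Term.eval_sub, Term.eval_div, eval_frobenius h 3, Idx.eval,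
    Size.eval, Finset.sum_range, Function.update_self,
    Function.update_of_ne (show (3 : ℕ) ≠ 4 by decide),
    Function.update_of_ne (show (2 : ℕ) ≠ 4 by decide),
    Function.update_of_ne (show (2 : ℕ) ≠ 3 by decide), h, ← sq, diagScore, block, column]

/-- The n squarings reach the exponent 2^n at polynomial cost. Arrays below 10, which hold the state
of the filter and the descent except for the flag in 9, survive together with it. -/
theorem exec_scoring (m : Mem) :
    (∀ a : Fin 16, a < 10 → Cmd.scoring.exec n d m a = m a) ∧
    (∀ i : Fin n, Cmd.scoring.exec n d m 11 i 0 =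
      score (directions (column n m 6) (block n d m 5) (3 * m 0 0 0) (2 ^ n)) (block n d m 5 i)) ∧
    Cmd.scoring.exec n d m 12 0 0 =
      excess (column n m 6) (block n d m 5) (3 * m 0 0 0) (2 ^ n) := by
  set H := shiftedMoment (column n m 6) (block n d m 5) (3 * m 0 0 0) with hH
  set m₁ := (Cmd.assign 14 .dims .dims .moment).exec n d m with hm₁
  set m₂ := (Cmd.assign 10 .dims .dims (.cell 14 (.var 0) (.var 1))).exec n d m₁ with hm₂
  set m₃ := ((Cmd.assign 10 .dims .dims .squared).exec n d)^[n] m₂ with hm₃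
  set m₄ := (Cmd.assign 11 .samples .one .pointScore).exec n d m₃ with hm₄
  have he : Cmd.scoring.exec n d m = (Cmd.assign 12 .one .one .totalExcess).exec n d m₄ := rfl
  have h₂ : ∀ i j : Fin d, m₂ 10 i j = H i j := fun i j => by
    rw [hm₂, exec_assign_self i.2 j.2]
    change m₁ 14 i j = _
    rw [hm₁, exec_assign_self i.2 j.2, eval_moment]
  obtain ⟨f₃, h₃⟩ := exec_squared (n := n) H h₂ n
  have k₃ : ∀ a : Fin 16, a < 10 → m₃ a = m a := fun a ha => by
    have ha' := Fin.lt_def.1 ha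
    rw [hm₃, f₃ a (Fin.ne_of_lt ha), hm₂, exec_assign_of_ne (Fin.ne_of_lt ha), hm₁,
      exec_assign_of_ne (Fin.ne_of_lt (ha.trans (by decide)))]
  have b₃ : block n d m₃ 5 = block n d m 5 := by
    funext i j; simp only [block, k₃ 5 (by decide)]
  have h₄ : ∀ i : Fin n, m₄ 11 i 0 = score (H ^ 2 ^ n) (block n d m 5 i) := fun i => by
    rw [hm₄, exec_assign_self i.2 Nat.one_pos, eval_pointScore h₃, b₃]
  have k₄ : ∀ a : Fin 16, a < 10 → m₄ a = m a := fun a ha => by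
    rw [hm₄, exec_assign_of_ne (Fin.ne_of_lt (ha.trans (by decide))), k₃ a ha]
  refine ⟨fun a ha => ?_, fun i => ?_, ?_⟩
  · rw [he, exec_assign_of_ne (Fin.ne_of_lt (ha.trans (by decide))), k₄ a ha]
  · rw [he, exec_assign_of_ne (by decide), h₄]; rfl
  · rw [he, exec_assign_self Nat.one_pos Nat.one_pos, eval_totalExcess (C := H ^ 2 ^ n), excess,
      Fintype.card_fin]
    · congr 1
      refine Finset.sum_congr rfl fun i _ => ?_
      have b₄ : block n d m₄ 5 = block n d m 5 := by
        funext i j; simp only [block, k₄ 5 (by decide)]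
      simp only [column, h₄, k₄ 6 (by decide), b₄]
      rfl
    · intro i j
      rw [hm₄, exec_assign_of_ne (by decide)]
      exact h₃ i j

/-- The maximum starts from the default 0, so it is either attained or zero. These are the two
alternatives allowed for the normalisation M. -/
theorem fold_max_spec (n : ℕ) (f : ℕ → ℝ) :
    0 ≤ (Finset.range n).fold max 0 f ∧ (∀ i : Fin n, f i ≤ (Finset.range n).fold max 0 f) ∧
      ((Finset.range n).fold max 0 f = 0 ∨ ∃ i : Fin n, f i = (Finset.range n).fold max 0 f) := by
  refine ⟨(Finset.le_fold_max _).2 (Or.inl le_rfl),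
    fun i => (Finset.le_fold_max _).2 (Or.inr ⟨i, Finset.mem_range.2 i.2, le_rfl⟩), ?_⟩
  rcases (Finset.le_fold_max _).1 (le_refl ((Finset.range n).fold max 0 f)) with h | ⟨i, hi, h⟩
  · exact Or.inl (le_antisymm h ((Finset.le_fold_max _).2 (Or.inl le_rfl)))
  · exact Or.inr ⟨⟨i, Finset.mem_range.1 hi⟩,
      le_antisymm ((Finset.le_fold_max _).2 (Or.inr ⟨i, hi, le_rfl⟩)) h⟩

/-- The best weights met so far and their excess are updated if the current weights are admissible
and at least as good; the current weights are reduced. -/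
theorem exec_filtering (m : Mem) :
    (∀ a : Fin 16, a < 6 → Cmd.filtering.exec n d m a = m a) ∧
    (∃ M : ℝ, 0 ≤ M ∧
      (∀ i, filterScore (column n m 6) (block n d m 5) (3 * m 0 0 0) (2 ^ n)
        (2 * m 1 0 0 * n) i ≤ M) ∧
      (M = 0 ∨ ∃ i, filterScore (column n m 6) (block n d m 5) (3 * m 0 0 0) (2 ^ n)
        (2 * m 1 0 0 * n) i = M) ∧
      column n (Cmd.filtering.exec n d m) 6 = reweight (column n m 6)
        (filterScore (column n m 6) (block n d m 5) (3 * m 0 0 0) (2 ^ n) (2 * m 1 0 0 * n)) M) ∧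
    (((∑ i, (1 - column n m 6 i) ≤ 2 * m 1 0 0 * n ∧
        excess (column n m 6) (block n d m 5) (3 * m 0 0 0) (2 ^ n) ≤ m 8 0 0) ∧
        column n (Cmd.filtering.exec n d m) 7 = column n m 6 ∧
        Cmd.filtering.exec n d m 8 0 0 =
          excess (column n m 6) (block n d m 5) (3 * m 0 0 0) (2 ^ n)) ∨
      (¬ (∑ i, (1 - column n m 6 i) ≤ 2 * m 1 0 0 * n ∧
        excess (column n m 6) (block n d m 5) (3 * m 0 0 0) (2 ^ n) ≤ m 8 0 0) ∧
        column n (Cmd.filtering.exec n d m) 7 = column n m 7 ∧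
        Cmd.filtering.exec n d m 8 0 0 = m 8 0 0)) := by
  set w := column n m 6 with hw
  set ψ := block n d m 5 with hψ
  set b := 3 * m 0 0 0 with hb
  set m₁ := Cmd.scoring.exec n d m with hm₁
  obtain ⟨k₁, s₁, e₁⟩ := exec_scoring (n := n) (d := d) m
  rw [← hm₁, ← hw, ← hψ, ← hb] at s₁ e₁
  rw [← hm₁] at k₁
  set m₂ := (Cmd.assign 9 .one .one .improves).exec n d m₁ with hm₂
  set m₃ := (Cmd.assign 7 .samples .one (.ite (.rat 1) (.cell 9 .zero .zero)
    (.cell 6 (.var 0) .zero) (.cell 7 (.var 0) .zero))).exec n d m₂ with hm₃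
  set m₄ := (Cmd.assign 8 .one .one (.ite (.rat 1) (.cell 9 .zero .zero) (.cell 12 .zero .zero)
    (.cell 8 .zero .zero))).exec n d m₃ with hm₄
  set m₅ := (Cmd.assign 13 .samples .one .removal).exec n d m₄ with hm₅
  have he : Cmd.filtering.exec n d m = (Cmd.assign 6 .samples .one .reduced).exec n d m₅ := rfl
  have k₄ : ∀ a : Fin 16, a ≠ 7 → a ≠ 8 → a ≠ 9 → m₄ a = m₁ a := fun a h7 h8 h9 => by
    rw [hm₄, exec_assign_of_ne h8, hm₃, exec_assign_of_ne h7, hm₂, exec_assign_of_ne h9]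
  have hflag : m₂ 9 0 0 = if ∑ i, (1 - w i) ≤ 2 * m 1 0 0 * n ∧ excess w ψ b (2 ^ n) ≤ m 8 0 0
      then 1 else 0 := by
    rw [hm₂, exec_assign_self Nat.one_pos Nat.one_pos]
    simp only [Term.improves, Term.budget, Term.eval, Term.eval_sub, Idx.eval,
      Size.eval, Finset.sum_range, Function.update_self, k₁ 6 (by decide), k₁ 1 (by decide),
      k₁ 8 (by decide), e₁]
    rw [ite_and]
    norm_num [hw, column]
  have h7 : ∀ i : Fin n, m₃ 7 i 0 = if 1 ≤ m₂ 9 0 0 then w i else m 7 i 0 := fun i => by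
    rw [hm₃, exec_assign_self i.2 Nat.one_pos]
    simp only [Term.eval, Idx.eval, pairEnv, Rat.cast_one]
    rw [hm₂, exec_assign_of_ne (show (6 : Fin 16) ≠ 9 by decide),
      exec_assign_of_ne (show (7 : Fin 16) ≠ 9 by decide), k₁ 6 (by decide), k₁ 7 (by decide)]
    rfl
  have h8 : m₄ 8 0 0 = if 1 ≤ m₂ 9 0 0 then excess w ψ b (2 ^ n) else m 8 0 0 := by
    rw [hm₄, exec_assign_self Nat.one_pos Nat.one_pos]
    simp only [Term.eval, Idx.eval, Rat.cast_one]
    rw [hm₃, exec_assign_of_ne (show (9 : Fin 16) ≠ 7 by decide),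
      exec_assign_of_ne (show (12 : Fin 16) ≠ 7 by decide),
      exec_assign_of_ne (show (8 : Fin 16) ≠ 7 by decide), hm₂,
      exec_assign_of_ne (show (12 : Fin 16) ≠ 9 by decide),
      exec_assign_of_ne (show (8 : Fin 16) ≠ 9 by decide), k₁ 8 (by decide), e₁]
  have h13 : ∀ i : Fin n, m₅ 13 i 0 = filterScore w ψ b (2 ^ n) (2 * m 1 0 0 * n) i := fun i => by
    rw [hm₅, exec_assign_self i.2 Nat.one_pos]
    simp only [Term.removal, Term.budget, Term.eval, Idx.eval, Size.eval,
      Finset.sum_range, Function.update_self, Function.update_of_ne (show (0 : ℕ) ≠ 2 by decide),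
      pairEnv, k₄ 6 (by decide) (by decide) (by decide), k₄ 11 (by decide) (by decide) (by decide),
      k₄ 1 (by decide) (by decide) (by decide), k₁ 6 (by decide), k₁ 1 (by decide), s₁,
      filterScore, TopScore]
    norm_num [hw, column]
  refine ⟨fun a ha => ?_, ?_, ?_⟩
  · rw [he, exec_assign_of_ne (Fin.ne_of_lt ha), hm₅,
      exec_assign_of_ne (Fin.ne_of_lt (ha.trans (by decide))),
      k₄ a (Fin.ne_of_lt (ha.trans (by decide))) (Fin.ne_of_lt (ha.trans (by decide)))
        (Fin.ne_of_lt (ha.trans (by decide))), k₁ a (ha.trans (by decide))]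
  · obtain ⟨f0, f1, f2⟩ := fold_max_spec n fun i => m₅ 13 i 0
    simp only [h13] at f1 f2
    refine ⟨_, f0, f1, f2, ?_⟩
    funext i
    simp only [column, he]
    rw [exec_assign_self i.2 Nat.one_pos]
    simp only [Term.reduced, Term.eval, Term.eval_sub, Term.eval_div, Idx.eval,
      Size.eval, Function.update_self, pairEnv, h13, reweight]
    rw [hm₅, exec_assign_of_ne (show (6 : Fin 16) ≠ 13 by decide),
      k₄ 6 (by decide) (by decide) (by decide), k₁ 6 (by decide)]
    rfl
  · have g7 : column n (Cmd.filtering.exec n d m) 7 = fun i : Fin n => m₃ 7 i 0 := by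
      funext i
      rw [column, he, exec_assign_of_ne (by decide), hm₅, exec_assign_of_ne (by decide), hm₄,
        exec_assign_of_ne (by decide)]
    have g8 : Cmd.filtering.exec n d m 8 0 0 = m₄ 8 0 0 := by
      rw [he, exec_assign_of_ne (by decide), hm₅, exec_assign_of_ne (by decide)]
    rw [g7, g8, h8]
    simp only [h7, hflag]
    by_cases hc : ∑ i, (1 - w i) ≤ 2 * m 1 0 0 * n ∧ excess w ψ b (2 ^ n) ≤ m 8 0 0
    · left
      refine ⟨hc, ?_, ?_⟩
      · funext i
        rw [if_pos hc, if_pos le_rfl]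
      · rw [if_pos hc, if_pos le_rfl]
    · right
      refine ⟨hc, ?_, ?_⟩
      · funext i
        rw [if_neg hc, if_neg (by norm_num)]; rfl
      · rw [if_neg hc, if_neg (by norm_num)]

end Exec

/-- A run of the filter on the points `ψ`: weights and normalizations. -/
structure IsFilterRun {n d : ℕ} (ψ : Fin n → Fin d → ℝ) (b ε : ℝ) (K : ℕ) (w : ℕ → Fin n → ℝ)
    (M : ℕ → ℝ) : Prop where
  zero : w 0 = fun _ => 1
  step : ∀ t, w (t + 1) = reweight (w t) (filterScore (w t) ψ b K (2 * ε * n)) (M t)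
  nonneg : ∀ t, 0 ≤ M t
  le : ∀ t i, filterScore (w t) ψ b K (2 * ε * n) i ≤ M t
  attained : ∀ t, M t = 0 ∨ ∃ i, filterScore (w t) ψ b K (2 * ε * n) i = M t

theorem IsFilterRun.mem {n d : ℕ} {ψ : Fin n → Fin d → ℝ} {b ε : ℝ} {K : ℕ} {w : ℕ → Fin n → ℝ}
    {M : ℕ → ℝ} (h : IsFilterRun ψ b ε K w M) (t : ℕ) (i : Fin n) : 0 ≤ w t i ∧ w t i ≤ 1 := by
  induction t generalizing i with
  | zero => simp [h.zero]
  | succ t ih =>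
    rw [h.step]
    have := reweight_mem (fun i => (ih i).1) (filterScore_nonneg (w t) ψ b K (2 * ε * n)) (h.le t) i
    exact ⟨this.1, this.2.trans (ih i).2⟩

section Exec

variable {n d : ℕ}

/-- The program cannot recognise the step at which the analysis finds a small excess, since L
depends on the unknown location. It keeps the admissible weights of least excess instead, which are
at least as good. -/
theorem exec_rep_filtering {m : Mem} (hε : 0 ≤ m 1 0 0) (h6 : column n m 6 = fun _ => 1)
    (h7 : column n m 7 = fun _ => 1)
    (h8 : m 8 0 0 = excess (column n m 6) (block n d m 5) (3 * m 0 0 0) (2 ^ n)) :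
    ∃ w M, IsFilterRun (block n d m 5) (3 * m 0 0 0) (m 1 0 0) (2 ^ n) w M ∧
      ∀ T, (∀ a : Fin 16, a < 6 → (Cmd.filtering.exec n d)^[T] m a = m a) ∧
        (∀ i, 0 ≤ column n ((Cmd.filtering.exec n d)^[T] m) 7 i ∧
          column n ((Cmd.filtering.exec n d)^[T] m) 7 i ≤ 1) ∧
        ∑ i, (1 - column n ((Cmd.filtering.exec n d)^[T] m) 7 i) ≤ 2 * m 1 0 0 * n ∧
        ∀ t < T, ∑ i, (1 - w t i) ≤ 2 * m 1 0 0 * n →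
          excess (column n ((Cmd.filtering.exec n d)^[T] m) 7) (block n d m 5) (3 * m 0 0 0)
            (2 ^ n) ≤ excess (w t) (block n d m 5) (3 * m 0 0 0) (2 ^ n) := by
  set ms : ℕ → Mem := fun t => (Cmd.filtering.exec n d)^[t] m with hms
  set ψ := block n d m 5 with hψ
  set b := 3 * m 0 0 0 with hb
  have hsucc : ∀ t, ms (t + 1) = Cmd.filtering.exec n d (ms t) := fun t =>
    Function.iterate_succ_apply' _ _ _
  have hframe : ∀ t, ∀ a : Fin 16, a < 6 → ms t a = m a := by
    intro t
    induction t with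
    | zero => exact fun _ _ => rfl
    | succ t ih => intro a ha; rw [hsucc, (exec_filtering (ms t)).1 a ha, ih a ha]
  have hψt : ∀ t, block n d (ms t) 5 = ψ := fun t => by
    funext i j; simp only [block, hψ, hframe t 5 (by decide)]
  have hspec := fun t => (exec_filtering (n := n) (d := d) (ms t)).2
  simp only [hψt, hframe _ 0 (show (0 : Fin 16) < 6 by decide),
    hframe _ 1 (show (1 : Fin 16) < 6 by decide), ← hsucc, ← hb] at hspec
  choose M hM0 hMle hMatt hMstep using fun t => (hspec t).1
  have hrun : IsFilterRun ψ b (m 1 0 0) (2 ^ n) (fun t => column n (ms t) 6) M :=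
    ⟨h6, hMstep, hM0, hMle, hMatt⟩
  refine ⟨_, M, hrun, fun T => ⟨hframe T, ?_⟩⟩
  -- The induction also records that array 8 is the excess of the weights stored in array 7.
  have key : (∀ i, 0 ≤ column n (ms T) 7 i ∧ column n (ms T) 7 i ≤ 1) ∧
      ∑ i, (1 - column n (ms T) 7 i) ≤ 2 * m 1 0 0 * n ∧
      ms T 8 0 0 = excess (column n (ms T) 7) ψ b (2 ^ n) ∧
      ∀ t < T, ∑ i, (1 - column n (ms t) 6 i) ≤ 2 * m 1 0 0 * n →
        ms T 8 0 0 ≤ excess (column n (ms t) 6) ψ b (2 ^ n) := by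
    induction T with
    | zero =>
      have e : column n (ms 0) 7 = fun _ => 1 := h7
      refine ⟨fun i => by simp [e], by simp [e]; positivity, ?_, fun t ht => by omega⟩
      rw [e, ← h6]
      exact h8
    | succ T ih =>
      obtain ⟨i1, i2, i3, i4⟩ := ih
      rcases (hspec T).2 with ⟨⟨hs, hle⟩, e7, e8⟩ | ⟨hn, e7, e8⟩
      · rw [e7, e8]
        refine ⟨hrun.mem T, hs, rfl, fun t ht hts => ?_⟩
        rcases Nat.lt_succ_iff_lt_or_eq.1 ht with h | rfl
        · exact hle.trans (i4 t h hts)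
        · exact le_rfl
      · rw [e7, e8]
        refine ⟨i1, i2, i3, fun t ht hts => ?_⟩
        rcases Nat.lt_succ_iff_lt_or_eq.1 ht with h | rfl
        · exact i4 t h hts
        · exact le_of_lt (not_le.1 fun h => hn ⟨hts, h⟩)
  obtain ⟨k1, k2, k3, k4⟩ := key
  exact ⟨k1, k2, fun t ht hts => by rw [← k3]; exact k4 t ht hts⟩

/-- One step of the descent moves the centre by the weighted mean of the truncated points, for
admissible weights at least as good as all those met by the filter. -/
theorem exec_descent {m : Mem} (hρ : 0 ≤ m 0 0 0) (hε : 0 ≤ m 1 0 0) {ψ : Fin n → Fin d → ℝ}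
    (hψ : ∀ i j, ψ i j = clip (3 * m 0 0 0) (block n d m 2 i j - row d m 3 j)) :
    (∀ a : Fin 16, a < 5 → a ≠ 3 → Cmd.descent.exec n d m a = m a) ∧
    ∃ w M, IsFilterRun ψ (3 * m 0 0 0) (m 1 0 0) (2 ^ n) w M ∧
      ∃ w' : Fin n → ℝ, (∀ i, 0 ≤ w' i) ∧ (∀ i, w' i ≤ 1) ∧
        ∑ i, (1 - w' i) ≤ 2 * m 1 0 0 * n ∧
        (∀ t < n, ∑ i, (1 - w t i) ≤ 2 * m 1 0 0 * n →
          excess w' ψ (3 * m 0 0 0) (2 ^ n) ≤ excess (w t) ψ (3 * m 0 0 0) (2 ^ n)) ∧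
        ∀ j, row d (Cmd.descent.exec n d m) 3 j = row d m 4 j + clip (m 0 0 0)
          (row d m 3 j + (∑ i, w' i * ψ i j) / n - row d m 4 j) := by
  set m₁ := (Cmd.assign 5 .samples .dims .centred).exec n d m with hm₁
  set m₂ := (Cmd.assign 6 .samples .one (.rat 1)).exec n d m₁ with hm₂
  set m₃ := (Cmd.assign 7 .samples .one (.rat 1)).exec n d m₂ with hm₃
  set m₄ := Cmd.scoring.exec n d m₃ with hm₄
  set m₅ := (Cmd.assign 8 .one .one (.cell 12 .zero .zero)).exec n d m₄ with hm₅
  set m₆ := (Cmd.filtering.exec n d)^[n] m₅ with hm₆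
  have he : Cmd.descent.exec n d m = (Cmd.assign 3 .one .dims .moved).exec n d m₆ := rfl
  obtain ⟨k₄, -, e₄⟩ := exec_scoring (n := n) (d := d) m₃
  rw [← hm₄] at k₄ e₄
  have k₅ : ∀ a : Fin 16, a < 5 → m₅ a = m a := fun a ha => by
    rw [hm₅, exec_assign_of_ne (Fin.ne_of_lt (ha.trans (by decide))), k₄ a (ha.trans (by decide)),
      hm₃, exec_assign_of_ne (Fin.ne_of_lt (ha.trans (by decide))),
      hm₂, exec_assign_of_ne (Fin.ne_of_lt (ha.trans (by decide))),
      hm₁, exec_assign_of_ne (Fin.ne_of_lt ha)]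
  have p₃ : block n d m₃ 5 = ψ := by
    funext i j
    rw [block, hm₃, exec_assign_of_ne (by decide), hm₂, exec_assign_of_ne (by decide), hm₁,
      exec_assign_self i.2 j.2, Term.centred, Term.eval_trunc, hψ]
    · simp [Term.scale, Term.eval, Term.eval_sub, Idx.eval, pairEnv, block, row]
    · simp only [Term.scale, Term.eval, Idx.eval]
      norm_num; exact hρ
  have w₃ : column n m₃ 6 = fun _ => 1 := by
    funext i
    rw [column, hm₃, exec_assign_of_ne (by decide), hm₂, exec_assign_self i.2 Nat.one_pos]
    simp [Term.eval]
  have v₃ : column n m₃ 7 = fun _ => 1 := by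
    funext i
    rw [column, hm₃, exec_assign_self i.2 Nat.one_pos]
    simp [Term.eval]
  have q₅ : ∀ a : Fin 16, a < 8 → m₅ a = m₃ a := fun a ha => by
    rw [hm₅, exec_assign_of_ne (Fin.ne_of_lt ha), k₄ a (ha.trans (by decide))]
  have p₅ : block n d m₅ 5 = ψ := by rw [← p₃]; funext i j; simp only [block, q₅ 5 (by decide)]
  have w₅ : column n m₅ 6 = fun _ => 1 := by
    rw [← w₃]; funext i; simp only [column, q₅ 6 (by decide)]
  have v₅ : column n m₅ 7 = fun _ => 1 := by
    rw [← v₃]; funext i; simp only [column, q₅ 7 (by decide)]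
  obtain ⟨w, M, hrun, hT⟩ := exec_rep_filtering (n := n) (d := d) (m := m₅)
    (by rw [k₅ 1 (by decide)]; exact hε) w₅ v₅ (by
      rw [hm₅, exec_assign_self Nat.one_pos Nat.one_pos, ← hm₅, w₅, p₅, k₅ 0 (by decide)]
      change m₄ 12 0 0 = _
      rw [e₄, w₃, p₃, ← q₅ 0 (by decide), k₅ 0 (by decide)])
  rw [p₅, k₅ 0 (by decide), k₅ 1 (by decide)] at hrun hT
  obtain ⟨t1, t2, t3, t4⟩ := hT n
  rw [← hm₆] at t1 t2 t3 t4
  refine ⟨fun a ha ha3 => ?_, w, M, hrun, column n m₆ 7, fun i => (t2 i).1, fun i => (t2 i).2, t3,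
    t4, fun j => ?_⟩
  · rw [he, exec_assign_of_ne ha3, t1 a (ha.trans (by decide)), k₅ a ha]
  · have hb : ∀ i j, block n d m₆ 5 i j = ψ i j := fun i j => by
      rw [← p₅]; simp only [block, t1 5 (by decide)]
    simp only [block] at hb
    have f0 : m₆ 0 = m 0 := by rw [t1 0 (by decide), k₅ 0 (by decide)]
    have f3 : m₆ 3 = m 3 := by rw [t1 3 (by decide), k₅ 3 (by decide)]
    have f4 : m₆ 4 = m 4 := by rw [t1 4 (by decide), k₅ 4 (by decide)]
    rw [row, he, exec_assign_self Nat.one_pos j.2, Term.moved, Term.eval_add, Term.eval_trunc]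
    · simp only [Term.scale, Term.eval, Term.eval_sub, Term.eval_div, Idx.eval, Size.eval,
        Finset.sum_range, pairEnv, Function.update_self, Function.update_of_ne (show (1 : ℕ) ≠ 2 by decide), row, column, f0, f3, f4, hb]
    · simp only [Term.scale, Term.eval, Idx.eval, f0]; exact hρ

theorem eval_middle (m : Mem) (j : Fin d) :
    Term.middle.eval n d m 2 (pairEnv 0 j) = midAverage fun i => block n d m 2 i j := by
  simp only [Term.middle, Term.ifMiddle, Term.eval, Term.eval_div, Idx.eval, Size.eval,
    Finset.sum_range, pairEnv, Function.update_self,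
    Function.update_of_ne (show (1 : ℕ) ≠ 2 by decide),
    Function.update_of_ne (show (1 : ℕ) ≠ 3 by decide),
    Function.update_of_ne (show (2 : ℕ) ≠ 3 by decide), midAverage, block, Fintype.card_fin,
    Rat.cast_zero, Rat.cast_one, Rat.cast_ofNat]
  congr!

end Exec

/-! ### Deterministic error bounds on a good sample -/

section Deterministic

variable {n d : ℕ} {α ρ ε : ℝ}

theorem GoodSample.count {X : Fin n → Fin d → ℝ} {μ : Fin d → ℝ} (h : GoodSample X μ α ρ ε)
    (j : Fin d) [DecidablePred fun i => |X i j - μ j| ≤ ρ] :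
    α / 2 * n ≤ ((Finset.univ.filter fun i => |X i j - μ j| ≤ ρ).card : ℝ) := by
  have h1 : (Finset.univ : Finset (Fin n)) ⊆ (Finset.univ.filter fun i => |X i j - μ j| ≤ ρ) ∪
      ((Finset.univ.filter fun i => ρ < X i j - μ j) ∪
        Finset.univ.filter fun i => X i j - μ j < -ρ) := by
    intro i _
    simp only [Finset.mem_union, Finset.mem_filter, Finset.mem_univ, true_and, abs_le]
    by_cases h1 : ρ < X i j - μ j
    · exact Or.inr (Or.inl h1)
    · by_cases h2 : X i j - μ j < -ρ
      · exact Or.inr (Or.inr h2)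
      · exact Or.inl ⟨not_lt.1 h2, not_lt.1 h1⟩
  have h2 := (Finset.card_le_card h1).trans ((Finset.card_union_le _ _).trans
    (Nat.add_le_add_left (Finset.card_union_le _ _) _))
  rw [Finset.card_univ, Fintype.card_fin] at h2
  have h3 : (n : ℝ) ≤ ((Finset.univ.filter fun i => |X i j - μ j| ≤ ρ).card : ℝ) +
      (((Finset.univ.filter fun i => ρ < X i j - μ j).card : ℝ) +
        ((Finset.univ.filter fun i => X i j - μ j < -ρ).card : ℝ)) := by exact_mod_cast h2
  linarith [h.upper j, h.lower j]

theorem card_filter_le_add {ι : Type*} [Fintype ι] [DecidableEq ι] {P Q : ι → Prop}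
    [DecidablePred P] [DecidablePred Q] {G : Finset ι} (h : ∀ i ∈ G, P i → Q i) :
    ((Finset.univ.filter P).card : ℝ) ≤ (Finset.univ.filter Q).card + Gᶜ.card := by
  have : Finset.univ.filter P ⊆ Finset.univ.filter Q ∪ Gᶜ := fun i hi => by
    simp only [Finset.mem_union, Finset.mem_filter, Finset.mem_univ, true_and,
      Finset.mem_compl] at hi ⊢
    by_cases hG : i ∈ G
    · exact Or.inl (h i hG hi)
    · exact Or.inr hG
  exact_mod_cast (Finset.card_le_card this).trans (Finset.card_union_le _ _)

/-- The coordinatewise median of a corrupted good sample. -/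
theorem GoodSample.abs_midAverage_sub_le {X Z : Fin n → Fin d → ℝ} {μ : Fin d → ℝ}
    (h : GoodSample X μ α ρ ε) (hn : 0 < n) (hε : ε < α / 4) {G : Finset (Fin n)}
    (hG : (Gᶜ.card : ℝ) ≤ ε * n) (hGZ : ∀ i ∈ G, Z i = X i) (j : Fin d) :
    |midAverage (fun i => Z i j) - μ j| ≤ ρ := by
  have : Nonempty (Fin n) := ⟨⟨0, hn⟩⟩
  have hn' : (0 : ℝ) < n := by exact_mod_cast hn
  have hlt : ε * n < α / 4 * n := by gcongr
  have h1 := card_filter_le_add (P := fun i => Z i j < μ j - ρ) (Q := fun i => X i j - μ j < -ρ)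
    (G := G) fun i hi hz => by rw [hGZ i hi] at hz; linarith
  have h2 := card_filter_le_add (P := fun i => μ j + ρ < Z i j) (Q := fun i => ρ < X i j - μ j)
    (G := G) fun i hi hz => by rw [hGZ i hi] at hz; linarith
  have h3 := midAverage_mem (z := fun i => Z i j) (lo := μ j - ρ) (hi := μ j + ρ)
    (by rw [Fintype.card_fin]; linarith [h.lower j]) (by rw [Fintype.card_fin]; linarith [h.upper j])
  exact abs_le.2 ⟨by linarith [h3.1], by linarith [h3.2]⟩

/-- The relative error d²/(2 · 2^n) of the power method is at most ε, since 2^n ≥ e^(n/2) ≥ n³/48, d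
≤ n/5 and εn ≥ 1. -/
theorem sq_le_two_pow {n d : ℕ} {ε : ℝ} (hε : 0 < ε) (h1 : 5 * d ≤ n) (h2 : 1 ≤ ε * n) :
    (d : ℝ) * d ≤ ε * (2 * (2 ^ n : ℕ)) := by
  have h3 : (n / 2 : ℝ) ^ 3 / 6 ≤ 2 ^ n := by
    have h4 := Real.pow_div_factorial_le_exp (n / 2 : ℝ) (by positivity) 3
    have h5 : Real.exp (n / 2 : ℝ) ≤ 2 ^ n := by
      rw [← Real.exp_log (show (0 : ℝ) < 2 by norm_num), ← Real.exp_nat_mul,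
        Real.exp_log (show (0 : ℝ) < 2 by norm_num)]
      have h6 : (1 : ℝ) / 2 ≤ Real.log 2 := by linarith [Real.log_two_gt_d9]
      refine Real.exp_le_exp.2 ?_
      have : (n : ℝ) * (1 / 2) ≤ n * Real.log 2 := by gcongr
      linarith
    have h7 : ((Nat.factorial 3 : ℕ) : ℝ) = 6 := by norm_num [Nat.factorial]
    rw [h7] at h4
    exact h4.trans h5
  have h8 : (5 : ℝ) * d ≤ n := by exact_mod_cast h1
  push_cast
  have h9 : (5 * d : ℝ) ^ 2 ≤ n ^ 2 := by gcongr
  have h10 : (n : ℝ) ^ 2 * 1 ≤ n ^ 2 * (ε * n) := by gcongr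
  have h11 : ε * ((n / 2 : ℝ) ^ 3 / 6) ≤ ε * 2 ^ n := by gcongr
  nlinarith

/-- Under the root the term linear in R is, up to constants, at most the product of αR and bε√l/α,
so AM–GM bounds the root by αR/20 + 80bε√l/α. Five times this uses up half of the contraction α/2
and contributes 400 to the constant 403; the mean contributes the other 3. -/
theorem descent_recursion {l b R : ℝ} (hα : 0 < α) (hα1 : α ≤ 1) (hε : 0 < ε)
    (hεα : 10000 * ε ≤ α ^ 2) (hl : 1 ≤ l) (hb : 0 < b) (hR : 0 ≤ R) :
    (1 - α / 2) * R + 3 * b * (ε * Real.sqrt l) +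
      5 * Real.sqrt (ε * (2 * (3000 * b ^ 2 * (ε * l)) + 5 * b * R + 6 * R ^ 2)) ≤
    (1 - α / 4) * R + 403 * b * (ε * Real.sqrt l) / α := by
  set s := Real.sqrt l with hs
  have hs1 : 1 ≤ s := Real.one_le_sqrt.2 hl
  have hsq : s ^ 2 = l := Real.sq_sqrt (by linarith)
  have hx : 0 ≤ b * (ε * s) := by positivity
  set x := b * (ε * s) with hxdef
  have hxα : x ≤ x / α := le_div_self hx hα hα1
  have key : Real.sqrt (ε * (2 * (3000 * b ^ 2 * (ε * l)) + 5 * b * R + 6 * R ^ 2)) ≤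
      α * R / 20 + 80 * (x / α) := by
    refine Real.sqrt_le_iff.2 ⟨by positivity, ?_⟩
    have e1 : (α * R / 20 + 80 * (x / α)) ^ 2 =
        α ^ 2 * R ^ 2 / 400 + 8 * (x * R) + 6400 * (x / α) ^ 2 := by
      field_simp; ring
    have e2 : ε * (2 * (3000 * b ^ 2 * (ε * l)) + 5 * b * R + 6 * R ^ 2) =
        6000 * x ^ 2 + 5 * (b * ε * R) + 6 * (ε * R ^ 2) := by
      rw [← hsq, hxdef]; ring
    have e3 : b * ε * R * 1 ≤ b * ε * R * s := by gcongr
    have e4 : x * R = b * ε * R * s := by rw [hxdef]; ring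
    have e5 : x ^ 2 ≤ (x / α) ^ 2 := by gcongr
    have e6 : 10000 * ε * R ^ 2 ≤ α ^ 2 * R ^ 2 := by gcongr
    have e7 : 0 ≤ b * ε * R := by positivity
    have e8 : 0 ≤ α ^ 2 * R ^ 2 := by positivity
    rw [e1, e2, e4]
    nlinarith [sq_nonneg x]
  have e9 : 403 * b * (ε * s) / α = 403 * (x / α) := by rw [hxdef]; ring
  have e10 : 3 * b * (ε * s) = 3 * x := by rw [hxdef]; ring
  rw [e9, e10]
  linarith

/-- The error after one step of the descent. -/
theorem GoodSample.descent {X Z : Fin n → Fin d → ℝ} {μ u u₀ u' : Fin d → ℝ}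
    (h : GoodSample X μ α ρ ε) (hd : 0 < d) (hα : 0 < α) (hα1 : α ≤ 1) (hρ : 0 < ρ)
    (hε : 0 < ε) (hl : 1 ≤ Real.log (1 / ε)) (hεl : 3000 * (ε * Real.log (1 / ε)) ≤ 1)
    (hεα : 10000 * ε ≤ α ^ 2) (hnd : 5 * d ≤ n) (hεn : 1 ≤ ε * n)
    {G : Finset (Fin n)} (hG : (Gᶜ.card : ℝ) ≤ ε * n) (hGZ : ∀ i ∈ G, Z i = X i)
    (hu : ∀ j, |u j - μ j| ≤ 2 * ρ) (hu₀ : ∀ j, |u₀ j - μ j| ≤ ρ)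
    {w : ℕ → Fin n → ℝ} {M : ℕ → ℝ}
    (hrun : IsFilterRun (fun i j => clip (3 * ρ) (Z i j - u j)) (3 * ρ) ε (2 ^ n) w M)
    {w' : Fin n → ℝ} (hw0 : ∀ i, 0 ≤ w' i) (hw1 : ∀ i, w' i ≤ 1)
    (hw : ∑ i, (1 - w' i) ≤ 2 * ε * n)
    (hbest : ∀ t < n, ∑ i, (1 - w t i) ≤ 2 * ε * n →
      excess w' (fun i j => clip (3 * ρ) (Z i j - u j)) (3 * ρ) (2 ^ n) ≤
        excess (w t) (fun i j => clip (3 * ρ) (Z i j - u j)) (3 * ρ) (2 ^ n))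
    (hu' : ∀ j, u' j = u₀ j + clip ρ
      (u j + (∑ i, w' i * clip (3 * ρ) (Z i j - u j)) / n - u₀ j)) :
    (∀ j, |u' j - μ j| ≤ 2 * ρ) ∧
      l2 (fun j => u' j - μ j) ≤ (1 - α / 4) * l2 (fun j => u j - μ j) +
        403 * (3 * ρ) * (ε * Real.sqrt (Real.log (1 / ε))) / α := by
  have hn : 0 < n := by omega
  have : Nonempty (Fin n) := ⟨⟨0, hn⟩⟩
  have : Nonempty (Fin d) := ⟨⟨0, hd⟩⟩
  have hcard : (Fintype.card (Fin n) : ℝ) = n := by simp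
  have hn' : (0 : ℝ) < n := by exact_mod_cast hn
  set b := 3 * ρ with hb
  have hb0 : 0 < b := by positivity
  set l := Real.log (1 / ε) with hldef
  set E := 3000 * b ^ 2 * (ε * l) with hE
  set R := l2 (fun j => u j - μ j) with hR
  have hR0 : 0 ≤ R := l2_nonneg _
  set L := 2 * E + 5 * b * R + 6 * R ^ 2 with hL
  have hE0 : 0 ≤ E := by positivity
  have hEb : E ≤ b ^ 2 := by
    have : b ^ 2 * (3000 * (ε * l)) ≤ b ^ 2 * 1 := by gcongr
    rw [hE]; linarith
  have hL0 : 0 ≤ L := by positivity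
  have hεE : ε * b ^ 2 ≤ L := by
    have h1 : b ^ 2 * (ε * 1) ≤ b ^ 2 * (ε * l) := by gcongr
    have h2 : 0 ≤ 5 * b * R + 6 * R ^ 2 := by positivity
    have h3 : 0 ≤ b ^ 2 * (ε * l) := by positivity
    rw [hL, hE]; linarith
  have hε1 : 4 * ε ≤ 1 := by nlinarith
  have hreg : Regular (fun i j => clip b (X i j - u j)) ε L := by
    refine h.regular.perturb hb0 hR0 hE0 hEb (by linarith)
      (fun i j => abs_clip_le hb0.le _) (fun i j => abs_clip_le hb0.le _) fun i => ?_
    rw [hR, l2_sq]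
    refine Finset.sum_le_sum fun j _ => sq_le_sq.2 ?_
    refine (abs_clip_sub_le _ _ _).trans (le_of_eq ?_)
    rw [← abs_neg]; congr 1; ring
  have hGψ : ∀ i ∈ G, (fun j => clip b (Z i j - u j)) = fun j => clip b (X i j - u j) :=
    fun i hi => by rw [hGZ i hi]
  obtain ⟨t, ht, hts, hte⟩ := exists_small_excess (G := G) (ψ' := fun i j => clip b (Z i j - u j))
    (K := 2 ^ n) hreg hε.le (by linarith) hL0 hεE (by rw [hcard]; convert hG) hGψ
    (fun i j => abs_clip_le hb0.le _) hrun.zero (by simpa only [hcard] using hrun.step) hrun.nonneg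
    (by simpa only [hcard] using hrun.le) (by simpa only [hcard] using hrun.attained)
  rw [hcard] at hts
  rw [Fintype.card_fin] at ht
  have hexc := (hbest t ht hts).trans hte
  -- The error of the power method is at most εb² ≤ L.
  have htol : (Fintype.card (Fin d) : ℝ) * (Fintype.card (Fin d) * b ^ 2) / (2 * (2 ^ n : ℕ)) ≤
      L := by
    rw [Fintype.card_fin]
    refine (div_le_of_le_mul₀ (by positivity) (by positivity) ?_).trans hεE
    have := mul_le_mul_of_nonneg_right (sq_le_two_pow hε hnd hεn) (sq_nonneg b)
    linarith
  have hclose : ∀ v : Fin d → ℝ,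
      |∑ i, w' i * dotp v (fun j => clip b (Z i j - u j)) -
        ∑ i, dotp v (fun j => clip b (X i j - u j))| ≤
      Fintype.card (Fin n) * (5 * Real.sqrt (ε * L)) * Real.sqrt (sqNorm v) := fun v => by
    have h1 := offDiag_le_of_excess (K := 2 ^ n) (ψ := fun i j => clip b (Z i j - u j)) hb0
      (by positivity) hw0 hw1 (fun i j => abs_clip_le hb0.le _) v
    -- The bound 7L required here is 6L from the filter plus L from the power method.
    have h2 := weighted_mean_close hreg hL0 hε.le hεE (by rw [hcard]; convert hG) hGψ
      (fun i j => abs_clip_le hb0.le _) hw0 hw1 (by rw [hcard]; exact hw) v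
      (h1.trans (by have := sqNorm_nonneg v; gcongr; linarith))
    refine h2.trans (le_of_eq ?_)
    ring
  obtain ⟨r1, r2⟩ := descent_step (M := 3 * b * (ε * Real.sqrt l)) (α := α) hρ (by linarith)
    (by positivity) hu hu₀ (fun j => by rw [hcard]; exact h.count j)
    (by simpa only [hcard] using h.mean) hclose (by simpa only [hcard] using hu')
  exact ⟨r1, r2.trans (descent_recursion hα hα1 hε hεα hl hb0 hR0)⟩

end Deterministic

/-! ### Iterating the descent, and the final bound -/

section Main

variable {n d : ℕ} {α ρ ε δ : ℝ}

/-- Only e^(xT) ≥ xT is used: linear decay suffices for T = dn steps. -/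
theorem one_sub_pow_le {x : ℝ} (hx0 : 0 < x) (hx1 : x ≤ 1) {T : ℕ} (hT : 0 < T) :
    (1 - x) ^ T ≤ 1 / (x * T) := by
  have hT' : (0 : ℝ) < T := by exact_mod_cast hT
  calc (1 - x) ^ T ≤ Real.exp (-x) ^ T := by
        have := Real.one_sub_le_exp_neg x
        have h0 : 0 ≤ 1 - x := by linarith
        gcongr
    _ = 1 / Real.exp (x * T) := by
        rw [← Real.exp_nat_mul, one_div, ← Real.exp_neg]; congr 1; ring
    _ ≤ 1 / (x * T) := by
        have := Real.add_one_le_exp (x * T)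
        gcongr
        linarith

/-- The centre computed from a corrupted good sample is close to the location. -/
theorem GoodSample.exec_main {X Z : Fin n → Fin d → ℝ} {μ : Fin d → ℝ} {m : Mem}
    (h : GoodSample X μ α ρ ε) (hd : 0 < d) (hα : 0 < α) (hα1 : α ≤ 1) (hρ : 0 < ρ)
    (hε : 0 < ε) (hl : 1 ≤ Real.log (1 / ε)) (hεl : 3000 * (ε * Real.log (1 / ε)) ≤ 1)
    (hεα : 10000 * ε ≤ α ^ 2) (hnd : 5 * d ≤ n) (hεn : 8 ≤ ε * α * n)
    {G : Finset (Fin n)} (hG : (Gᶜ.card : ℝ) ≤ ε * n) (hGZ : ∀ i ∈ G, Z i = X i)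
    (hm0 : m 0 0 0 = ρ) (hm1 : m 1 0 0 = ε) (hm2 : block n d m 2 = Z) :
    l2 (fun j => row d (Cmd.main.exec n d m) 3 j - μ j) ≤
      5000 * ρ * (ε * Real.sqrt (Real.log (1 / ε))) / α ^ 2 := by
  have hn : 0 < n := by omega
  have hn' : (0 : ℝ) < n := by exact_mod_cast hn
  have hd' : (1 : ℝ) ≤ d := by exact_mod_cast hd
  set x := ε * Real.sqrt (Real.log (1 / ε)) with hx
  have hεx : ε ≤ x := le_mul_of_one_le_right hε.le (Real.one_le_sqrt.2 hl)
  have hx0 : 0 < x := hε.trans_le hεx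
  have hεn1 : 1 ≤ ε * n := by
    have : ε * n * α ≤ ε * n * 1 := by gcongr
    linarith
  set m₁ := (Cmd.assign 4 .one .dims .middle).exec n d m with hm₁
  set m₂ := (Cmd.assign 3 .one .dims (.cell 4 .zero (.var 1))).exec n d m₁ with hm₂
  set ms : ℕ → Mem := fun t => (Cmd.descent.exec n d)^[t] m₂ with hms
  have he : Cmd.main.exec n d m = ms (d * n) := by
    simp only [hms]
    rw [Function.iterate_mul]; rfl
  set u₀ : Fin d → ℝ := fun j => midAverage fun i => Z i j with hu₀def
  have hu₀ : ∀ j, |u₀ j - μ j| ≤ ρ := h.abs_midAverage_sub_le hn (by nlinarith) hG hGZ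
  have k₂ : ∀ a : Fin 16, a < 3 → m₂ a = m a := fun a ha => by
    rw [hm₂, exec_assign_of_ne (Fin.ne_of_lt ha), hm₁,
      exec_assign_of_ne (Fin.ne_of_lt (ha.trans (by decide)))]
  have r₁ : ∀ j : Fin d, m₁ 4 0 j = u₀ j := fun j => by
    rw [hm₁, exec_assign_self Nat.one_pos j.2, eval_middle, hm2]
  have r₂ : row d m₂ 4 = u₀ := by
    funext j
    rw [row, hm₂, exec_assign_of_ne (by decide), r₁]
  have c₂ : row d m₂ 3 = u₀ := by
    funext j
    rw [row, hm₂, exec_assign_self Nat.one_pos j.2]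
    exact r₁ j
  have hsucc : ∀ t, ms (t + 1) = Cmd.descent.exec n d (ms t) := fun t =>
    Function.iterate_succ_apply' _ _ _
  have inv : ∀ t, (∀ a : Fin 16, a < 5 → a ≠ 3 → ms t a = m₂ a) ∧
      (∀ j, |row d (ms t) 3 j - μ j| ≤ 2 * ρ) ∧
      l2 (fun j => row d (ms t) 3 j - μ j) ≤ (1 - α / 4) ^ t * (ρ * d) + 4836 * ρ * x / α ^ 2 := by
    intro t
    induction t with
    | zero =>
      refine ⟨fun _ _ _ => rfl, fun j => ?_, ?_⟩
      · change |row d m₂ 3 j - μ j| ≤ _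
        rw [c₂]; linarith [hu₀ j]
      · change l2 (fun j => row d m₂ 3 j - μ j) ≤ _
        rw [c₂, pow_zero, one_mul]
        have h1 : l2 (fun j => u₀ j - μ j) ≤ ρ * d := by
          refine Real.sqrt_le_iff.2 ⟨by positivity, ?_⟩
          calc sqNorm (fun j => u₀ j - μ j) ≤ ∑ _j : Fin d, ρ ^ 2 :=
                Finset.sum_le_sum fun j _ => sq_le_sq.2 (by rw [abs_of_pos hρ]; exact hu₀ j)
            _ = ρ ^ 2 * (d * 1) := by simp [mul_comm]
            _ ≤ ρ ^ 2 * (d * d) := by gcongr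
            _ = _ := by ring
        have h2 : 0 ≤ 4836 * ρ * x / α ^ 2 := by positivity
        linarith
    | succ t ih =>
      obtain ⟨i1, i2, i3⟩ := ih
      have s0 : ms t 0 0 0 = ρ := by rw [i1 0 (by decide) (by decide), k₂ 0 (by decide), hm0]
      have s1 : ms t 1 0 0 = ε := by rw [i1 1 (by decide) (by decide), k₂ 1 (by decide), hm1]
      have s2 : block n d (ms t) 2 = Z := by
        rw [← hm2]; funext i j
        simp only [block, i1 2 (by decide) (by decide), k₂ 2 (by decide)]
      have s4 : row d (ms t) 4 = u₀ := by
        rw [← r₂]; funext j; simp only [row, i1 4 (by decide) (by decide)]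
      obtain ⟨f, w, M, hrun, w', hw0, hw1, hw, hbest, hu'⟩ := exec_descent (n := n) (d := d)
        (m := ms t) (by rw [s0]; exact hρ.le) (by rw [s1]; exact hε.le)
        (ψ := fun i j => clip (3 * ρ) (Z i j - row d (ms t) 3 j))
        (fun i j => by rw [s0, s2])
      rw [s0, s1] at hrun hbest
      rw [s1] at hw
      rw [s0, s4] at hu'
      rw [hsucc]
      obtain ⟨g1, g2⟩ := h.descent hd hα hα1 hρ hε hl hεl hεα hnd hεn1 hG hGZ i2 hu₀ hrun hw0 hw1 hw
        hbest hu'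
      refine ⟨fun a ha ha3 => by rw [f a ha ha3, i1 a ha ha3], g1, g2.trans ?_⟩
      have h1 : (1 - α / 4) * l2 (fun j => row d (ms t) 3 j - μ j) ≤
          (1 - α / 4) * ((1 - α / 4) ^ t * (ρ * d) + 4836 * ρ * x / α ^ 2) :=
        mul_le_mul_of_nonneg_left i3 (by linarith)
      -- The number 4836 = 403 · 3 · 4 makes the additive term a fixed point of the recursion.
      have h2 : 403 * (3 * ρ) * x / α = α / 4 * (4836 * ρ * x / α ^ 2) := by field_simp; ring
      rw [h2, pow_succ (1 - α / 4)]
      linarith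
  rw [he]
  refine (inv (d * n)).2.2.trans ?_
  have h1 := one_sub_pow_le (x := α / 4) (by positivity) (by linarith) (Nat.mul_pos hd hn)
  -- The initial error is at most ρd, and the factor 4/(αdn) reduces it to 4ρ/(αn) ≤ ρε.
  have h2 : (1 - α / 4) ^ (d * n) * (ρ * d) ≤ ρ * x / α ^ 2 := by
    calc (1 - α / 4) ^ (d * n) * (ρ * d) ≤ 1 / (α / 4 * (d * n : ℕ)) * (ρ * d) := by gcongr
      _ = ρ * (4 / (α * n)) := by push_cast; field_simp
      _ ≤ ρ * ε := by
          gcongr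
          rw [div_le_iff₀ (by positivity)]; linarith
      _ ≤ ρ * x := by gcongr
      _ ≤ ρ * x / α ^ 2 := le_div_self (by positivity) (by positivity) (by nlinarith)
  have h3 : 0 ≤ ρ * x / α ^ 2 := by positivity
  have h4 : 4836 * ρ * x / α ^ 2 = 4836 * (ρ * x / α ^ 2) := by ring
  have h5 : 5000 * ρ * x / α ^ 2 = 5000 * (ρ * x / α ^ 2) := by ring
  rw [h4, h5]
  linarith

theorem GoodSample.norm_estimator_sub_le {X Z : Fin n → EuclideanSpace ℝ (Fin d)}
    {μ : EuclideanSpace ℝ (Fin d)}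
    (h : GoodSample (fun i j => X i j) μ α ρ ε) (hd : 0 < d) (hα : 0 < α) (hα1 : α ≤ 1) (hρ : 0 < ρ)
    (hε : 0 < ε) (hl : 1 ≤ Real.log (1 / ε)) (hεl : 3000 * (ε * Real.log (1 / ε)) ≤ 1)
    (hεα : 10000 * ε ≤ α ^ 2) (hnd : 5 * d ≤ n) (hεn : 8 ≤ ε * α * n) (hZ : IsCorruption ε X Z) :
    ‖Cmd.main.estimator n d ρ ε Z - μ‖ ≤
      5000 * ρ * (ε * Real.sqrt (Real.log (1 / ε))) / α ^ 2 := by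
  classical
  have e : Cmd.main.estimator n d ρ ε Z - μ = WithLp.toLp 2 (fun j => row d (Cmd.main.exec n d
      (visible (inputStore n d ρ ε Z).real)) 3 j - μ j) := rfl
  rw [e, ← l2_eq_norm]
  refine h.exec_main (Z := fun i j => Z i j) (G := Finset.univ.filter fun i => Z i = X i) hd hα hα1
    hρ hε hl hεl hεα hnd hεn ?_ (fun i hi => ?_) rfl rfl ?_
  · have h1 : Set.ncard {i | Z i = X i} = (Finset.univ.filter fun i => Z i = X i).card := by
      rw [← Set.ncard_coe_finset]; congr 1; ext i; simp
    have h2 := Finset.card_add_card_compl (Finset.univ.filter fun i => Z i = X i)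
    rw [Fintype.card_fin] at h2
    have h3 : ((Finset.univ.filter fun i => Z i = X i).card : ℝ) +
        ((Finset.univ.filter fun i => Z i = X i)ᶜ.card : ℝ) = n := by exact_mod_cast h2
    rw [IsCorruption, h1] at hZ
    linarith
  · rw [(Finset.mem_filter.1 hi).2]
  · funext i j
    exact dif_pos ⟨i.2, j.2⟩

/-- Write log(1/ε) = 2 log(1/√ε) and use log y ≤ y - 1. -/
theorem mul_log_inv_le (hε : 0 < ε) : ε * Real.log (1 / ε) ≤ 2 * Real.sqrt ε := by
  have hs : 0 < Real.sqrt ε := Real.sqrt_pos.2 hε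
  have hsq : Real.sqrt ε ^ 2 = ε := Real.sq_sqrt hε.le
  have h1 := Real.log_le_sub_one_of_pos (show 0 < 1 / Real.sqrt ε by positivity)
  have h2 : Real.log (1 / ε) = 2 * Real.log (1 / Real.sqrt ε) := by
    rw [← hsq, Real.sqrt_sq hs.le, ← one_div_pow, Real.log_pow]; norm_num
  calc ε * Real.log (1 / ε) ≤ ε * (2 * (1 / Real.sqrt ε)) := by rw [h2]; gcongr; linarith
    _ = 2 * Real.sqrt ε := by
        nth_rewrite 1 [← hsq]; field_simp

end Main

theorem mainTheorem5 :
    ∃ (p : Prog) (A : Estimator), ComputesInPolyTime p A ∧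
      ∃ C K : ℝ, 0 < C ∧ 0 < K ∧
        ∀ (n d : ℕ) (α ρ ε δ : ℝ) (μ : EuclideanSpace ℝ (Fin d))
          (D : Measure (EuclideanSpace ℝ (Fin d))) [IsProbabilityMeasure D],
          1 ≤ d → 0 < α → 0 < ρ → 0 < ε → 0 < δ → δ < 1 →
          (2 ≤ d ∨ δ ≤ 1 / 2) →
          IsSemiProductWithLocation α ρ μ D →
          ε ^ (1 / 3 : ℝ) ≤ α / C →
          C * ((d * Real.log d + Real.log (1 / δ)) / (α ^ 6 * ε ^ 2 * Real.log (1 / ε))) ≤ n →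
          -- the samples `X` are i.i.d. from `D`; outside an event of (outer) probability at most
          -- `δ`, the estimate is accurate whatever corruption `Z` the adversary chooses
          Measure.pi (fun _ : Fin n => D)
            {X | ¬ ∀ Z : Fin n → EuclideanSpace ℝ (Fin d), IsCorruption ε X Z →
              ‖A n d ρ ε Z - μ‖ ≤
                K * (ρ * (Real.sqrt ((d * Real.log d + Real.log (1 / δ)) / (α ^ 4 * n))
                  + ε * Real.sqrt (Real.log (1 / ε)) / α ^ 3))} ≤ ENNReal.ofReal δ := by
  refine ⟨Cmd.main.compile 2, Cmd.main.estimator, Cmd.main.computesInPolyTime, 1000, 5000,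
    by norm_num, by norm_num, ?_⟩
  intro n d α ρ ε δ μ D _ hd hα hρ hε hδ hδ1 hcase hD hεα hn
  have hm : Measurable fun y : EuclideanSpace ℝ (Fin d) => y - μ := by fun_prop
  have : IsProbabilityMeasure (D.map fun y => y - μ) :=
    Measure.isProbabilityMeasure_map hm.aemeasurable
  have hα1 : α ≤ 1 := (hD.mass ⟨0, hd⟩).trans measureReal_le_one
  have hd' : (1 : ℝ) ≤ d := by exact_mod_cast hd
  -- The constant C = 1000 is cubed. The smallness conditions on ε below follow from this bound.
  have hε3 : ε ≤ α ^ 3 / 10 ^ 9 := by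
    have h1 : (ε ^ (1 / 3 : ℝ)) ^ 3 ≤ (α / 1000) ^ 3 := by gcongr
    rw [← Real.rpow_natCast, ← Real.rpow_mul hε.le] at h1
    norm_num at h1
    linarith [h1, show (α / 1000) ^ 3 = α ^ 3 / 10 ^ 9 by ring]
  have hα3 : α ^ 3 ≤ 1 := pow_le_one₀ hα.le hα1
  have hα32 : α ^ 3 ≤ α ^ 2 := pow_le_pow_of_le_one hα.le hα1 (by norm_num)
  have hε9 : ε ≤ 1 / 10 ^ 9 := by linarith
  have hl : 1 ≤ Real.log (1 / ε) := by
    rw [Real.le_log_iff_exp_le (by positivity), le_div_iff₀ hε]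
    have := Real.exp_one_lt_d9
    nlinarith
  have hsqrt : Real.sqrt ε ≤ 1 / 10 ^ 4 := Real.sqrt_le_iff.2 ⟨by norm_num, by linarith⟩
  have hεl : 3000 * (ε * Real.log (1 / ε)) ≤ 1 := by linarith [mul_log_inv_le hε]
  set l := Real.log (1 / ε) with hldef
  set Λ := d * Real.log d + Real.log (1 / δ) with hΛ
  have hlogd : 0 ≤ d * Real.log d := mul_nonneg (by linarith) (Real.log_nonneg hd')
  have hlogδ : 0 ≤ Real.log (1 / δ) := Real.log_nonneg (by rw [le_div_iff₀ hδ]; linarith)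
  -- For d = 1 the term d log d vanishes and the lower bound on Λ comes from δ ≤ 1/2. This bound
  -- also yields n ≥ 5d below.
  have hdlog : d * Real.log 2 ≤ Λ := by
    rcases Nat.lt_or_ge d 2 with h | h
    · have hd1 : d = 1 := by omega
      have hδ2 : δ ≤ 1 / 2 := hcase.resolve_left (by omega)
      have : Real.log 2 ≤ Real.log (1 / δ) :=
        Real.log_le_log (by norm_num) (by rw [le_div_iff₀ hδ]; linarith)
      rw [hΛ, hd1]; simpa using this
    · have h1 : Real.log 2 ≤ Real.log d := Real.log_le_log (by norm_num) (by exact_mod_cast h)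
      have h2 : d * Real.log 2 ≤ d * Real.log d := by gcongr
      linarith
  have hlog2 : 1 / 2 ≤ Real.log 2 := by linarith [Real.log_two_gt_d9]
  have hdΛ : d / 2 ≤ Λ := by nlinarith
  have hlogΛ : Real.log 2 ≤ Λ := by nlinarith
  have hsize : 1000 * Λ ≤ n * (α ^ 6 * ε ^ 2 * l) := by
    rw [← mul_div_assoc, div_le_iff₀ (by positivity)] at hn
    exact hn
  have hn0 : (0 : ℝ) ≤ n := Nat.cast_nonneg n
  have hα6 : α ^ 6 ≤ 1 := pow_le_one₀ hα.le hα1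
  have hα62 : α ^ 6 ≤ α ^ 2 := pow_le_pow_of_le_one hα.le hα1 (by norm_num)
  have hα61 : α ^ 6 ≤ α := pow_le_of_le_one hα.le hα1 (by norm_num)
  have hεl1 : ε * l ≤ 1 := by linarith
  -- Three weakenings of the sample size follow: for the grid events, for the number of descent
  -- steps, and for the coordinate counts.
  have hsize₁ : 1000 * Λ ≤ n * (ε ^ 2 * l) := hsize.trans (by
    have : n * (ε ^ 2 * l) * α ^ 6 ≤ n * (ε ^ 2 * l) * 1 := by gcongr
    linarith)
  have hsize₂ : 1000 * Λ ≤ ε * α * n := hsize.trans (by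
    calc n * (α ^ 6 * ε ^ 2 * l) = n * ε * (α ^ 6 * (ε * l)) := by ring
      _ ≤ n * ε * (α * 1) := by gcongr
      _ = _ := by ring)
  have hsize₃ : 1000 * Λ ≤ n * α ^ 2 := hsize.trans (by
    calc n * (α ^ 6 * ε ^ 2 * l) = n * (α ^ 6 * (ε * (ε * l))) := by ring
      _ ≤ n * (α ^ 2 * (1 * 1)) := by gcongr; linarith
      _ = _ := by ring)
  have hnd : 5 * d ≤ n := by
    have h1 : (n : ℝ) * α ^ 2 ≤ n * 1 := by
      gcongr; exact pow_le_one₀ hα.le hα1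
    have : (5 * d : ℝ) ≤ n := by linarith
    exact_mod_cast this
  refine (measure_mono fun X hX => ?_).trans (measure_not_goodSample_le (Λ := Λ) hD hd (by omega) hα
    hα1 hρ hε (by linarith) hδ hl hεl1 hlogΛ (by linarith) (by linarith) (by linarith)
    (by linarith))
  refine fun hgood => hX fun Z hZ => ?_
  refine (hgood.norm_estimator_sub_le hd hα hα1 hρ hε hl hεl (by linarith) hnd (by linarith)
    hZ).trans ?_
  have h1 : ε * Real.sqrt l / α ^ 2 ≤ ε * Real.sqrt l / α ^ 3 := by gcongr
  have h2 := Real.sqrt_nonneg (Λ / (α ^ 4 * n))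
  -- The 0 makes room for the sampling term of the claim. For samples of the assumed size, sampling
  -- errors are already covered by the corruption term.
  calc 5000 * ρ * (ε * Real.sqrt l) / α ^ 2 = 5000 * (ρ * (0 + ε * Real.sqrt l / α ^ 2)) := by ring
    _ ≤ _ := by gcongr
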